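/- **Polynomial identifiability of hidden Markov models.** Consider a discrete stationary hidden Markov model with $R$ hidden states and $n$ possible observations: the hidden chain $Z_1\to Z_2\to\cdots$ on $[R]$ has transition matrix $P\in\mathbb R^{R\times R}$, $P_{ij}=\Pr[Z_{t+1}=i\mid Z_t=j]$, and starts in a stationary distribution $w=(w_r)_{r\in[R]}$, and, given the hidden states, the observations $X_t\in[n]$ are independent with $\Pr[X_t=i\mid Z_t=r]=M_{ir}$, $M\in\mathbb R^{n\times R}$. For a matrix $A$ let $\sigma_j(A)$ be its $j$-th largest singular value, and for $\tau>0$ let the $\tau$-robust Kruskal rank $\text{K-rank}_\tau(A)$ be the largest $k$, at most the number of columns of $A$, such that every submatrix $A_S$ formed by $k$ columns of $A$ satisfies $\sigma_k(A_S)\ge 1/\tau$. Write $\log^+x=\max\{0,\log x\}$. Fix a constant $\delta>0$ and put $m=2\lceil 1/\delta\rceil+3$. For every $c\in\mathbb N$ there are a polynomial $\vartheta$ in five variables, a constant $K$ and an algorithm (a program of a real random access machine with unit-cost arithmetic, comparison and array access), all depending only on $\delta$ and $c$, such that the following holds for all $n,R$, all $\gamma_1,\gamma_2,\tau,\eta>0$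 and every hidden Markov model as above for which 1. $w_r>\gamma_1$ for all $r\in[R]$; 2. $\text{K-rank}_\tau(M)\ge k\ge\delta R$ for some integer $k$ with $(\lceil 1/\delta\rceil+1)(k-1)+1\ge R$ (the last inequality follows from $k\ge\delta R$ if $R\ge 1/\delta^2$, and it always holds if $k\ge\delta R+1$); 3. $\sigma_R(P)\ge\gamma_2$. Given $n,R,\eta,\tau,\gamma_1,\gamma_2$ and $$N=\Big\lceil\vartheta\Big(\frac1\eta,R,n,\tau,\frac1{\gamma_1\gamma_2}\Big)\Big\rceil$$ independent samples, each consisting of $m$ consecutive observations of the model (and given the number $N$), the algorithm outputs, with probability at least $1-n^{-c}$, matrices $M',P'$ and weights $(\tilde w_r)_{r\in[R]}$ such that, up to one common renaming of the hidden states, $$\|M-M'\|_F\le\eta,\qquad \|P-P'\|_F\le\eta,\qquad |w_r-\tilde w_r|<\eta\quad\text{for all } r\in[R].$$ Moreover, on every sample sequence the algorithm halts after at most $$K\cdot n^{K R^2\log^+\left(\frac1{\eta\gamma_1}\right)}\left(\frac{n\,\tau}{\gamma_1\gamma_2}\right)^{K}$$ steps. -/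

import Mathlib

open scoped BigOperators

noncomputable section

/-! ### Singular values, robust Kruskal rank, Frobenius norm -/

/-- `σ_j(A)`, the `j`-th largest singular value of a real matrix, counted from `j = 1`
(it is `0` when `j` exceeds the rank of `A`). -/
def singVal {m n : Type} [Fintype m] [Fintype n] [DecidableEq n]
    (j : ℕ) (A : Matrix m n ℝ) : ℝ :=
  (Matrix.toEuclideanLin A).singularValues (j - 1)

/-- The `τ`-robust Kruskal rank of an `n × R` matrix: the largest `k ≤ R` such that every
`n × k` submatrix `A_S` (`S` a set of `k` columns) satisfies `σ_k(A_S) ≥ 1 / τ`. -/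
def robustKRank {n R : ℕ} (τ : ℝ) (A : Matrix (Fin n) (Fin R) ℝ) : ℕ :=
  sSup {k : ℕ | k ≤ R ∧ ∀ S : Finset (Fin R), S.card = k →
    1 / τ ≤ singVal k (A.submatrix id (fun r : {r // r ∈ S} => (r : Fin R)))}

open scoped Matrix.Norms.Frobenius in
/-- The Frobenius norm of a real matrix. -/
def frobNorm {m n : ℕ} (A : Matrix (Fin m) (Fin n) ℝ) : ℝ := ‖A‖

/-! ### Discrete stationary hidden Markov models -/

/-- A discrete stationary hidden Markov model with `R` hidden states and `n` possible
observations.  Column `r` of `P` is the law of the next hidden state, and column `r` of `M` the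
law of the observation, when the current hidden state is `r`; `w` is a stationary law of the
hidden chain. -/
structure HMM (n R : ℕ) where
  /-- stationary distribution of the hidden chain -/
  w : Fin R → ℝ
  /-- transition matrix, `P i j = Pr[Z_{t+1} = i | Z_t = j]` -/
  P : Matrix (Fin R) (Fin R) ℝ
  /-- observation matrix, `M i r = Pr[X_t = i | Z_t = r]` -/
  M : Matrix (Fin n) (Fin R) ℝ
  w_nonneg : ∀ r, 0 ≤ w r
  w_sum : ∑ r, w r = 1
  P_nonneg : ∀ i j, 0 ≤ P i j
  P_sum : ∀ j, ∑ i, P i j = 1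
  M_nonneg : ∀ i r, 0 ≤ M i r
  M_sum : ∀ r, ∑ i, M i r = 1
  stationary : P.mulVec w = w

namespace HMM

variable {n R : ℕ}

/-- `Pr[Z_0 = z_0, …, Z_ℓ = z_ℓ, X_0 = x_0, …, X_ℓ = x_ℓ]`: the joint law of `ℓ + 1`
consecutive hidden states and observations. -/
def jointProb (H : HMM n R) {ℓ : ℕ} (z : Fin (ℓ + 1) → Fin R) (x : Fin (ℓ + 1) → Fin n) : ℝ :=
  H.w (z 0) * (∏ t : Fin ℓ, H.P (z t.succ) (z t.castSucc)) * ∏ t, H.M (x t) (z t)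

/-- `Pr[X_0 = x_0, …, X_ℓ = x_ℓ]`: the law of `ℓ + 1` consecutive observations. -/
def obsProb (H : HMM n R) {ℓ : ℕ} (x : Fin (ℓ + 1) → Fin n) : ℝ :=
  ∑ z : Fin (ℓ + 1) → Fin R, H.jointProb z x

open Classical in
/-- The probability that `N` independent samples, each consisting of `ℓ + 1` consecutive
observations of the model, lie in the event `E`. -/
def sampleProb (H : HMM n R) {ℓ N : ℕ} (E : Set (Fin N → Fin (ℓ + 1) → Fin n)) : ℝ :=
  ∑ S : Fin N → Fin (ℓ + 1) → Fin n, if S ∈ E then ∏ s, H.obsProb (S s) else 0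

/-- `P'`, `M'`, `w'` are `η`-accurate estimates of the parameters of the model, up to a renaming
of the hidden states. -/
def Approx (H : HMM n R) (η : ℝ) (P' : Matrix (Fin R) (Fin R) ℝ) (M' : Matrix (Fin n) (Fin R) ℝ)
    (w' : Fin R → ℝ) : Prop :=
  ∃ π : Equiv.Perm (Fin R),
    frobNorm (H.M.submatrix id π - M') ≤ η ∧
    frobNorm (H.P.submatrix π π - P') ≤ η ∧
    ∀ r, |H.w (π r) - w' r| < η

end HMM

/-! ### Real random access machine

Algorithms are finite programs of a real random access machine with a unit-cost measure: the
memory has arrays of natural numbers (for indices and discrete data) and arrays of real numbers;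
the operations are arithmetic, comparison and (indirect) array access.  The constants of a
program are natural numbers, and there is no operation that turns reals into integers. -/

namespace RealRAM

/-- Memory: `nat a i` and `real a i` are the `i`-th entries of the `a`-th array of natural
numbers and of the `a`-th array of reals. -/
structure Mem where
  nat : ℕ → ℕ → ℕ
  real : ℕ → ℕ → ℝ

/-- Natural number expressions (`sub` is truncated subtraction). -/
inductive NatExpr : Type
  | const (k : ℕ)
  | read (a : ℕ) (i : NatExpr)
  | add (e f : NatExpr)
  | sub (e f : NatExpr)
  | mul (e f : NatExpr)

/-- Real expressions (division by zero returns zero). -/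
inductive RealExpr : Type
  | ofNat (e : NatExpr)
  | read (a : ℕ) (i : NatExpr)
  | add (e f : RealExpr)
  | sub (e f : RealExpr)
  | mul (e f : RealExpr)
  | div (e f : RealExpr)

/-- Tests `e < f`. -/
inductive Test : Type
  | natLt (e f : NatExpr)
  | realLt (e f : RealExpr)

/-- Programs; `setNat a i e` and `setReal a i e` store the value of `e` in the entry of array `a`
whose index is the value of `i`. -/
inductive Prog : Type
  | skip
  | setNat (a : ℕ) (i e : NatExpr)
  | setReal (a : ℕ) (i : NatExpr) (e : RealExpr)
  | seq (p q : Prog)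
  | branch (b : Test) (p q : Prog)
  | loop (b : Test) (p : Prog)

/-- Value of an expression. -/
def NatExpr.eval (s : Mem) : NatExpr → ℕ
  | const k => k
  | read a i => s.nat a (i.eval s)
  | add e f => e.eval s + f.eval s
  | sub e f => e.eval s - f.eval s
  | mul e f => e.eval s * f.eval s

/-- Number of operations that it takes to evaluate an expression. -/
def NatExpr.cost : NatExpr → ℕ
  | const _ => 1
  | read _ i => i.cost + 1
  | add e f => e.cost + f.cost + 1
  | sub e f => e.cost + f.cost + 1
  | mul e f => e.cost + f.cost + 1

/-- Value of an expression. -/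
def RealExpr.eval (s : Mem) : RealExpr → ℝ
  | ofNat e => (e.eval s : ℝ)
  | read a i => s.real a (i.eval s)
  | add e f => e.eval s + f.eval s
  | sub e f => e.eval s - f.eval s
  | mul e f => e.eval s * f.eval s
  | div e f => e.eval s / f.eval s

/-- Number of operations that it takes to evaluate an expression. -/
def RealExpr.cost : RealExpr → ℕ
  | ofNat e => e.cost + 1
  | read _ i => i.cost + 1
  | add e f => e.cost + f.cost + 1
  | sub e f => e.cost + f.cost + 1
  | mul e f => e.cost + f.cost + 1
  | div e f => e.cost + f.cost + 1

/-- Truth of a test. -/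
def Test.Holds (s : Mem) : Test → Prop
  | natLt e f => e.eval s < f.eval s
  | realLt e f => e.eval s < f.eval s

/-- Number of operations of a test. -/
def Test.cost : Test → ℕ
  | natLt e f => e.cost + f.cost + 1
  | realLt e f => e.cost + f.cost + 1

/-- The memory after `v` has been stored in entry `i` of the array `a` of natural numbers. -/
def Mem.setNat (s : Mem) (a i v : ℕ) : Mem :=
  { s with nat := Function.update s.nat a (Function.update (s.nat a) i v) }

/-- The memory after `v` has been stored in entry `i` of the array `a` of reals. -/
def Mem.setReal (s : Mem) (a i : ℕ) (v : ℝ) : Mem :=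
  { s with real := Function.update s.real a (Function.update (s.real a) i v) }

/-- `Exec p s t s'`: started in memory `s`, the program `p` halts after exactly `t` steps, with
memory `s'`. -/
inductive Exec : Prog → Mem → ℕ → Mem → Prop
  | skip (s : Mem) : Exec .skip s 1 s
  | setNat (s : Mem) (a : ℕ) (i e : NatExpr) :
      Exec (.setNat a i e) s (i.cost + e.cost + 1) (s.setNat a (i.eval s) (e.eval s))
  | setReal (s : Mem) (a : ℕ) (i : NatExpr) (e : RealExpr) :
      Exec (.setReal a i e) s (i.cost + e.cost + 1) (s.setReal a (i.eval s) (e.eval s))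
  | seq {p q : Prog} {s s₁ s₂ : Mem} {t₁ t₂ : ℕ} (hp : Exec p s t₁ s₁) (hq : Exec q s₁ t₂ s₂) :
      Exec (.seq p q) s (t₁ + t₂) s₂
  | branch_true {b : Test} {p q : Prog} {s s' : Mem} {t : ℕ} (hb : b.Holds s)
      (hp : Exec p s t s') : Exec (.branch b p q) s (b.cost + t) s'
  | branch_false {b : Test} {p q : Prog} {s s' : Mem} {t : ℕ} (hb : ¬ b.Holds s)
      (hq : Exec q s t s') : Exec (.branch b p q) s (b.cost + t) s'
  | loop_false {b : Test} {p : Prog} {s : Mem} (hb : ¬ b.Holds s) :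
      Exec (.loop b p) s b.cost s
  | loop_true {b : Test} {p : Prog} {s s₁ s₂ : Mem} {t₁ t₂ : ℕ} (hb : b.Holds s)
      (hp : Exec p s t₁ s₁) (hl : Exec (.loop b p) s₁ t₂ s₂) :
      Exec (.loop b p) s (b.cost + t₁ + t₂) s₂

/-- Initial memory of a learning algorithm.  The array `0` of natural numbers holds `n`, `R` and
the number `N` of samples, the array `1` holds the samples (entry `s * m + t` is the `t`-th
observation of the `s`-th sample), the array `0` of reals holds `η, τ, γ₁, γ₂`; everything else
is `0`. -/
def input (n R : ℕ) (η τ γ₁ γ₂ : ℝ) {N m : ℕ} (S : Fin N → Fin m → Fin n) : Mem where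
  nat a i :=
    if a = 0 then (if i = 0 then n else if i = 1 then R else if i = 2 then N else 0)
    else if a = 1 then
      (if h : i / m < N ∧ i % m < m then (S ⟨i / m, h.1⟩ ⟨i % m, h.2⟩ : ℕ) else 0)
    else 0
  real a i :=
    if a = 0 then
      (if i = 0 then η else if i = 1 then τ else if i = 2 then γ₁ else if i = 3 then γ₂ else 0)
    else 0

/-- The `n × R` matrix that is stored row by row in the array `a` of reals. -/
def Mem.matrix (s : Mem) (a n R : ℕ) : Matrix (Fin n) (Fin R) ℝ :=
  Matrix.of fun i r => s.real a ((i : ℕ) * R + r)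

/-- The vector that is stored in the array `a` of reals. -/
def Mem.vector (s : Mem) (a R : ℕ) : Fin R → ℝ := fun r => s.real a r

end RealRAM

end

/-! Put `q = ⌈1/δ⌉` and cut a window of `2q + 3` observations into a past block `I` of `q + 1`
observations, a middle observation `x` and a future block `J` of `q + 1` observations. Given the
hidden state `s` at the middle time the three are independent, so the law of the window is `p(I,x,J)
= ∑ s, U_I(s) M_x(s) V_J(s)`, where `U` is the joint law of the past block and `s`, and `V` is the
law of the future block given `s`.

Conditioning. The combinations of the rows of a block law form a space of functions on the hidden
states. Multiplying such a function by a combination of rows of `M` can make it vanish at any `k -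
1` prescribed further states, since `M` has Kruskal rank at least `k`. Hence one more observation
enlarges the space by `k - 1` dimensions until it has dimension `R` (`RowRep.khatriRao`), and a
barycentric spanner keeps all coefficients polynomially bounded. A transition is harmless because
`σ_R(P) ≥ γ₂`. As `1 + (q + 1)(k - 1) ≥ R`, blocks of length `q + 1` determine the state robustly:
`rowRep_futLaw` for the future and, by the same argument for the reversed chain, `rowRep_pastLaw`
for the past.

Isolating one state. For weights `α` on the observations let `μ_s` be the mean weight in state `s`.
For a vector `φ` on past blocks with `c_s = ∑ I, U_I(s) φ_I`, contraction of the law gives `∑ (α_x -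
λ) p(I,x,J) φ_I = ∑ s, V_J(s) (μ_s - λ) c_s`. Since `V` is bounded below, an approximate zero of
this expression with `∑ c_s = 1` forces `λ` to be close to some `μ_s`; if no other mean is near, `c`
is close to the unit vector of `s`. So `λ` is scanned over a grid, a linear system is solved at each
grid point, and the points with small residual are kept (`Mixture.candOk_of_close`,
`Mixture.exists_perm_of_selected`). Contracting marginals of `p` with such a `φ` yields column `s`
of `M`, of `V`, and of the law `F` of a block that starts in `s`. Finally `V = F P`, and `F w` is
the law of a block, which are well conditioned systems for `P` and `w` (`Mixture.output_approx`).

Finding the weights. All sums of `R²` multiples of unit vectors with integer coefficients at most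
`R²` are tried. A union bound over pairs of states shows that one of them separates all means
(`exists_separating_weightVec`). Their number is the only factor of the running time that is not
polynomial. A vector that yields `R` far apart grid points is good whether or not it was known to
separate.

Numerics. The machine has only arithmetic and comparisons, so linear systems are treated by
Landweber iteration, which needs no lower bound on singular values to make the residual small. A
single integer `B`, the rounded `D`-th root of the number of samples, serves as the scale: every
tolerance is a negative power of `B`, every time bound a positive one. Chebyshev's inequality makes
all empirical frequencies accurate to `B ^ (-37)`, and from there on the argument is deterministic
(`HMM.approx_of_empFreq`). -/

open scoped BigOperators

/-! ### Landweber iteration -/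

/-- Squared Euclidean norm of the restriction of `f` to `s`. -/
noncomputable def nsq {ι : Type*} (s : Finset ι) (f : ι → ℝ) : ℝ := ∑ i ∈ s, f i ^ 2

/-- Residual `A y - h` of a linear system. -/
noncomputable def lwResid {ι κ : Type*} (t : Finset ι) (A : κ → ι → ℝ) (h : κ → ℝ) (y : ι → ℝ)
    (J : κ) : ℝ := -h J + ∑ I ∈ t, A J I * y I

/-- Landweber iterates `y ← y - σ Aᵀ (A y - h)`, started at `0`. -/
noncomputable def lwIter {ι κ : Type*} (s : Finset κ) (t : Finset ι) (A : κ → ι → ℝ) (h : κ → ℝ)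
    (σ : ℝ) : ℕ → ι → ℝ
  | 0 => fun _ => 0
  | j + 1 => fun I => lwIter s t A h σ j I +
      ∑ J ∈ s, -(σ * A J I * lwResid t A h (lwIter s t A h σ j) J)

section nsq
variable {ι κ : Type*}

lemma nsq_nonneg (s : Finset ι) (f : ι → ℝ) : 0 ≤ nsq s f :=
  Finset.sum_nonneg fun _ _ => sq_nonneg _

lemma sq_le_nsq {s : Finset ι} (f : ι → ℝ) {i : ι} (hi : i ∈ s) : f i ^ 2 ≤ nsq s f :=
  Finset.single_le_sum (f := fun i => f i ^ 2) (fun _ _ => sq_nonneg _) hi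

lemma nsq_congr {s : Finset ι} {f g : ι → ℝ} (h : ∀ i ∈ s, f i = g i) : nsq s f = nsq s g :=
  Finset.sum_congr rfl fun i hi => by rw [h i hi]

lemma nsq_le_card {s : Finset ι} {f : ι → ℝ} {c : ℝ} (h : ∀ i ∈ s, f i ^ 2 ≤ c) :
    nsq s f ≤ s.card * c := by
  simpa [nsq] using Finset.sum_le_card_nsmul s (fun i => f i ^ 2) c h

lemma nsq_smul (s : Finset ι) (c : ℝ) (f : ι → ℝ) : nsq s (fun i => c * f i) = c ^ 2 * nsq s f := by
  simp [nsq, Finset.mul_sum, mul_pow]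

lemma nsq_add_le (s : Finset ι) (f g : ι → ℝ) :
    nsq s (fun i => f i + g i) ≤ 2 * nsq s f + 2 * nsq s g := by
  simp only [nsq, Finset.mul_sum, ← Finset.sum_add_distrib]
  exact Finset.sum_le_sum fun i _ => by nlinarith [sq_nonneg (f i - g i)]

lemma sum_mul_sq_le_nsq (s : Finset ι) (f g : ι → ℝ) :
    (∑ i ∈ s, f i * g i) ^ 2 ≤ nsq s f * nsq s g :=
  Finset.sum_mul_sq_le_sq_mul_sq s f g

lemma nsq_apply_le (s : Finset κ) (t : Finset ι) (A : κ → ι → ℝ) (y : ι → ℝ) :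
    nsq s (fun J => ∑ I ∈ t, A J I * y I) ≤ (∑ J ∈ s, ∑ I ∈ t, A J I ^ 2) * nsq t y := by
  rw [Finset.sum_mul]
  exact Finset.sum_le_sum fun J _ => sum_mul_sq_le_nsq t (A J) y

lemma sum_sum_sq_le {s : Finset κ} {t : Finset ι} {A : κ → ι → ℝ} {e : ℝ}
    (h : ∀ J ∈ s, ∀ I ∈ t, |A J I| ≤ e) :
    ∑ J ∈ s, ∑ I ∈ t, A J I ^ 2 ≤ s.card * (t.card * e ^ 2) := by
  have : ∀ J ∈ s, ∑ I ∈ t, A J I ^ 2 ≤ t.card * e ^ 2 := fun J hJ =>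
    nsq_le_card fun I hI => sq_le_sq' (abs_le.1 (h J hJ I hI)).1 (abs_le.1 (h J hJ I hI)).2
  simpa using Finset.sum_le_card_nsmul s _ _ this

variable (s : Finset κ) (t : Finset ι) (A : κ → ι → ℝ) (h : κ → ℝ)

lemma lwResid_sub (y z : ι → ℝ) (J : κ) :
    lwResid t A h y J = lwResid t A h z J + ∑ I ∈ t, A J I * (y I - z I) := by
  simp only [lwResid, mul_sub, Finset.sum_sub_distrib]; ring

lemma lwResid_congr {y z : ι → ℝ} (hy : ∀ I ∈ t, y I = z I) (J : κ) :
    lwResid t A h y J = lwResid t A h z J := by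
  simp only [lwResid]
  rw [Finset.sum_congr rfl fun I hI => by rw [hy I hI]]

lemma lw_adjoint (x : ι → ℝ) (r : κ → ℝ) :
    ∑ I ∈ t, x I * ∑ J ∈ s, A J I * r J = ∑ J ∈ s, (∑ I ∈ t, A J I * x I) * r J := by
  simp only [Finset.mul_sum, Finset.sum_mul]
  rw [Finset.sum_comm]
  exact Finset.sum_congr rfl fun J _ => Finset.sum_congr rfl fun I _ => by ring

end nsq

section Landweber
variable {ι κ : Type*} (s : Finset κ) (t : Finset ι) (A : κ → ι → ℝ) (h : κ → ℝ) {C : ℝ}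

/-- One step of the iteration does not increase the residual, and it decreases the distance to
any `z` up to the residual of `z`. -/
lemma lw_step (hC : 0 < C) (hA : ∑ J ∈ s, ∑ I ∈ t, A J I ^ 2 ≤ C) (j : ℕ) (z : ι → ℝ) :
    nsq s (lwResid t A h (lwIter s t A h (1 / C) (j + 1))) ≤
      nsq s (lwResid t A h (lwIter s t A h (1 / C) j)) ∧
    C * nsq t (fun I => lwIter s t A h (1 / C) (j + 1) I - z I) +
      nsq s (lwResid t A h (lwIter s t A h (1 / C) j)) / 2 ≤
    C * nsq t (fun I => lwIter s t A h (1 / C) j I - z I) + 2 * nsq s (lwResid t A h z) := by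
  set y := lwIter s t A h (1 / C) j with hy
  set r := lwResid t A h y with hr
  set g : ι → ℝ := fun I => ∑ J ∈ s, A J I * r J with hg
  have hy1 : ∀ I, lwIter s t A h (1 / C) (j + 1) I = y I - g I / C := by
    intro I
    have e : lwIter s t A h (1 / C) (j + 1) I = y I + ∑ J ∈ s, -(1 / C * A J I * r J) := rfl
    have e2 : g I / C = ∑ J ∈ s, 1 / C * A J I * r J := by
      rw [hg, Finset.sum_div]
      exact Finset.sum_congr rfl fun J _ => by ring
    rw [e, Finset.sum_neg_distrib, e2]; ring
  have hgC : nsq t g ≤ C * nsq s r := by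
    refine (nsq_apply_le t s (fun I J => A J I) r).trans ?_
    rw [Finset.sum_comm]
    exact mul_le_mul_of_nonneg_right hA (nsq_nonneg _ _)
  have hAg : nsq s (fun J => ∑ I ∈ t, A J I * g I) ≤ C * nsq t g :=
    (nsq_apply_le s t A g).trans (mul_le_mul_of_nonneg_right hA (nsq_nonneg _ _))
  have adj : ∀ x : ι → ℝ, ∑ I ∈ t, x I * g I = ∑ J ∈ s, (∑ I ∈ t, A J I * x I) * r J := fun x =>
    lw_adjoint s t A x r
  constructor
  -- With `g = Aᵀ r` the new residual is `r - A g / C`. Its square is `‖r‖² - 2 ‖g‖² / C + ‖A g‖² /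
  -- C²`, and `‖A g‖² ≤ C ‖g‖²` because `C` dominates the squared Frobenius norm of `A`.
  · have e1 : ∀ J, lwResid t A h (lwIter s t A h (1 / C) (j + 1)) J
        = r J - (∑ I ∈ t, A J I * g I) / C := by
      intro J
      rw [lwResid_sub t A h _ y J, ← hr, sub_eq_add_neg, Finset.sum_div, ← Finset.sum_neg_distrib]
      congr 1
      exact Finset.sum_congr rfl fun I _ => by rw [hy1]; ring
    have e2 : nsq s (lwResid t A h (lwIter s t A h (1 / C) (j + 1))) =
        nsq s r - 2 / C * (∑ J ∈ s, (∑ I ∈ t, A J I * g I) * r J) +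
          1 / C ^ 2 * nsq s (fun J => ∑ I ∈ t, A J I * g I) := by
      simp only [nsq, Finset.mul_sum (s := s), ← Finset.sum_sub_distrib, ← Finset.sum_add_distrib]
      refine Finset.sum_congr rfl fun J _ => ?_
      rw [e1]; field_simp; ring
    have e3 : ∑ J ∈ s, (∑ I ∈ t, A J I * g I) * r J = nsq t g := by
      rw [← adj]; exact Finset.sum_congr rfl fun I _ => by ring
    have e4 : 1 / C ^ 2 * nsq s (fun J => ∑ I ∈ t, A J I * g I) ≤ 1 / C * nsq t g := by
      calc _ ≤ 1 / C ^ 2 * (C * nsq t g) := by gcongr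
        _ = 1 / C * nsq t g := by field_simp
    have : 0 ≤ 1 / C * nsq t g := mul_nonneg (by positivity) (nsq_nonneg _ _)
    rw [e2, e3]
    have : 2 / C * nsq t g = 2 * (1 / C * nsq t g) := by ring
    linarith
  · have e2 : C * nsq t (fun I => lwIter s t A h (1 / C) (j + 1) I - z I) =
        C * nsq t (fun I => y I - z I) - 2 * (∑ I ∈ t, (y I - z I) * g I) + 1 / C * nsq t g := by
      simp only [nsq, Finset.mul_sum (s := t), ← Finset.sum_sub_distrib, ← Finset.sum_add_distrib]
      refine Finset.sum_congr rfl fun J _ => ?_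
      rw [hy1]; field_simp; ring
    have e3 : ∑ I ∈ t, (y I - z I) * g I = nsq s r - ∑ J ∈ s, lwResid t A h z J * r J := by
      rw [adj, nsq, ← Finset.sum_sub_distrib]
      refine Finset.sum_congr rfl fun J _ => ?_
      have : ∑ I ∈ t, A J I * (y I - z I) = r J - lwResid t A h z J := by
        rw [hr, lwResid_sub t A h y z J]; ring
      rw [this]; ring
    have e4 : 1 / C * nsq t g ≤ nsq s r := by
      rw [one_div, inv_mul_le_iff₀ hC]; exact hgC
    -- Young's inequality, weighted so that half of the gain `‖r‖²` survives.
    have e5 : 2 * ∑ J ∈ s, lwResid t A h z J * r J ≤ nsq s r / 2 + 2 * nsq s (lwResid t A h z) := by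
      simp only [nsq, Finset.mul_sum, Finset.sum_div, ← Finset.sum_add_distrib]
      exact Finset.sum_le_sum fun J _ => by nlinarith [sq_nonneg (r J - 2 * lwResid t A h z J)]
    rw [e2, e3]
    linarith

/-- The steps telescope, and since residuals do not increase, the last one bounds all earlier ones
from below. The comparison vector `z` is arbitrary and no singular value enters. -/
lemma lw_bound (hC : 0 < C) (hA : ∑ J ∈ s, ∑ I ∈ t, A J I ^ 2 ≤ C) (z : ι → ℝ) (L : ℕ) :
    C * nsq t (fun I => lwIter s t A h (1 / C) L I - z I) +
      L * (nsq s (lwResid t A h (lwIter s t A h (1 / C) L)) / 2) ≤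
    C * nsq t z + L * (2 * nsq s (lwResid t A h z)) := by
  induction L with
  | zero => simp [lwIter, nsq]
  | succ L ih =>
    obtain ⟨h1, h2⟩ := lw_step s t A h hC hA L z
    have h3 : (L : ℝ) * (nsq s (lwResid t A h (lwIter s t A h (1 / C) (L + 1))) / 2) ≤
        L * (nsq s (lwResid t A h (lwIter s t A h (1 / C) L)) / 2) := by gcongr
    push_cast
    nlinarith

/-- From `lw_bound` without the distance term: if some moderate `z` nearly solves the system, the
iteration finds a near solution, however ill conditioned the system is. -/
lemma lw_resid_le (hC : 0 < C) (hA : ∑ J ∈ s, ∑ I ∈ t, A J I ^ 2 ≤ C) (z : ι → ℝ) {L : ℕ}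
    (hL : 0 < L) :
    nsq s (lwResid t A h (lwIter s t A h (1 / C) L)) ≤
      2 * C * nsq t z / L + 4 * nsq s (lwResid t A h z) := by
  have := lw_bound s t A h hC hA z L
  have h0 := mul_nonneg hC.le (nsq_nonneg t (fun I => lwIter s t A h (1 / C) L I - z I))
  have hL' : (0 : ℝ) < L := by exact_mod_cast hL
  rw [div_add' _ _ _ hL'.ne', le_div_iff₀ hL']
  linarith

/-- From `lw_bound` without the residual term. It bounds the iterates a priori, which keeps errors
in the matrix harmless. -/
lemma lw_dist_le (hC : 0 < C) (hA : ∑ J ∈ s, ∑ I ∈ t, A J I ^ 2 ≤ C) (z : ι → ℝ) (L : ℕ) :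
    nsq t (fun I => lwIter s t A h (1 / C) L I - z I) ≤
      nsq t z + 2 * L / C * nsq s (lwResid t A h z) := by
  have := lw_bound s t A h hC hA z L
  have h0 : 0 ≤ (L : ℝ) * (nsq s (lwResid t A h (lwIter s t A h (1 / C) L)) / 2) :=
    mul_nonneg (by positivity) (div_nonneg (nsq_nonneg _ _) (by norm_num))
  have e : C * (nsq t z + 2 * L / C * nsq s (lwResid t A h z)) =
      C * nsq t z + L * (2 * nsq s (lwResid t A h z)) := by field_simp
  refine le_of_mul_le_mul_left ?_ hC
  rw [e]; linarith

end Landweber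

/-! ### Spaces of functions that are represented by the rows of a matrix -/

lemma exists_submatrix_det_ne_zero {l R : ℕ} (N : Matrix (Fin l) (Fin R) ℝ)
    (hN : LinearIndependent ℝ N.row) : ∃ f : Fin l → Fin R, (N.submatrix id f).det ≠ 0 := by
  have h1 : Module.finrank ℝ (Submodule.span ℝ (Set.range N.col)) = l := by
    rw [← Matrix.rank_eq_finrank_span_cols, hN.rank_matrix, Fintype.card_fin]
  obtain ⟨f, hf, -, hli⟩ := Submodule.exists_fun_fin_finrank_span_eq ℝ (Set.range N.col)
  choose g hg using hf
  refine ⟨fun i => g (Fin.cast h1.symm i), ?_⟩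
  have h2 : LinearIndependent ℝ (N.submatrix id fun i => g (Fin.cast h1.symm i)).col := by
    have e : (N.submatrix id fun i => g (Fin.cast h1.symm i)).col = f ∘ Fin.cast h1.symm := by
      funext i
      exact hg (Fin.cast h1.symm i)
    rw [e]
    exact hli.comp _ (Fin.cast_injective _)
  rw [Matrix.linearIndependent_cols_iff_isUnit, Matrix.isUnit_iff_isUnit_det] at h2
  exact h2.ne_zero

/-- A subspace of `ℝ^R` of dimension `l` has a basis that is dual to `l` coordinates and whose
members have coordinates of modulus at most `1`. -/
lemma exists_barycentric_spanner {R : ℕ} (U : Submodule ℝ (Fin R → ℝ)) :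
    ∃ (I : Finset (Fin R)) (u : Fin R → Fin R → ℝ), I.card = Module.finrank ℝ U ∧
      ∀ i ∈ I, u i ∈ U ∧ (∀ j ∈ I, u i j = if j = i then 1 else 0) ∧ ∀ r, |u i r| ≤ 1 := by
  classical
  set l := Module.finrank ℝ U with hl
  let b := Module.finBasis ℝ U
  let N : Matrix (Fin l) (Fin R) ℝ := Matrix.of fun i r => (b i : Fin R → ℝ) r
  have hN : LinearIndependent ℝ N.row :=
    b.linearIndependent.map' U.subtype (Submodule.ker_subtype U)
  obtain ⟨f0, hf0⟩ := exists_submatrix_det_ne_zero N hN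
  have : Nonempty (Fin l → Fin R) := ⟨f0⟩
  -- The `l` coordinates are chosen to maximize the modulus of the minor. By Cramer's rule the
  -- entries of the dual basis are quotients of minors by the maximal one, hence of modulus at most
  -- `1`.
  obtain ⟨f, hf⟩ := Finite.exists_max fun f : Fin l → Fin R => |(N.submatrix id f).det|
  set D := N.submatrix id f with hD
  have hdet : D.det ≠ 0 := abs_pos.1 ((abs_pos.2 hf0).trans_le (hf f0))
  have hunit : IsUnit D.det := isUnit_iff_ne_zero.2 hdet
  have hfi : Function.Injective f := by
    intro i j hij
    by_contra hne
    exact hdet (Matrix.det_zero_of_column_eq hne fun k => by simp [hD, hij])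
  let v : Fin l → Fin R → ℝ := fun i r => ∑ j, D⁻¹ i j * (b j : Fin R → ℝ) r
  have hv : ∀ i j, v i (f j) = if j = i then 1 else 0 := by
    intro i j
    have := congrFun (congrFun (Matrix.nonsing_inv_mul D hunit) i) j
    rw [Matrix.mul_apply, Matrix.one_apply] at this
    simpa [v, hD, N, eq_comm] using this
  have hvb : ∀ i r, |v i r| ≤ 1 := by
    intro i r
    have e1 : v i r = (D⁻¹.mulVec (N.col r)) i := rfl
    have e2 : D⁻¹.mulVec (N.col r) = D.det⁻¹ • D.cramer (N.col r) := by
      rw [Matrix.cramer_eq_adjugate_mulVec, Matrix.inv_def, Matrix.smul_mulVec]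
      simp
    have e3 : D.updateCol i (N.col r) = N.submatrix id (Function.update f i r) := by
      ext a c
      by_cases h : c = i
      · subst h; simp
      · simp [Matrix.updateCol_ne h, Function.update_of_ne h, hD]
    rw [e1, e2, Pi.smul_apply, Matrix.cramer_apply, e3, smul_eq_mul, abs_mul, abs_inv,
      inv_mul_le_iff₀ (abs_pos.2 hdet), mul_one]
    exact hf _
  have hvU : ∀ i, v i ∈ U := by
    intro i
    have : v i = ∑ j, D⁻¹ i j • (b j : Fin R → ℝ) := by
      funext r; simp [v]
    rw [this]
    exact Submodule.sum_mem _ fun j _ => U.smul_mem _ (b j).2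
  rcases isEmpty_or_nonempty (Fin l) with hE | hE
  · refine ⟨∅, fun _ _ => 0, ?_, by simp⟩
    have : l = 0 := (Fintype.card_fin l).symm.trans Fintype.card_eq_zero
    simp [this]
  refine ⟨Finset.univ.image f, fun r => v (Function.invFun f r), ?_, ?_⟩
  · rw [Finset.card_image_of_injective _ hfi]; simp
  · simp only [Finset.mem_image, Finset.mem_univ, true_and, forall_exists_index,
      forall_apply_eq_imp_iff]
    intro i
    rw [Function.leftInverse_invFun hfi i]
    exact ⟨hvU i, fun j => by rw [hv]; simp [hfi.eq_iff], hvb i⟩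

/-- Every `u ∈ U` is a combination of the rows `B i`, `i ∈ s`, with coefficients of squared norm
at most `C` times that of `u`. -/
def RowRep {ι : Type*} {R : ℕ} (s : Finset ι) (B : ι → Fin R → ℝ) (U : Submodule ℝ (Fin R → ℝ))
    (C : ℝ) : Prop :=
  ∀ u ∈ U, ∃ Φ : ι → ℝ, (∀ r, ∑ i ∈ s, B i r * Φ i = u r) ∧ nsq s Φ ≤ C * nsq Finset.univ u

/-- Any column of a set of at most `k` columns has a dual vector of squared norm at most `T`. -/
def ColDual {ι : Type*} {R : ℕ} (s : Finset ι) (M : ι → Fin R → ℝ) (k : ℕ) (T : ℝ) : Prop :=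
  ∀ S : Finset (Fin R), S.card ≤ k → ∀ r₀ ∈ S, ∃ y : ι → ℝ,
    (∀ r ∈ S, ∑ x ∈ s, M x r * y x = if r = r₀ then 1 else 0) ∧ nsq s y ≤ T

lemma nsq_sum_le {ι κ : Type*} (s : Finset ι) (t : Finset κ) (f : κ → ι → ℝ) (a : κ → ℝ) :
    nsq s (fun i => ∑ k ∈ t, a k * f k i) ≤ nsq t a * ∑ k ∈ t, nsq s (f k) := by
  have : ∀ i ∈ s, (∑ k ∈ t, a k * f k i) ^ 2 ≤ nsq t a * ∑ k ∈ t, f k i ^ 2 :=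
    fun i _ => sum_mul_sq_le_nsq t a fun k => f k i
  refine (Finset.sum_le_sum this).trans ?_
  rw [← Finset.mul_sum, Finset.sum_comm]
  rfl

lemma nsq_product {ι κ : Type*} (s : Finset ι) (t : Finset κ) (f : ι → ℝ) (g : κ → ℝ) :
    nsq (s ×ˢ t) (fun p => f p.1 * g p.2) = nsq s f * nsq t g := by
  simp only [nsq, Finset.sum_product, mul_pow, ← Finset.mul_sum, ← Finset.sum_mul]

lemma sum_product_mul {ι κ : Type*} (s : Finset ι) (t : Finset κ) (a f : ι → ℝ) (b g : κ → ℝ) :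
    ∑ p ∈ s ×ˢ t, a p.1 * b p.2 * (f p.1 * g p.2) = (∑ i ∈ s, a i * f i) * ∑ k ∈ t, b k * g k := by
  rw [Finset.sum_product, Finset.sum_mul_sum]
  exact Finset.sum_congr rfl fun i _ => Finset.sum_congr rfl fun k _ => by ring

/-! ### Growth of represented spaces under products with observations -/

section growth
variable {ι κ : Type*} {R : ℕ}

/-- Products with the functions represented by `M` enlarge a represented space. -/
lemma RowRep.khatriRao {s : Finset ι} {t : Finset κ} {M : ι → Fin R → ℝ} {B : κ → Fin R → ℝ}
    {U : Submodule ℝ (Fin R → ℝ)} {k : ℕ} {T C C₁ : ℝ} (hk : 1 ≤ k)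
    (hT : 0 ≤ T) (hC : 0 ≤ C) (hM : ColDual s M k T) (hM1 : ∀ r, nsq s (fun x => M x r) ≤ 1)
    (hB : RowRep t B U C)
    (hB1 : ∃ Φ : κ → ℝ, (∀ r, ∑ i ∈ t, B i r * Φ i = 1) ∧ nsq t Φ ≤ C₁) :
    ∃ U' : Submodule ℝ (Fin R → ℝ), min R (Module.finrank ℝ U + (k - 1)) ≤ Module.finrank ℝ U' ∧
      RowRep (s ×ˢ t) (fun p r => M p.1 r * B p.2 r) U'
        (R * (2 * (T * C₁) + (R * T * 2 + 1) * (R * (T * (C * R))))) := by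
  classical
  obtain ⟨Φ₁, hΦ₁, hC₁⟩ := hB1
  -- `I` is a set of coordinates dual to a basis of `U`, and `J` consists of up to `k - 1` further
  -- states. The aim is a represented function for every member of `I ∪ J` that is `1` there and `0`
  -- at the other members; these functions are linearly independent.
  obtain ⟨I, u, hIc, hu⟩ := exists_barycentric_spanner U
  obtain ⟨J, hJ, hJc⟩ : ∃ J : Finset (Fin R), J ⊆ Iᶜ ∧ J.card = min (R - I.card) (k - 1) := by
    apply Finset.exists_subset_card_eq
    rw [Finset.card_compl, Fintype.card_fin]
    exact min_le_left _ _
  have hIJ : Disjoint I J := Finset.disjoint_left.2 fun r hr hr' => by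
    simpa [hr] using hJ hr'
  have hunu : ∀ i ∈ I, nsq Finset.univ (u i) ≤ R := by
    intro i hi
    have := nsq_le_card (s := Finset.univ) (f := u i) (c := 1) fun r _ => by
      rw [← sq_abs]
      exact pow_le_one₀ (abs_nonneg _) ((hu i hi).2.2 r)
    simpa using this
  -- the functions attached to the members of `I`
  have h1 : ∀ i ∈ I, ∃ Ψ : ι × κ → ℝ, nsq (s ×ˢ t) Ψ ≤ T * (C * R) ∧
      (∀ r ∈ I ∪ J, ∑ p ∈ s ×ˢ t, M p.1 r * B p.2 r * Ψ p = if r = i then 1 else 0) := by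
    intro i hi
    have hiJ : i ∉ J := Finset.disjoint_left.1 hIJ hi
    -- The product of a combination of rows of `M` that is `1` at `i` and `0` on `J` with `u i`,
    -- which is already dual to `I`. At most `k` columns are involved.
    obtain ⟨y, hy, hyT⟩ := hM (insert i J)
      (by rw [Finset.card_insert_of_notMem hiJ]; omega) i (Finset.mem_insert_self _ _)
    obtain ⟨Φ, hΦ, hΦC⟩ := hB (u i) (hu i hi).1
    refine ⟨fun p => y p.1 * Φ p.2, ?_, ?_⟩
    · rw [nsq_product]
      exact mul_le_mul hyT (hΦC.trans (mul_le_mul_of_nonneg_left (hunu i hi) hC))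
        (nsq_nonneg _ _) hT
    · intro r hr
      rw [(sum_product_mul s t (fun x => M x r) y (fun J => B J r) Φ :), hΦ]
      by_cases hrJ : r ∈ J
      · rw [hy r (Finset.mem_insert_of_mem hrJ)]
        have : r ≠ i := fun h => hiJ (h ▸ hrJ)
        simp [this]
      · have hrI : r ∈ I := (Finset.mem_union.1 hr).resolve_right hrJ
        rw [(hu i hi).2.1 r hrI]
        split_ifs with h
        · subst h; rw [hy r (Finset.mem_insert_self _ _)]; simp
        · simp
  choose! Ψ hΨn hΨ using h1
  -- the functions attached to all members of `I ∪ J`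
  set D : ℝ := 2 * (T * C₁) + (R * T * 2 + 1) * (R * (T * (C * R))) with hD
  have hC₁0 : 0 ≤ C₁ := (nsq_nonneg _ _).trans hC₁
  have hIR : (I.card : ℝ) ≤ R := by
    exact_mod_cast (Finset.card_le_univ I).trans_eq (Fintype.card_fin R)
  have hX : 0 ≤ T * (C * R) := by positivity
  have hsumI : ∑ i ∈ I, nsq (s ×ˢ t) (Ψ i) ≤ R * (T * (C * R)) := by
    have := Finset.sum_le_card_nsmul I _ _ hΨn
    rw [nsmul_eq_mul] at this
    exact this.trans (mul_le_mul_of_nonneg_right hIR hX)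
  have h2 : ∀ j ∈ I ∪ J, ∃ Θ : ι × κ → ℝ, nsq (s ×ˢ t) Θ ≤ D ∧
      (∀ r ∈ I ∪ J, ∑ p ∈ s ×ˢ t, M p.1 r * B p.2 r * Θ p = if r = j then 1 else 0) := by
    intro j hj
    by_cases hjI : j ∈ I
    · refine ⟨Ψ j, ?_, hΨ j hjI⟩
      have hR : (1 : ℝ) ≤ R := by
        have : 0 < R := j.pos
        exact_mod_cast this
      have e1 : nsq (s ×ˢ t) (Ψ j) ≤ ∑ i ∈ I, nsq (s ×ˢ t) (Ψ i) :=
        Finset.single_le_sum (f := fun i => nsq (s ×ˢ t) (Ψ i)) (fun _ _ => nsq_nonneg _ _) hjI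
      have e2 : 0 ≤ T * C₁ := by positivity
      have e3 : 0 ≤ R * T * 2 * (R * (T * (C * R))) := by positivity
      linarith
    · have hjJ : j ∈ J := (Finset.mem_union.1 hj).resolve_left hjI
      -- For `j ∈ J` the product with the constant function `1` has the right values on `J`; its
      -- values `a i` on `I` are removed by subtracting the functions built for `I`.
      obtain ⟨y, hy, hyT⟩ := hM J (by omega) j hjJ
      let a : Fin R → ℝ := fun i => ∑ x ∈ s, M x i * y x
      refine ⟨fun p => y p.1 * Φ₁ p.2 + -1 * ∑ i ∈ I, a i * Ψ i p, ?_, ?_⟩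
      · refine (nsq_add_le _ _ _).trans ?_
        rw [nsq_smul, nsq_product]
        have ha : nsq I a ≤ R * T := by
          have : ∀ i ∈ I, a i ^ 2 ≤ T := fun i _ =>
            (sum_mul_sq_le_nsq s (fun x => M x i) y).trans
              (by nlinarith [hM1 i, nsq_nonneg s (fun x => M x i), nsq_nonneg s y])
          exact (nsq_le_card this).trans (mul_le_mul_of_nonneg_right hIR hT)
        have h3 := (nsq_sum_le (s ×ˢ t) I Ψ a).trans
          (mul_le_mul ha hsumI (Finset.sum_nonneg fun _ _ => nsq_nonneg _ _) (by positivity))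
        have h4 : nsq s y * nsq t Φ₁ ≤ T * C₁ := mul_le_mul hyT hC₁ (nsq_nonneg _ _) hT
        have e3 : 0 ≤ R * (T * (C * R)) := by positivity
        linarith
      · intro r hr
        have e1 : ∑ p ∈ s ×ˢ t, M p.1 r * B p.2 r * (y p.1 * Φ₁ p.2 + -1 * ∑ i ∈ I, a i * Ψ i p) =
            a r - ∑ i ∈ I, a i * (if r = i then 1 else 0) := by
          have e2 : ∑ i ∈ I, a i * (if r = i then (1 : ℝ) else 0) =
              ∑ p ∈ s ×ˢ t, M p.1 r * B p.2 r * ∑ i ∈ I, a i * Ψ i p := by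
            rw [Finset.sum_congr rfl fun i hi => by rw [← hΨ i hi r hr]]
            simp only [Finset.mul_sum]
            rw [Finset.sum_comm]
            exact Finset.sum_congr rfl fun p _ => Finset.sum_congr rfl fun i _ => by ring
          have e3 : a r = ∑ p ∈ s ×ˢ t, M p.1 r * B p.2 r * (y p.1 * Φ₁ p.2) := by
            rw [(sum_product_mul s t (fun x => M x r) y (fun J => B J r) Φ₁ :), hΦ₁, mul_one]
          rw [e2, e3, ← Finset.sum_sub_distrib]
          exact Finset.sum_congr rfl fun p _ => by ring
        rw [e1]
        by_cases hrI : r ∈ I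
        · have : r ≠ j := fun h => hjI (h ▸ hrI)
          simp [hrI, this]
        · have hrJ : r ∈ J := (Finset.mem_union.1 hr).resolve_left hrI
          have : ∑ i ∈ I, a i * (if r = i then (1 : ℝ) else 0) = 0 :=
            Finset.sum_eq_zero fun i hi => by
              have : r ≠ i := fun h => hrI (h ▸ hi)
              simp [this]
          rw [this, sub_zero]
          exact hy r hrJ
  choose! Θ hΘn hΘ using h2
  let f : Fin R → Fin R → ℝ := fun j r => ∑ p ∈ s ×ˢ t, M p.1 r * B p.2 r * Θ j p
  have hf : ∀ j ∈ I ∪ J, ∀ r ∈ I ∪ J, f j r = if r = j then 1 else 0 := fun j hj r hr => hΘ j hj r hr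
  have hD0 : 0 ≤ D := by positivity
  refine ⟨Submodule.span ℝ (Set.range fun j : {j // j ∈ I ∪ J} => f j), ?_, ?_⟩
  · have hli : LinearIndependent ℝ fun j : {j // j ∈ I ∪ J} => f j := by
      rw [Fintype.linearIndependent_iff]
      intro g hg i
      have := congrFun hg i
      rw [Finset.sum_apply] at this
      rw [Finset.sum_eq_single i] at this
      · simpa [hf i i.2 i i.2] using this
      · intro b _ hb
        have hne : (i : Fin R) ≠ b := fun h => hb (Subtype.ext h.symm)
        simp [hf b b.2 i i.2, hne]
      · simp
    rw [finrank_span_eq_card hli, Fintype.card_coe, Finset.card_union_of_disjoint hIJ, hJc, ← hIc]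
    have : I.card ≤ R := (Finset.card_le_univ I).trans_eq (Fintype.card_fin R)
    omega
  · intro v hv
    obtain ⟨c, hc⟩ := (Submodule.mem_span_range_iff_exists_fun ℝ).1 hv
    -- By duality the coefficients of `v` are values of `v`, so their norm is at most that of `v`.
    have hvc : ∀ j : {j // j ∈ I ∪ J}, v j = c j := by
      intro i
      rw [← hc, Finset.sum_apply, Finset.sum_eq_single i]
      · simp [hf i i.2 i i.2]
      · intro b _ hb
        have hne : (i : Fin R) ≠ b := fun h => hb (Subtype.ext h.symm)
        simp [hf b b.2 i i.2, hne]
      · simp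
    have hv2 : ∀ r, v r = ∑ j ∈ I ∪ J, v j * f j r := by
      intro r
      rw [← Finset.sum_coe_sort (I ∪ J) fun j => v j * f j r]
      conv_lhs => rw [← hc]
      rw [Finset.sum_apply]
      exact Finset.sum_congr rfl fun j _ => by rw [hvc j]; rfl
    refine ⟨fun p => ∑ j ∈ I ∪ J, v j * Θ j p, ?_, ?_⟩
    · intro r
      rw [hv2 r]
      simp only [f, Finset.mul_sum]
      rw [Finset.sum_comm]
      exact Finset.sum_congr rfl fun p _ => Finset.sum_congr rfl fun j _ => by ring
    · refine (nsq_sum_le _ _ Θ v).trans ?_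
      have e1 : nsq (I ∪ J) v ≤ nsq Finset.univ v :=
        Finset.sum_le_sum_of_subset_of_nonneg (Finset.subset_univ _) fun _ _ _ => sq_nonneg _
      have e2 : ∑ j ∈ I ∪ J, nsq (s ×ˢ t) (Θ j) ≤ R * D := by
        have := Finset.sum_le_card_nsmul (I ∪ J) _ _ hΘn
        rw [nsmul_eq_mul] at this
        refine this.trans (mul_le_mul_of_nonneg_right ?_ hD0)
        exact_mod_cast (Finset.card_le_univ (I ∪ J)).trans_eq (Fintype.card_fin R)
      rw [mul_comm]
      exact mul_le_mul e2 e1 (nsq_nonneg _ _) (by positivity)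

/-- Right multiplication by a well-conditioned square matrix. -/
lemma RowRep.mul_right {t : Finset κ} {B : κ → Fin R → ℝ} {U : Submodule ℝ (Fin R → ℝ)} {C c : ℝ}
    (hC : 0 ≤ C) (hB : RowRep t B U C) (P : Matrix (Fin R) (Fin R) ℝ)
    (hP : ∀ u : Fin R → ℝ, nsq Finset.univ u ≤ c * nsq Finset.univ (fun r => ∑ s, P s r * u s)) :
    ∃ U' : Submodule ℝ (Fin R → ℝ), Module.finrank ℝ U ≤ Module.finrank ℝ U' ∧
      RowRep t (fun J r => ∑ s, P s r * B J s) U' (C * c) := by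
  have hmul : ∀ (u : Fin R → ℝ) r, Matrix.mulVecLin P.transpose u r = ∑ s, P s r * u s :=
    fun u r => rfl
  have hinj : Function.Injective (Matrix.mulVecLin P.transpose) := by
    rw [injective_iff_map_eq_zero]
    intro u hu
    have h0 : nsq Finset.univ u ≤ 0 := by
      refine (hP u).trans ?_
      have : (fun r => ∑ s, P s r * u s) = fun _ => 0 := by
        funext r; rw [← hmul, hu]; rfl
      rw [this]; simp [nsq]
    funext r
    have := (sq_le_nsq u (Finset.mem_univ r)).trans h0
    exact pow_eq_zero_iff (two_ne_zero) |>.1 (le_antisymm this (sq_nonneg _))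
  refine ⟨U.map (Matrix.mulVecLin P.transpose), ?_, ?_⟩
  · exact (LinearEquiv.finrank_eq (Submodule.equivMapOfInjective _ hinj U)).le
  · rintro _ ⟨u, hu, rfl⟩
    obtain ⟨Φ, hΦ, hn⟩ := hB u hu
    refine ⟨Φ, fun r => ?_, ?_⟩
    · rw [hmul]
      simp only [← hΦ, Finset.mul_sum, Finset.sum_mul]
      rw [Finset.sum_comm]
      exact Finset.sum_congr rfl fun J _ => Finset.sum_congr rfl fun s _ => by ring
    · rw [mul_assoc]
      exact hn.trans (mul_le_mul_of_nonneg_left (hP u) hC)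

/-- A matrix that represents everything is bounded below. -/
lemma RowRep.nsq_le {t : Finset κ} {B : κ → Fin R → ℝ} {C : ℝ}
    (hC : 0 ≤ C) (hB : RowRep t B ⊤ C) (z : Fin R → ℝ) :
    nsq Finset.univ z ≤ C * nsq t (fun J => ∑ r, B J r * z r) := by
  obtain ⟨Φ, hΦ, hn⟩ := hB z trivial
  -- With `z` represented as `Bᵀ Φ` one has `‖z‖² = ⟨B z, Φ⟩`, and the norm of `Φ` is controlled by
  -- that of `z`.
  have e : nsq Finset.univ z = ∑ J ∈ t, (∑ r, B J r * z r) * Φ J := by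
    simp only [nsq, Finset.sum_mul]
    rw [Finset.sum_comm]
    refine Finset.sum_congr rfl fun r _ => ?_
    rw [sq]; nth_rewrite 1 [← hΦ r]
    rw [Finset.sum_mul]
    exact Finset.sum_congr rfl fun J _ => by ring
  have h1 : nsq Finset.univ z ^ 2 ≤ nsq t (fun J => ∑ r, B J r * z r) * nsq t Φ := by
    rw [e]; exact sum_mul_sq_le_nsq _ _ _
  have h0 := nsq_nonneg t (fun J => ∑ r, B J r * z r)
  rcases (nsq_nonneg Finset.univ z).eq_or_lt with h | h
  · rw [← h]; positivity
  · have h2 := h1.trans (mul_le_mul_of_nonneg_left hn h0)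
    refine le_of_mul_le_mul_right ?_ h
    nlinarith

end growth

/-! ### Laws of blocks of observations, indexed by base `n` codes -/

lemma sum_range_mul_add (a b : ℕ) (f : ℕ → ℝ) :
    ∑ c ∈ Finset.range (a * b), f c =
      ∑ y ∈ Finset.range b, ∑ x ∈ Finset.range a, f (x + a * y) := by
  induction b with
  | zero => simp
  | succ b ih =>
    rw [mul_add, mul_one, Finset.sum_range_add, ih, Finset.sum_range_succ]
    congr 1
    exact Finset.sum_congr rfl fun x _ => by rw [add_comm]

/-- Sums over codes of blocks become double sums over the low digits and the high digits. -/
lemma sum_range_mod_div (a b : ℕ) (f : ℕ → ℕ → ℝ) :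
    ∑ c ∈ Finset.range (a * b), f (c % a) (c / a) =
      ∑ x ∈ Finset.range a, ∑ y ∈ Finset.range b, f x y := by
  rw [sum_range_mul_add, Finset.sum_comm]
  refine Finset.sum_congr rfl fun x hx => Finset.sum_congr rfl fun y _ => ?_
  have hx := Finset.mem_range.1 hx
  have ha : 0 < a := by omega
  rw [Nat.add_mul_mod_self_left, Nat.mod_eq_of_lt hx, Nat.add_mul_div_left _ _ ha,
    Nat.div_eq_of_lt hx, zero_add]

section laws
variable {R : ℕ} (n : ℕ) (P : Matrix (Fin R) (Fin R) ℝ) (M : ℕ → Fin R → ℝ)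

/-- Law of the next `j` observations, given the current hidden state. -/
noncomputable def futLaw : ℕ → ℕ → Fin R → ℝ
  | 0, _, _ => 1
  | j + 1, c, r => M (c % n) r * ∑ s, P s r * futLaw j (c / n) s

/-- Joint law of the next `a` observations and the hidden state after them, for the initial
law `v`. -/
noncomputable def pastLaw (v : Fin R → ℝ) : ℕ → ℕ → Fin R → ℝ
  | 0, _, s => v s
  | a + 1, c, s => ∑ r, P s r * (M (c / n ^ a % n) r * pastLaw v a (c % n ^ a) r)

/-- Law of the last `j` observations, given the current hidden state, where `P` is the transition
matrix of the reversed chain. -/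
noncomputable def revLaw : ℕ → ℕ → Fin R → ℝ
  | 0, _, _ => 1
  | j + 1, c, r => M (c / n ^ j % n) r * ∑ s, P s r * revLaw j (c % n ^ j) s

/-- The Markov property: a window is cut after `a` observations, and the hidden state at the cut
separates both parts. The low digits of the code belong to the earlier observations. -/
lemma sum_mul_futLaw (v : Fin R → ℝ) (a b c : ℕ) :
    ∑ r, v r * futLaw n P M (a + b) c r =
      ∑ s, pastLaw n P M v a (c % n ^ a) s * futLaw n P M b (c / n ^ a) s := by
  induction a generalizing b with
  | zero => simp [pastLaw]
  | succ a ih =>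
    rw [show a + 1 + b = a + (b + 1) by ring, ih]
    have h1 : c % n ^ (a + 1) / n ^ a % n = c / n ^ a % n := by
      rw [pow_succ, Nat.mod_mul_right_div_self, Nat.mod_mod]
    have h2 : c % n ^ (a + 1) % n ^ a = c % n ^ a :=
      Nat.mod_mod_of_dvd _ (pow_dvd_pow n (Nat.le_succ a))
    have h3 : c / n ^ a / n = c / n ^ (a + 1) := by rw [Nat.div_div_eq_div_mul, pow_succ]
    simp only [futLaw, pastLaw, h1, h2, h3, Finset.mul_sum, Finset.sum_mul]
    rw [Finset.sum_comm]
    exact Finset.sum_congr rfl fun s _ => Finset.sum_congr rfl fun r _ => by ring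

variable {n P M}

lemma futLaw_nonneg (hP : ∀ s r, 0 ≤ P s r) (hM : ∀ x r, 0 ≤ M x r) (j c : ℕ) (r : Fin R) :
    0 ≤ futLaw n P M j c r := by
  induction j generalizing c r with
  | zero => simp [futLaw]
  | succ j ih => exact mul_nonneg (hM _ _) (Finset.sum_nonneg fun s _ => mul_nonneg (hP _ _) (ih _ _))

lemma pastLaw_nonneg (hP : ∀ s r, 0 ≤ P s r) (hM : ∀ x r, 0 ≤ M x r) {v : Fin R → ℝ}
    (hv : ∀ r, 0 ≤ v r) (j c : ℕ) (r : Fin R) : 0 ≤ pastLaw n P M v j c r := by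
  induction j generalizing c r with
  | zero => exact hv r
  | succ j ih =>
    exact Finset.sum_nonneg fun s _ => mul_nonneg (hP _ _) (mul_nonneg (hM _ _) (ih _ _))

lemma sum_futLaw (hP : ∀ r, ∑ s, P s r = 1) (hM : ∀ r, ∑ x ∈ Finset.range n, M x r = 1)
    (j : ℕ) (r : Fin R) : ∑ c ∈ Finset.range (n ^ j), futLaw n P M j c r = 1 := by
  induction j generalizing r with
  | zero => simp [futLaw]
  | succ j ih =>
    rw [pow_succ']
    simp only [futLaw]
    rw [sum_range_mod_div n (n ^ j) fun x y => M x r * ∑ s, P s r * futLaw n P M j y s]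
    simp only [← Finset.mul_sum]
    rw [Finset.sum_comm]
    simp only [← Finset.mul_sum, ih, mul_one, hP, hM]

lemma sum_pastLaw {v : Fin R → ℝ} (hv : ∀ s, ∑ r, P s r * v r = v s)
    (hM : ∀ r, ∑ x ∈ Finset.range n, M x r = 1) (j : ℕ) (s : Fin R) :
    ∑ c ∈ Finset.range (n ^ j), pastLaw n P M v j c s = v s := by
  induction j generalizing s with
  | zero => simp [pastLaw]
  | succ j ih =>
    have h0 : ∀ c ∈ Finset.range (n ^ j * n), pastLaw n P M v (j + 1) c s =
        ∑ r, P s r * (M (c / n ^ j) r * pastLaw n P M v j (c % n ^ j) r) := by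
      intro c hc
      have : c / n ^ j < n := Nat.div_lt_of_lt_mul (Finset.mem_range.1 hc)
      simp only [pastLaw, Nat.mod_eq_of_lt this]
    rw [pow_succ, Finset.sum_congr rfl h0, sum_range_mod_div (n ^ j) n fun x y =>
      ∑ r, P s r * (M y r * pastLaw n P M v j x r)]
    rw [← hv s, Finset.sum_congr rfl fun x _ => Finset.sum_comm, Finset.sum_comm]
    refine Finset.sum_congr rfl fun r _ => ?_
    simp only [← Finset.mul_sum, ← Finset.sum_mul, hM, one_mul, ih]

/-- The last observation is the top digit of the code, so summing over it shortens the block at its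
end. This is what makes `earlyMarg` a law of shorter blocks. -/
lemma sum_futLaw_last (hP : ∀ r, ∑ s, P s r = 1) (hM : ∀ r, ∑ x ∈ Finset.range n, M x r = 1)
    {a J : ℕ} (hJ : J < n ^ a) (r : Fin R) :
    ∑ y ∈ Finset.range n, futLaw n P M (a + 1) (J + n ^ a * y) r = futLaw n P M a J r := by
  induction a generalizing J r with
  | zero =>
    have : J = 0 := by simpa using hJ
    subst this
    have h0 : ∀ y ∈ Finset.range n, futLaw n P M (0 + 1) (0 + n ^ 0 * y) r = M y r := by
      intro y hy
      simp [futLaw, Nat.mod_eq_of_lt (Finset.mem_range.1 hy), hP]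
    rw [Finset.sum_congr rfl h0, hM]; rfl
  | succ a ih =>
    rcases Nat.eq_zero_or_pos n with hn | hn
    · subst hn; simp at hJ
    have h1 : ∀ y, (J + n ^ (a + 1) * y) % n = J % n := fun y => by
      rw [pow_succ', mul_assoc, Nat.add_mul_mod_self_left]
    have h2 : ∀ y, (J + n ^ (a + 1) * y) / n = J / n + n ^ a * y := fun y => by
      rw [pow_succ', mul_assoc, Nat.add_mul_div_left _ _ hn]
    have h3 : J / n < n ^ a := Nat.div_lt_of_lt_mul (by rwa [← pow_succ'])
    simp only [futLaw] at ih ⊢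
    simp only [h1, h2, ← Finset.mul_sum]
    rw [Finset.sum_comm]
    simp only [← Finset.mul_sum]
    congr 1
    exact Finset.sum_congr rfl fun s _ => by rw [ih h3]

/-- The past law in terms of the reversed chain. -/
lemma pastLaw_eq_revLaw {v : Fin R → ℝ} (hv : ∀ s, ∑ r, P s r * v r = v s) (hv0 : ∀ r, v r ≠ 0)
    (a c : ℕ) (r : Fin R) :
    pastLaw n P M v a c r =
      v r * ∑ s, (Matrix.of fun s r => v s * P r s / v r) s r *
        revLaw n (Matrix.of fun s r => v s * P r s / v r) M a c s := by
  induction a generalizing c r with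
  | zero =>
    simp only [pastLaw, revLaw, Matrix.of_apply, mul_one]
    rw [← Finset.sum_div, mul_div_cancel₀ _ (hv0 r)]
    exact (hv r).symm.trans (Finset.sum_congr rfl fun s _ => mul_comm _ _)
  | succ a ih =>
    simp only [pastLaw, revLaw, Matrix.of_apply] at ih ⊢
    rw [Finset.mul_sum]
    refine Finset.sum_congr rfl fun s _ => ?_
    rw [ih]
    field_simp [hv0 r]

lemma nsq_le_one_of_sum {ι : Type*} {s : Finset ι} {f : ι → ℝ} (h0 : ∀ i ∈ s, 0 ≤ f i)
    (h1 : ∑ i ∈ s, f i = 1) : nsq s f ≤ 1 := by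
  rw [← h1]
  refine Finset.sum_le_sum fun i hi => ?_
  have : f i ≤ 1 := h1 ▸ Finset.single_le_sum h0 hi
  nlinarith [h0 i hi]

/-- Blocks of `j` observations represent a space of dimension at least `min R (1 + j (k - 1))`. -/
lemma exists_rowRep_block {k : ℕ} (hk : 1 ≤ k) (hR : 1 ≤ R) {X : ℝ} (hX : 2 ≤ X) (hRX : (R : ℝ) ≤ X)
    (hnX : (n : ℝ) ≤ X) (hM0 : ∀ x r, 0 ≤ M x r)
    (hM : ∀ r, ∑ x ∈ Finset.range n, M x r = 1) (hMk : ColDual (Finset.range n) M k X)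
    (hP1 : ∀ r, ∑ s, P s r = 1)
    (hP : ∀ u : Fin R → ℝ, nsq Finset.univ u ≤ X * nsq Finset.univ (fun r => ∑ s, P s r * u s))
    (B : ℕ → ℕ → Fin R → ℝ) (σ : ℕ → ℕ → ℕ × ℕ)
    (hσ : ∀ j (f : ℕ × ℕ → ℝ), ∑ c ∈ Finset.range (n ^ (j + 1)), f (σ j c) =
      ∑ p ∈ Finset.range n ×ˢ Finset.range (n ^ j), f p)
    (hB0 : ∀ c r, B 0 c r = 1)
    (hB : ∀ j, ∀ c ∈ Finset.range (n ^ (j + 1)), ∀ r,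
      B (j + 1) c r = M (σ j c).1 r * ∑ s, P s r * B j (σ j c).2 s) (j : ℕ) :
    ∃ U : Submodule ℝ (Fin R → ℝ), min R (1 + j * (k - 1)) ≤ Module.finrank ℝ U ∧
      RowRep (Finset.range (n ^ j)) (B j) U (X ^ (10 * j)) := by
  -- `σ` separates one observation from the code of a block. It is abstract because `futLaw` splits
  -- off the lowest digit and `revLaw` the highest.
  have hsum : ∀ j r, ∑ c ∈ Finset.range (n ^ j), B j c r = 1 := by
    intro j
    induction j with
    | zero => intro r; simp [hB0]
    | succ j ih =>
      intro r
      rw [Finset.sum_congr rfl fun c hc => hB j c hc r,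
        hσ j fun p => M p.1 r * ∑ s, P s r * B j p.2 s, Finset.sum_product]
      simp only [← Finset.mul_sum]
      rw [Finset.sum_comm]
      simp only [← Finset.mul_sum, ih, mul_one, hP1, hM]
  have hX0 : (0 : ℝ) ≤ X := by linarith
  have hX1 : (1 : ℝ) ≤ X := by linarith
  induction j with
  | zero =>
    refine ⟨Submodule.span ℝ {fun _ => 1}, ?_, ?_⟩
    · have : (fun _ : Fin R => (1 : ℝ)) ≠ 0 := fun h => by
        simpa using congrFun h ⟨0, hR⟩
      rw [finrank_span_singleton this]; simp
    · intro u hu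
      obtain ⟨a, rfl⟩ := Submodule.mem_span_singleton.1 hu
      refine ⟨fun _ => a, fun r => by simp [hB0], ?_⟩
      have : (1 : ℝ) ≤ R := by exact_mod_cast hR
      simp only [nsq, pow_zero, Finset.range_one, Pi.smul_apply, smul_eq_mul,
        mul_one, mul_zero, Finset.sum_const, Finset.card_univ, Fintype.card_fin, nsmul_eq_mul, one_mul,
        Finset.card_singleton, Nat.cast_one]
      nlinarith [sq_nonneg a]
  | succ j ih =>
    obtain ⟨U, hU, hrep⟩ := ih
    obtain ⟨U₁, hU₁, hrep₁⟩ := hrep.mul_right (by positivity) P hP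
    -- Conditional laws sum to `1`, so the all-ones vector represents the constant function; its
    -- squared norm is the number `n ^ j` of blocks.
    have hone : ∃ Φ : ℕ → ℝ, (∀ r, ∑ i ∈ Finset.range (n ^ j), (∑ s, P s r * B j i s) * Φ i = 1) ∧
        nsq (Finset.range (n ^ j)) Φ ≤ X ^ j := by
      refine ⟨fun _ => 1, fun r => ?_, ?_⟩
      · simp only [mul_one]
        rw [Finset.sum_comm]
        simp only [← Finset.mul_sum, hsum, mul_one, hP1]
      · simp only [nsq, one_pow, Finset.sum_const, Finset.card_range, nsmul_eq_mul, mul_one]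
        push_cast
        gcongr
    obtain ⟨U₂, hU₂, hrep₂⟩ := RowRep.khatriRao hk hX0 (by positivity) hMk
      (fun r => nsq_le_one_of_sum (fun x _ => hM0 x r) (hM r)) hrep₁ hone
    refine ⟨U₂, ?_, ?_⟩
    · refine le_trans ?_ hU₂
      have : (j + 1) * (k - 1) = j * (k - 1) + (k - 1) := by ring
      omega
    · intro u hu
      obtain ⟨Φ, hΦ, hn⟩ := hrep₂ u hu
      refine ⟨fun c => Φ (σ j c), fun r => ?_, ?_⟩
      · rw [← hΦ r, ← hσ j fun p => M p.1 r * (∑ s, P s r * B j p.2 s) * Φ p]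
        exact Finset.sum_congr rfl fun c hc => by rw [hB j c hc]
      · have e : nsq (Finset.range (n ^ (j + 1))) (fun c => Φ (σ j c)) =
            nsq (Finset.range n ×ˢ Finset.range (n ^ j)) Φ := hσ j fun p => Φ p ^ 2
        rw [e]
        refine hn.trans (mul_le_mul_of_nonneg_right ?_ (nsq_nonneg _ _))
        have hRn : (0 : ℝ) ≤ R := Nat.cast_nonneg R
        have hj : X ^ j ≤ X ^ (10 * j) := pow_le_pow_right₀ hX1 (by omega)
        set Y := X ^ (10 * j) with hY
        have hY1 : 1 ≤ Y := one_le_pow₀ hX1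
        -- The price of one more observation is a factor `X ^ 10`: the polynomial is at most `5 X ^
        -- 7`, and `5 ≤ 8 ≤ X ^ 3`.
        calc (R : ℝ) * (2 * (X * X ^ j) + (R * X * 2 + 1) * (R * (X * (Y * X * R))))
            ≤ X * (2 * (X * Y) + (X * X * 2 + 1) * (X * (X * (Y * X * X)))) := by gcongr
          _ = Y * (2 * X ^ 2 + 2 * X ^ 7 + X ^ 5) := by ring
          _ ≤ Y * X ^ 10 := by
              have h2 : X ^ 2 ≤ X ^ 7 := pow_le_pow_right₀ hX1 (by norm_num)
              have h5 : X ^ 5 ≤ X ^ 7 := pow_le_pow_right₀ hX1 (by norm_num)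
              have h8 : (8 : ℝ) ≤ X ^ 3 := by
                calc (8 : ℝ) = 2 ^ 3 := by norm_num
                  _ ≤ X ^ 3 := by gcongr
              have : X ^ 10 = X ^ 7 * X ^ 3 := by ring
              have h7 : 0 ≤ X ^ 7 := by positivity
              refine mul_le_mul_of_nonneg_left ?_ (by linarith)
              nlinarith
          _ = X ^ (10 * (j + 1)) := by rw [hY]; ring

end laws

/-! ### Conditioning of the laws of past and future blocks -/

section conditioning
variable {R : ℕ}

lemma nsq_univ_pos_of_ne {u : Fin R → ℝ} (h : nsq Finset.univ u = 0) : u = 0 := by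
  funext r
  have := (sq_le_nsq u (Finset.mem_univ r)).trans_eq h
  exact pow_eq_zero_iff (two_ne_zero) |>.1 (le_antisymm this (sq_nonneg _))

lemma exists_preimage_of_bounded_below {X : ℝ} (P : Matrix (Fin R) (Fin R) ℝ)
    (hP : ∀ u : Fin R → ℝ, nsq Finset.univ u ≤ X * nsq Finset.univ (fun r => ∑ s, P r s * u s))
    (u : Fin R → ℝ) : ∃ z : Fin R → ℝ, ∀ r, ∑ s, P r s * z s = u r := by
  have hinj : Function.Injective P.mulVecLin := by
    rw [injective_iff_map_eq_zero]
    intro u hu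
    refine nsq_univ_pos_of_ne (le_antisymm ((hP u).trans ?_) (nsq_nonneg _ _))
    have : (fun r => ∑ s, P r s * u s) = fun _ => 0 := by
      funext r; exact congrFun hu r
    rw [this]; simp [nsq]
  obtain ⟨z, hz⟩ := (LinearMap.injective_iff_surjective.1 hinj) u
  exact ⟨z, fun r => congrFun hz r⟩

/-- A square matrix that is bounded below is invertible, so `u = P z` with `‖z‖² ≤ X ‖u‖²`, and
`‖u‖² = ⟨Pᵀ u, z⟩`. The constant is the same for both sides; block laws are propagated by `Pᵀ`. -/
lemma bounded_below_transpose {X : ℝ} (hX : 0 ≤ X) (P : Matrix (Fin R) (Fin R) ℝ)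
    (hP : ∀ u : Fin R → ℝ, nsq Finset.univ u ≤ X * nsq Finset.univ (fun r => ∑ s, P r s * u s))
    (u : Fin R → ℝ) :
    nsq Finset.univ u ≤ X * nsq Finset.univ (fun r => ∑ s, P s r * u s) := by
  obtain ⟨z, hz⟩ := exists_preimage_of_bounded_below P hP u
  have h1 : nsq Finset.univ z ≤ X * nsq Finset.univ u := by
    have := hP z
    simpa only [hz] using this
  have e : nsq Finset.univ u = ∑ s, (∑ r, P r s * u r) * z s := by
    simp only [nsq, Finset.sum_mul]
    rw [Finset.sum_comm]
    refine Finset.sum_congr rfl fun r _ => ?_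
    rw [sq]; nth_rewrite 1 [← hz r]
    rw [Finset.sum_mul]
    exact Finset.sum_congr rfl fun J _ => by ring
  have h2 : nsq Finset.univ u ^ 2 ≤
      nsq Finset.univ (fun s => ∑ r, P r s * u r) * nsq Finset.univ z := by
    rw [e]; exact sum_mul_sq_le_nsq _ _ _
  have h0 := nsq_nonneg Finset.univ (fun s => ∑ r, P r s * u r)
  rcases (nsq_nonneg Finset.univ u).eq_or_lt with h | h
  · rw [← h]; positivity
  · have h3 := h2.trans (mul_le_mul_of_nonneg_left h1 h0)
    refine le_of_mul_le_mul_right ?_ h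
    nlinarith

variable {n : ℕ} {P : Matrix (Fin R) (Fin R) ℝ} {M : ℕ → Fin R → ℝ} {w : Fin R → ℝ} {k q : ℕ} {X : ℝ}

lemma RowRep.top_of_le {κ : Type*} {t : Finset κ} {B : κ → Fin R → ℝ}
    {U : Submodule ℝ (Fin R → ℝ)} {C : ℝ} (h : RowRep t B U C) (hU : R ≤ Module.finrank ℝ U) :
    RowRep t B ⊤ C := by
  have : U = ⊤ := Submodule.eq_top_of_finrank_eq
    (le_antisymm (Submodule.finrank_le U) (by simpa using hU))
  rwa [this] at h

/-- Blocks of `q + 1` future observations determine the hidden state. -/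
lemma rowRep_futLaw (hk : 1 ≤ k) (hR : 1 ≤ R) (hX : 2 ≤ X) (hRX : (R : ℝ) ≤ X)
    (hnX : (n : ℝ) ≤ X) (hM0 : ∀ x r, 0 ≤ M x r)
    (hM : ∀ r, ∑ x ∈ Finset.range n, M x r = 1) (hMk : ColDual (Finset.range n) M k X)
    (hP1 : ∀ r, ∑ s, P s r = 1)
    (hP : ∀ u : Fin R → ℝ, nsq Finset.univ u ≤ X * nsq Finset.univ (fun r => ∑ s, P r s * u s))
    (hq : R ≤ 1 + (q + 1) * (k - 1)) :
    RowRep (Finset.range (n ^ (q + 1))) (futLaw n P M (q + 1)) ⊤ (X ^ (10 * (q + 1))) := by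
  obtain ⟨U, hU, h⟩ := exists_rowRep_block hk hR hX hRX hnX hM0 hM hMk hP1
    (bounded_below_transpose (by linarith) P hP) (futLaw n P M) (fun _ c => (c % n, c / n))
    (fun j f => by
      rw [pow_succ', sum_range_mod_div n (n ^ j) fun x y => f (x, y), Finset.sum_product])
    (fun c r => rfl) (fun j c _ r => rfl) (q + 1)
  exact h.top_of_le (by omega)

/-- The joint laws of a block of `q + 1` observations and the next hidden state represent
everything. -/
lemma rowRep_pastLaw (hk : 1 ≤ k) (hR : 1 ≤ R) (hX : 2 ≤ X) (hRX : (R : ℝ) ≤ X)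
    (hnX : (n : ℝ) ≤ X) (hM0 : ∀ x r, 0 ≤ M x r)
    (hM : ∀ r, ∑ x ∈ Finset.range n, M x r = 1) (hMk : ColDual (Finset.range n) M k X)
    (hP : ∀ u : Fin R → ℝ, nsq Finset.univ u ≤ X * nsq Finset.univ (fun r => ∑ s, P r s * u s))
    (hw : ∀ s, ∑ r, P s r * w r = w s) (hw0 : ∀ r, 0 < w r) (hw1 : ∀ r, w r ≤ 1)
    (hwX : ∀ r, 1 ≤ X * w r ^ 2)
    (hq : R ≤ 1 + (q + 1) * (k - 1)) :
    RowRep (Finset.range (n ^ (q + 1))) (pastLaw n P M w (q + 1)) ⊤ (X ^ (20 * (q + 1) + 3)) := by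
  -- Bayes' rule: transition matrix of the stationary chain run backwards. The diagonal factors `w`
  -- cost one extra factor `X` in its lower bound, whence `X ^ 2` below.
  set P' : Matrix (Fin R) (Fin R) ℝ := Matrix.of fun s r => w s * P r s / w r with hP'
  have hX1 : (1 : ℝ) ≤ X := by linarith
  have hXX : X ≤ X ^ 2 := by nlinarith
  have hP'1 : ∀ r, ∑ s, P' s r = 1 := by
    intro r
    simp only [hP', Matrix.of_apply]
    rw [← Finset.sum_div, div_eq_one_iff_eq (hw0 r).ne']
    exact (Finset.sum_congr rfl fun s _ => mul_comm _ _).trans (hw r)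
  have hP'b : ∀ u : Fin R → ℝ,
      nsq Finset.univ u ≤ X ^ 2 * nsq Finset.univ (fun r => ∑ s, P' s r * u s) := by
    intro u
    have h1 : nsq Finset.univ u ≤ X * nsq Finset.univ (fun s => w s * u s) := by
      simp only [nsq, Finset.mul_sum]
      refine Finset.sum_le_sum fun r _ => ?_
      nlinarith [hwX r, sq_nonneg (u r)]
    have h2 : nsq Finset.univ (fun r => ∑ s, P r s * (w s * u s)) ≤
        nsq Finset.univ (fun r => ∑ s, P' s r * u s) := by
      refine Finset.sum_le_sum fun r _ => ?_
      have e : ∑ s, P r s * (w s * u s) = w r * ∑ s, P' s r * u s := by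
        rw [Finset.mul_sum]
        refine Finset.sum_congr rfl fun s _ => ?_
        simp only [hP', Matrix.of_apply]
        field_simp [(hw0 r).ne']
      show (∑ s, P r s * (w s * u s)) ^ 2 ≤ (∑ s, P' s r * u s) ^ 2
      rw [e, mul_pow]
      have : w r ^ 2 ≤ 1 := pow_le_one₀ (hw0 r).le (hw1 r)
      nlinarith [sq_nonneg (∑ s, P' s r * u s)]
    calc nsq Finset.univ u ≤ X * nsq Finset.univ (fun s => w s * u s) := h1
      _ ≤ X * (X * nsq Finset.univ (fun r => ∑ s, P r s * (w s * u s))) := by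
          gcongr; exact hP _
      _ ≤ X * (X * nsq Finset.univ (fun r => ∑ s, P' s r * u s)) := by gcongr
      _ = _ := by ring
  obtain ⟨U, hU, h⟩ := exists_rowRep_block hk hR (hX.trans hXX) (hRX.trans hXX) (hnX.trans hXX) hM0
    hM (fun S hS r hr => by
      obtain ⟨y, h1, h2⟩ := hMk S hS r hr
      exact ⟨y, h1, h2.trans hXX⟩) hP'1 hP'b
    (revLaw n P' M) (fun j c => (c / n ^ j, c % n ^ j))
    (fun j f => by
      rw [pow_succ, sum_range_mod_div (n ^ j) n fun x y => f (y, x), Finset.sum_comm,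
        Finset.sum_product])
    (fun c r => rfl)
    (fun j c hc r => by
      have : c / n ^ j < n := Nat.div_lt_of_lt_mul (by
        rw [← pow_succ]; exact Finset.mem_range.1 hc)
      simp only [revLaw, Nat.mod_eq_of_lt this]) (q + 1)
  -- The state recorded by `pastLaw` lies one transition after the block, so one more factor `P'` is
  -- needed, and then multiplication by `w`. A function `u` is therefore obtained by representing `u
  -- / w`.
  obtain ⟨U₁, hU₁, h₁⟩ := (h.top_of_le (by omega)).mul_right (by positivity) P' hP'b
  have h₂ := h₁.top_of_le (by simpa using hU₁)
  intro u _
  obtain ⟨Φ, hΦ, hn⟩ := h₂ (fun r => u r / w r) trivial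
  refine ⟨Φ, fun r => ?_, hn.trans ?_⟩
  · have e := hΦ r
    rw [eq_div_iff (hw0 r).ne'] at e
    rw [← e, mul_comm, Finset.mul_sum]
    refine Finset.sum_congr rfl fun c _ => ?_
    rw [pastLaw_eq_revLaw hw (fun r => (hw0 r).ne')]
    ring
  · have h3 : nsq Finset.univ (fun r => u r / w r) ≤ X * nsq Finset.univ u := by
      simp only [nsq, Finset.mul_sum]
      refine Finset.sum_le_sum fun r _ => ?_
      rw [div_pow, div_le_iff₀ (by have := hw0 r; positivity)]
      nlinarith [hwX r, sq_nonneg (u r)]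
    calc _ ≤ (X ^ 2) ^ (10 * (q + 1)) * X ^ 2 * (X * nsq Finset.univ u) := by gcongr
      _ = _ := by ring

/-- Lower bound for the laws of future blocks, seen from the previous hidden state. -/
lemma nsq_le_next {d : ℕ} {F : ℕ → Fin R → ℝ} {C : ℝ} (hX : 0 ≤ X)
    (hF : ∀ z : Fin R → ℝ, nsq Finset.univ z ≤ C * nsq (Finset.range d) fun J => ∑ r, F J r * z r)
    (hP : ∀ u : Fin R → ℝ, nsq Finset.univ u ≤ X * nsq Finset.univ (fun r => ∑ s, P r s * u s))
    (z : Fin R → ℝ) :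
    nsq Finset.univ z ≤ X * C * nsq (Finset.range d) fun J => ∑ r, (∑ s, P s r * F J s) * z r := by
  have e : ∀ J, ∑ r, (∑ s, P s r * F J s) * z r = ∑ s, F J s * ∑ r, P s r * z r := by
    intro J
    simp only [Finset.mul_sum, Finset.sum_mul]
    rw [Finset.sum_comm]
    exact Finset.sum_congr rfl fun r _ => Finset.sum_congr rfl fun s _ => by ring
  simp only [e]
  calc _ ≤ X * nsq Finset.univ (fun r => ∑ s, P r s * z s) := hP z
    _ ≤ X * (C * _) := mul_le_mul_of_nonneg_left (hF _) hX
    _ = _ := by ring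

end conditioning

/-! ### The law of a window in terms of block codes -/

namespace HMM
variable {n R : ℕ} (H : HMM n R)

/-- Observation matrix with rows indexed by natural numbers. -/
noncomputable def obs (x : ℕ) (r : Fin R) : ℝ := if h : x < n then H.M ⟨x, h⟩ r else 0

lemma obs_fin (x : Fin n) (r : Fin R) : H.obs x r = H.M x r := by simp [obs]

lemma obs_nonneg (x : ℕ) (r : Fin R) : 0 ≤ H.obs x r := by
  unfold obs; split_ifs
  exacts [H.M_nonneg _ _, le_rfl]

lemma sum_obs_mul (r : Fin R) (y : ℕ → ℝ) :
    ∑ x ∈ Finset.range n, H.obs x r * y x = ∑ x, H.M x r * y x := by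
  rw [Finset.sum_range]; simp only [obs_fin]

lemma sum_obs (r : Fin R) : ∑ x ∈ Finset.range n, H.obs x r = 1 := by
  rw [Finset.sum_range]; simp only [obs_fin]; exact H.M_sum r

lemma stationary' (s : Fin R) : ∑ r, H.P s r * H.w r = H.w s := congrFun H.stationary s

/-- Code of a block of observations. -/
def blockCode {m : ℕ} (x : Fin m → Fin n) : ℕ := ∑ i, (x i : ℕ) * n ^ (i : ℕ)

lemma blockCode_lt {m : ℕ} (x : Fin m → Fin n) : blockCode x < n ^ m := by
  rw [blockCode, ← finFunctionFinEquiv_apply]; exact Fin.is_lt _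

lemma blockCode_succ {m : ℕ} (x : Fin (m + 1) → Fin n) :
    blockCode x % n = x 0 ∧ blockCode x / n = blockCode (Fin.tail x) := by
  have e : blockCode x = (x 0 : ℕ) + n * blockCode (Fin.tail x) := by
    simp only [blockCode, Fin.sum_univ_succ, Fin.val_zero, pow_zero, mul_one, Finset.mul_sum,
      Fin.val_succ, Fin.tail]
    congr 1
    exact Finset.sum_congr rfl fun i _ => by ring
  have hn : 0 < n := (x 0).pos
  rw [e]
  refine ⟨by rw [Nat.add_mul_mod_self_left, Nat.mod_eq_of_lt (x 0).2], ?_⟩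
  rw [Nat.add_mul_div_left _ _ hn, Nat.div_eq_of_lt (x 0).2, zero_add]

/-- The initial weights `v` are arbitrary so that the induction can continue, after the first state
`r`, with column `r` of `P` in the role of `v`. -/
lemma sum_path_eq_futLaw {l : ℕ} (v : Fin R → ℝ) (x : Fin (l + 1) → Fin n) :
    ∑ z : Fin (l + 1) → Fin R,
      v (z 0) * (∏ t : Fin l, H.P (z t.succ) (z t.castSucc)) * ∏ t, H.M (x t) (z t) =
    ∑ r, v r * futLaw n H.P H.obs (l + 1) (blockCode x) r := by
  induction l generalizing v with
  | zero =>
    rw [← (Equiv.funUnique (Fin 1) (Fin R)).symm.sum_comp]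
    refine Finset.sum_congr rfl fun r _ => ?_
    have := (blockCode_succ x).1
    simp only [futLaw, this, obs_fin, mul_one, H.P_sum]
    simp
  | succ l ih =>
    rw [← (Fin.consEquiv fun _ => Fin R).sum_comp, Fintype.sum_prod_type]
    refine Finset.sum_congr rfl fun r _ => ?_
    obtain ⟨h1, h2⟩ := blockCode_succ x
    rw [futLaw, h1, h2, obs_fin, ← ih (fun s => H.P s r) (Fin.tail x), Finset.mul_sum, Finset.mul_sum]
    refine Finset.sum_congr rfl fun z _ => ?_
    rw [Fin.prod_univ_succ, Fin.prod_univ_succ (n := l + 1)]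
    simp only [Fin.consEquiv_apply, Fin.cons_zero, Fin.cons_succ, Fin.castSucc_zero,
      Fin.castSucc_succ, Fin.tail]
    ring

lemma obsProb_eq {l : ℕ} (x : Fin (l + 1) → Fin n) :
    H.obsProb x = ∑ r, H.w r * futLaw n H.P H.obs (l + 1) (blockCode x) r :=
  H.sum_path_eq_futLaw H.w x

end HMM

/-! ### Singular values and robust Kruskal rank -/

/-- In an orthonormal eigenbasis of `T* T` the form `‖T x‖²` is a sum of squares weighted by squared
singular values. As the domain has dimension `k`, the value with index `k - 1` is the smallest one
that occurs. -/
lemma sq_mul_norm_sq_le_of_le_singularValues {E F : Type*} [NormedAddCommGroup E]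
    [InnerProductSpace ℝ E] [FiniteDimensional ℝ E] [NormedAddCommGroup F] [InnerProductSpace ℝ F]
    [FiniteDimensional ℝ F] (T : E →ₗ[ℝ] F) {k : ℕ} (hk : Module.finrank ℝ E = k) {c : ℝ}
    (hc : 0 ≤ c) (h : c ≤ T.singularValues (k - 1)) (x : E) : c ^ 2 * ‖x‖ ^ 2 ≤ ‖T x‖ ^ 2 := by
  have hS := T.isSymmetric_adjoint_comp_self
  set b := hS.eigenvectorBasis hk
  have h1 : ‖T x‖ ^ 2 = ∑ i, hS.eigenvalues hk i * b.repr x i ^ 2 := by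
    have e : ‖T x‖ ^ 2 = inner ℝ x ((LinearMap.adjoint T ∘ₗ T) x) := by
      rw [LinearMap.comp_apply, LinearMap.adjoint_inner_right, real_inner_self_eq_norm_sq]
    rw [e, ← b.repr.inner_map_map, PiLp.inner_apply]
    refine Finset.sum_congr rfl fun i _ => ?_
    rw [hS.eigenvectorBasis_apply_self_apply hk x i]
    simp only [RCLike.inner_apply, conj_trivial, RCLike.ofReal_real_eq_id, id]
    ring
  have h2 : ‖x‖ ^ 2 = ∑ i, b.repr x i ^ 2 := by
    rw [← b.repr.norm_map x, EuclideanSpace.norm_sq_eq]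
    simp
  rw [h1, h2, Finset.mul_sum]
  refine Finset.sum_le_sum fun i _ => mul_le_mul_of_nonneg_right ?_ (sq_nonneg _)
  rw [← T.sq_singularValues_fin hk i]
  have : T.singularValues (k - 1) ≤ T.singularValues i :=
    T.singularValues_antitone (by have := i.2; omega)
  exact pow_le_pow_left₀ hc (h.trans this) 2

lemma nsq_le_of_le_singVal {m n : Type} [Fintype m] [Fintype n] [DecidableEq n] (A : Matrix m n ℝ)
    {k : ℕ} (hk : Fintype.card n = k) {c : ℝ} (hc : 0 ≤ c) (h : c ≤ singVal k A) (x : n → ℝ) :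
    c ^ 2 * nsq Finset.univ x ≤ nsq Finset.univ (fun i => ∑ j, A i j * x j) := by
  have := sq_mul_norm_sq_le_of_le_singularValues (Matrix.toEuclideanLin A)
    (by rw [finrank_euclideanSpace, hk]) hc h (WithLp.toLp 2 x)
  rw [EuclideanSpace.norm_sq_eq, EuclideanSpace.norm_sq_eq] at this
  simpa [nsq, Matrix.toLpLin_apply, Matrix.mulVec, dotProduct] using this

/-- Solution of least norm type of an underdetermined system. -/
lemma exists_dual_of_bounded_below {m n : Type} [Fintype m] [Fintype n] (A : Matrix m n ℝ) {c : ℝ}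
    (hc : 0 < c)
    (h : ∀ x : n → ℝ, c * nsq Finset.univ x ≤ nsq Finset.univ (fun i => ∑ j, A i j * x j))
    (t : n → ℝ) : ∃ y : m → ℝ, (∀ j, ∑ i, A i j * y i = t j) ∧
      c * nsq Finset.univ y ≤ nsq Finset.univ t := by
  classical
  have hq : ∀ x : n → ℝ, nsq Finset.univ (fun i => ∑ j, A i j * x j) =
      ∑ j, (∑ i, A i j * ∑ l, A i l * x l) * x j := by
    intro x
    simp only [nsq, Finset.sum_mul]
    rw [Finset.sum_comm]
    refine Finset.sum_congr rfl fun i _ => ?_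
    rw [sq, Finset.sum_mul]
    exact Finset.sum_congr rfl fun j _ => by ring
  have hG : ∀ (x : n → ℝ) j, (Matrix.mulVecLin (A.transpose * A)) x j =
      ∑ i, A i j * ∑ l, A i l * x l := by
    intro x j
    rw [Matrix.mulVecLin_apply, ← Matrix.mulVec_mulVec]
    rfl
  have hinj : Function.Injective (Matrix.mulVecLin (A.transpose * A)) := by
    rw [injective_iff_map_eq_zero]
    intro x hx
    have h0 : nsq Finset.univ (fun i => ∑ j, A i j * x j) = 0 := by
      rw [hq]
      refine Finset.sum_eq_zero fun j _ => ?_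
      rw [← hG, hx]; simp
    have h1 := h x
    rw [h0] at h1
    funext j
    have h2 := sq_le_nsq x (Finset.mem_univ j)
    have : x j ^ 2 ≤ 0 := by nlinarith
    exact pow_eq_zero_iff (two_ne_zero) |>.1 (le_antisymm this (sq_nonneg _))
  -- The solution is `y = A x` with `Aᵀ A x = t`. Then `‖y‖² = ⟨t, x⟩`, and the lower bound for `A`
  -- turns `‖x‖` back into `‖y‖`.
  obtain ⟨x, hx⟩ := LinearMap.injective_iff_surjective.1 hinj t
  refine ⟨fun i => ∑ l, A i l * x l, fun j => by rw [← hx, hG], ?_⟩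
  have e : nsq Finset.univ (fun i => ∑ l, A i l * x l) = ∑ j, t j * x j := by
    rw [hq]
    exact Finset.sum_congr rfl fun j _ => by rw [← hx, hG]
  have h1 : nsq Finset.univ (fun i => ∑ l, A i l * x l) ^ 2 ≤
      nsq Finset.univ t * nsq Finset.univ x := by
    rw [e]; exact sum_mul_sq_le_nsq _ _ _
  have h2 := h x
  set a := nsq Finset.univ (fun i => ∑ l, A i l * x l)
  have ha : 0 ≤ a := nsq_nonneg _ _
  have ht := nsq_nonneg Finset.univ t
  rcases ha.eq_or_lt with h0 | h0
  · rw [← h0]; simpa using ht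
  · refine le_of_mul_le_mul_right ?_ h0
    nlinarith

namespace HMM
variable {n R : ℕ} (H : HMM n R)

/-- The dual vectors that a robust Kruskal rank of at least `k` provides. -/
lemma exists_colDual {τ : ℝ} (hτ : 0 < τ) {k : ℕ} (hk : 1 ≤ k) (h : k ≤ robustKRank τ H.M) :
    ∃ k₀, k ≤ k₀ ∧ ColDual (Finset.range n) H.obs k₀ (τ ^ 2) := by
  classical
  set S := {k : ℕ | k ≤ R ∧ ∀ S : Finset (Fin R), S.card = k →
    1 / τ ≤ singVal k (H.M.submatrix id (fun r : {r // r ∈ S} => (r : Fin R)))} with hS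
  have hne : S.Nonempty := by
    by_contra h0
    rw [Set.not_nonempty_iff_eq_empty] at h0
    have : robustKRank τ H.M = 0 := by rw [robustKRank, ← hS, h0]; simp
    omega
  -- The supremum is attained: the set is bounded by `R`, and it is nonempty because the supremum of
  -- the empty set would be `0 < k`.
  have hmem : robustKRank τ H.M ∈ S := Nat.sSup_mem hne ⟨R, fun k hk => hk.1⟩
  refine ⟨robustKRank τ H.M, h, fun S₀ hS₀ r₀ hr₀ => ?_⟩
  -- Singular values are controlled only for exactly `k₀` columns, `k₀` being the robust Kruskal
  -- rank itself. Smaller sets are enlarged to that size, and a dual vector for the larger set is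
  -- one for the smaller set.
  obtain ⟨S₁, hS₁, -, hc⟩ := Finset.exists_subsuperset_card_eq (Finset.subset_univ S₀) hS₀
    (by simpa using hmem.1)
  have hlow := nsq_le_of_le_singVal (H.M.submatrix id (fun r : {r // r ∈ S₁} => (r : Fin R)))
    (by simp [hc]) (by positivity) (hmem.2 S₁ hc)
  obtain ⟨y, hy, hn⟩ := exists_dual_of_bounded_below _ (by positivity) hlow
    (fun r => if (r : Fin R) = r₀ then 1 else 0)
  refine ⟨fun x => if hx : x < n then y ⟨x, hx⟩ else 0, fun r hr => ?_, ?_⟩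
  · rw [H.sum_obs_mul]
    simpa using hy ⟨r, hS₁ hr⟩
  · have e1 : nsq (Finset.range n) (fun x => if hx : x < n then y ⟨x, hx⟩ else 0) =
        nsq Finset.univ y := by
      rw [nsq, Finset.sum_range]; simp [nsq]
    have e2 : nsq Finset.univ (fun r : {r // r ∈ S₁} => if (r : Fin R) = r₀ then (1 : ℝ) else 0)
        = 1 := by
      rw [nsq, Finset.sum_eq_single ⟨r₀, hS₁ hr₀⟩]
      · simp
      · intro b _ hb
        have : (b : Fin R) ≠ r₀ := fun h => hb (Subtype.ext h)
        simp [this]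
      · simp
    rw [e2] at hn
    rw [e1]
    have : (1 / τ) ^ 2 * τ ^ 2 = 1 := by field_simp
    have h0 := nsq_nonneg Finset.univ y
    have hτ2 : 0 < τ ^ 2 := by positivity
    calc nsq Finset.univ y = τ ^ 2 * ((1 / τ) ^ 2 * nsq Finset.univ y) := by
          rw [← mul_assoc, mul_comm (τ ^ 2), this, one_mul]
      _ ≤ τ ^ 2 * 1 := by gcongr
      _ = τ ^ 2 := mul_one _

end HMM

/-! ### Concentration of empirical distributions -/

section sampling
variable {Ω : Type*} [Fintype Ω] {N : ℕ}

lemma sum_prod_sample (F : Fin N → Ω → ℝ) :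
    ∑ S : Fin N → Ω, ∏ s, F s (S s) = ∏ s, ∑ ω, F s ω := by
  rw [Finset.prod_univ_sum, Fintype.piFinset_univ]

variable {p : Ω → ℝ}

/-- Independence: for `i ≠ j` the expectation factors, and the factor of sample `i` is the mean `0`
of `g`. -/
lemma expect_mul_centered (hp : ∑ ω, p ω = 1) (g : Ω → ℝ) (hg : ∑ ω, p ω * g ω = 0) (i j : Fin N) :
    ∑ S : Fin N → Ω, (∏ s, p (S s)) * (g (S i) * g (S j)) =
      if i = j then ∑ ω, p ω * g ω ^ 2 else 0 := by
  have key : ∀ S : Fin N → Ω, (∏ s, p (S s)) * (g (S i) * g (S j)) =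
      ∏ s, p (S s) * ((if s = i then g (S s) else 1) * (if s = j then g (S s) else 1)) := by
    intro S
    have h : ∀ a : Fin N, ∏ s, (if s = a then g (S s) else 1) = g (S a) := fun a => by simp
    rw [Finset.prod_mul_distrib, Finset.prod_mul_distrib, h, h]
  rw [Finset.sum_congr rfl fun S _ => key S, sum_prod_sample fun s ω =>
    p ω * ((if s = i then g ω else 1) * (if s = j then g ω else 1))]
  split_ifs with h
  · subst h
    rw [Finset.prod_eq_single i]
    · simp [sq]
    · intro b _ hb; simp [hb, hp]
    · simp
  · refine Finset.prod_eq_zero (Finset.mem_univ i) ?_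
    simpa [h] using hg

variable [DecidableEq Ω] 

/-- Empirical frequency of `ω`. -/
noncomputable def empFreq (S : Fin N → Ω) (ω : Ω) : ℝ := (∑ s, if S s = ω then 1 else 0) / N

/-- The frequency of `ω` has variance at most `p ω / N`. Summed over `ω` this is `1 / N`,
independently of the number of outcomes. -/
lemma expect_sq_dist_le (hp : ∑ ω, p ω = 1) (hN : 0 < N) :
    ∑ S : Fin N → Ω, (∏ s, p (S s)) * ∑ ω, (empFreq S ω - p ω) ^ 2 ≤ 1 / N := by
  have hN' : (0 : ℝ) < N := by exact_mod_cast hN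
  have h1 : ∀ ω, ∑ S : Fin N → Ω, (∏ s, p (S s)) * (empFreq S ω - p ω) ^ 2 ≤ p ω / N := by
    intro ω
    let g : Ω → ℝ := fun x => (if x = ω then 1 else 0) - p ω
    have hg : ∑ x, p x * g x = 0 := by
      simp [g, mul_sub, Finset.sum_sub_distrib, ← Finset.sum_mul, hp]
    have e1 : ∀ S : Fin N → Ω, (empFreq S ω - p ω) ^ 2 = (∑ i, ∑ j, g (S i) * g (S j)) / N ^ 2 := by
      intro S
      have : empFreq S ω - p ω = (∑ i, g (S i)) / N := by
        simp only [g, empFreq, Finset.sum_sub_distrib, Finset.sum_const, Finset.card_univ,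
          Fintype.card_fin, nsmul_eq_mul]
        field_simp
      rw [this, div_pow, sq (∑ i, g (S i)), Finset.sum_mul_sum]
    have e2 : ∑ S : Fin N → Ω, (∏ s, p (S s)) * (empFreq S ω - p ω) ^ 2 =
        (∑ i : Fin N, ∑ j : Fin N, ∑ S : Fin N → Ω, (∏ s, p (S s)) * (g (S i) * g (S j))) / N ^ 2 := by
      have e0 : ∑ i : Fin N, ∑ j : Fin N, ∑ S : Fin N → Ω, (∏ s, p (S s)) * (g (S i) * g (S j)) =
          ∑ S : Fin N → Ω, (∏ s, p (S s)) * ∑ i, ∑ j, g (S i) * g (S j) := by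
        simp only [Finset.mul_sum]
        rw [Finset.sum_congr rfl fun i _ => Finset.sum_comm, Finset.sum_comm]
      rw [e0, Finset.sum_div]
      exact Finset.sum_congr rfl fun S _ => by rw [e1, mul_div_assoc]
    have e3 : ∑ x, p x * g x ^ 2 ≤ p ω := by
      have : ∀ x, p x * g x ^ 2 = p x * (if x = ω then 1 - 2 * p ω else 0) + p x * p ω ^ 2 := by
        intro x; simp only [g]; split_ifs <;> ring
      simp only [this, Finset.sum_add_distrib, ← Finset.sum_mul, hp]
      simp
      nlinarith [sq_nonneg (p ω)]
    rw [e2]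
    simp only [expect_mul_centered hp g hg]
    simp only [Finset.sum_ite_eq, Finset.mem_univ, if_true, Finset.sum_const, Finset.card_univ,
      Fintype.card_fin, nsmul_eq_mul]
    rw [div_le_div_iff₀ (by positivity) hN']
    nlinarith
  simp only [Finset.mul_sum]
  rw [Finset.sum_comm]
  refine (Finset.sum_le_sum fun ω _ => h1 ω).trans ?_
  rw [← Finset.sum_div, hp]

end sampling

namespace HMM
variable {n R : ℕ} (H : HMM n R)

lemma obsProb_nonneg {l : ℕ} (x : Fin (l + 1) → Fin n) : 0 ≤ H.obsProb x :=
  Finset.sum_nonneg fun _ _ => mul_nonneg (mul_nonneg (H.w_nonneg _)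
    (Finset.prod_nonneg fun _ _ => H.P_nonneg _ _)) (Finset.prod_nonneg fun _ _ => H.M_nonneg _ _)

lemma sum_obsProb (l : ℕ) : ∑ x : Fin (l + 1) → Fin n, H.obsProb x = 1 := by
  have e : ∀ x : Fin (l + 1) → Fin n, H.obsProb x =
      ∑ r, H.w r * futLaw n H.P H.obs (l + 1) (finFunctionFinEquiv x) r := by
    intro x
    rw [obsProb_eq, finFunctionFinEquiv_apply]; rfl
  rw [Finset.sum_congr rfl fun x _ => e x, finFunctionFinEquiv.sum_comp
    fun c : Fin (n ^ (l + 1)) => ∑ r, H.w r * futLaw n H.P H.obs (l + 1) c r, Finset.sum_comm]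
  rw [← H.w_sum]
  refine Finset.sum_congr rfl fun r _ => ?_
  rw [← Finset.mul_sum, ← Finset.sum_range (fun c => futLaw n H.P H.obs (l + 1) c r),
    sum_futLaw H.P_sum H.sum_obs, mul_one]

lemma sampleProb_mono {l N : ℕ} {E E' : Set (Fin N → Fin (l + 1) → Fin n)} (h : E ⊆ E') :
    H.sampleProb E ≤ H.sampleProb E' := by
  classical
  unfold sampleProb
  refine Finset.sum_le_sum fun S _ => ?_
  have h0 : 0 ≤ ∏ s, H.obsProb (S s) := Finset.prod_nonneg fun s _ => H.obsProb_nonneg _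
  by_cases hS : S ∈ E
  · simp [hS, h hS]
  · rw [if_neg hS]; split_ifs
    exacts [h0, le_rfl]

lemma sampleProb_univ (l N : ℕ) :
    H.sampleProb (Set.univ : Set (Fin N → Fin (l + 1) → Fin n)) = 1 := by
  classical
  simp only [sampleProb, Set.mem_univ, if_true]
  rw [sum_prod_sample fun _ => H.obsProb]
  simp [sum_obsProb]

lemma sampleProb_nonneg {l N : ℕ} (E : Set (Fin N → Fin (l + 1) → Fin n)) : 0 ≤ H.sampleProb E := by
  classical
  refine Finset.sum_nonneg fun S _ => ?_
  split_ifs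
  exacts [Finset.prod_nonneg fun s _ => H.obsProb_nonneg _, le_rfl]

/-- All empirical frequencies are accurate with high probability. -/
lemma le_sampleProb_empFreq {l N : ℕ} (hN : 0 < N) {ε : ℝ} (hε : 0 < ε) :
    1 - 1 / (N * ε ^ 2) ≤ H.sampleProb
      {S : Fin N → Fin (l + 1) → Fin n | ∀ x, |empFreq S x - H.obsProb x| ≤ ε} := by
  classical
  set G := {S : Fin N → Fin (l + 1) → Fin n | ∀ x, |empFreq S x - H.obsProb x| ≤ ε} with hG
  have h1 := expect_sq_dist_le (N := N) (p := fun x : Fin (l + 1) → Fin n => H.obsProb x)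
    (H.sum_obsProb l) hN
  have h2 := H.sampleProb_univ l N
  -- Chebyshev's inequality: outside `G` some frequency is off by more than `ε`, so the total
  -- squared distance exceeds `ε ^ 2`.
  have h3 : H.sampleProb (Set.univ : Set (Fin N → Fin (l + 1) → Fin n)) - H.sampleProb G ≤
      (1 / N) / ε ^ 2 := by
    rw [le_div_iff₀ (by positivity)]
    refine le_trans ?_ h1
    unfold sampleProb
    rw [← Finset.sum_sub_distrib, Finset.sum_mul]
    refine Finset.sum_le_sum fun S _ => ?_
    have h0 : 0 ≤ ∏ s, H.obsProb (S s) := Finset.prod_nonneg fun s _ => H.obsProb_nonneg _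
    by_cases hS : S ∈ G
    · simp only [Set.mem_univ, if_true, hS, sub_self, zero_mul]
      exact mul_nonneg h0 (Finset.sum_nonneg fun _ _ => sq_nonneg _)
    · simp only [Set.mem_univ, if_true, hS, if_false, sub_zero]
      refine mul_le_mul_of_nonneg_left ?_ h0
      simp only [hG, Set.mem_ofPred_eq, not_forall, not_le] at hS
      obtain ⟨x, hx⟩ := hS
      refine le_trans ?_ (Finset.single_le_sum (f := fun x => (empFreq S x - H.obsProb x) ^ 2)
        (fun _ _ => sq_nonneg _) (Finset.mem_univ x))
      rw [← sq_abs (empFreq S x - H.obsProb x)]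
      exact pow_le_pow_left₀ hε.le hx.le 2
  rw [h2, div_div] at h3
  linarith

end HMM

/-! ### Structured programs of the real random access machine -/

namespace RealRAM

lemma Mem.setNat_nat (s : Mem) (a i v b j : ℕ) :
    (s.setNat a i v).nat b j = if b = a ∧ j = i then v else s.nat b j := by
  simp only [Mem.setNat, Function.update_apply]
  by_cases h : b = a
  · subst h; by_cases h' : j = i <;> simp [h']
  · simp [h]

lemma Mem.setNat_real (s : Mem) (a i v : ℕ) : (s.setNat a i v).real = s.real := rfl

lemma Mem.setReal_nat (s : Mem) (a i : ℕ) (v : ℝ) : (s.setReal a i v).nat = s.nat := rfl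

lemma Mem.setReal_real (s : Mem) (a i : ℕ) (v : ℝ) (b j : ℕ) :
    (s.setReal a i v).real b j = if b = a ∧ j = i then v else s.real b j := by
  simp only [Mem.setReal, Function.update_apply]
  by_cases h : b = a
  · subst h; by_cases h' : j = i <;> simp [h']
  · simp [h]

/-- `p`, started in `s`, halts within `T` steps in a memory that satisfies `Q`. -/
def Runs (p : Prog) (s : Mem) (T : ℕ) (Q : Mem → Prop) : Prop :=
  ∃ t s', Exec p s t s' ∧ t ≤ T ∧ Q s'

lemma Runs.mono {p : Prog} {s : Mem} {T T' : ℕ} {Q Q' : Mem → Prop} (h : Runs p s T Q)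
    (hT : T ≤ T') (hQ : ∀ s', Q s' → Q' s') : Runs p s T' Q' := by
  obtain ⟨t, s', h1, h2, h3⟩ := h
  exact ⟨t, s', h1, h2.trans hT, hQ _ h3⟩

lemma Runs.seq {p q : Prog} {s : Mem} {T T' : ℕ} {Q Q' : Mem → Prop} (h : Runs p s T Q)
    (h' : ∀ s', Q s' → Runs q s' T' Q') : Runs (.seq p q) s (T + T') Q' := by
  obtain ⟨t, s', h1, h2, h3⟩ := h
  obtain ⟨t', s'', h4, h5, h6⟩ := h' s' h3
  exact ⟨t + t', s'', .seq h1 h4, add_le_add h2 h5, h6⟩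

lemma runs_skip {s : Mem} {Q : Mem → Prop} (h : Q s) : Runs .skip s 1 Q :=
  ⟨1, s, .skip s, le_rfl, h⟩

lemma runs_setNat {s : Mem} {a : ℕ} {i e : NatExpr} {Q : Mem → Prop}
    (h : Q (s.setNat a (i.eval s) (e.eval s))) :
    Runs (.setNat a i e) s (i.cost + e.cost + 1) Q :=
  ⟨_, _, .setNat s a i e, le_rfl, h⟩

lemma runs_setReal {s : Mem} {a : ℕ} {i : NatExpr} {e : RealExpr} {Q : Mem → Prop}
    (h : Q (s.setReal a (i.eval s) (e.eval s))) :
    Runs (.setReal a i e) s (i.cost + e.cost + 1) Q :=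
  ⟨_, _, .setReal s a i e, le_rfl, h⟩

lemma runs_branch {b : Test} {p q : Prog} {s : Mem} {T : ℕ} {Q : Mem → Prop}
    (hp : b.Holds s → Runs p s T Q) (hq : ¬ b.Holds s → Runs q s T Q) :
    Runs (.branch b p q) s (b.cost + T) Q := by
  by_cases h : b.Holds s
  · obtain ⟨t, s', h1, h2, h3⟩ := hp h
    exact ⟨_, s', .branch_true h h1, Nat.add_le_add_left h2 _, h3⟩
  · obtain ⟨t, s', h1, h2, h3⟩ := hq h
    exact ⟨_, s', .branch_false h h1, Nat.add_le_add_left h2 _, h3⟩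

/-- Loops with an invariant and a bound on the number of rounds. -/
lemma runs_loop {b : Test} {p : Prog} (Inv : ℕ → Mem → Prop) (T m : ℕ)
    (hstep : ∀ i s, Inv i s → b.Holds s → i < m ∧ Runs p s T (Inv (i + 1))) {s : Mem}
    (h0 : Inv 0 s) :
    Runs (.loop b p) s ((m + 1) * (T + b.cost))
      (fun s' => ¬ b.Holds s' ∧ ∃ i, i ≤ m ∧ Inv i s') := by
  have key : ∀ k i s, m - i = k → i ≤ m → Inv i s →
      Runs (.loop b p) s ((k + 1) * (T + b.cost))
        (fun s' => ¬ b.Holds s' ∧ ∃ i, i ≤ m ∧ Inv i s') := by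
    intro k
    induction k with
    | zero =>
      intro i s hk hi hs
      by_cases h : b.Holds s
      · have := (hstep i s hs h).1; omega
      · exact ⟨_, s, .loop_false h, by nlinarith, h, i, hi, hs⟩
    | succ k ih =>
      intro i s hk hi hs
      by_cases h : b.Holds s
      · obtain ⟨him, t, s', h1, h2, h3⟩ := hstep i s hs h
        obtain ⟨t', s'', h4, h5, h6⟩ := ih (i + 1) s' (by omega) (by omega) h3
        exact ⟨_, s'', .loop_true h h1 h4, by nlinarith, h6⟩
      · exact ⟨_, s, .loop_false h, by nlinarith, h, i, hi, hs⟩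
  exact key m 0 s (by omega) (by omega) h0

/-- Scalar variables live in the array `2` of natural numbers. -/
abbrev var (v : ℕ) : NatExpr := .read 2 (.const v)

/-- Assignment to a scalar variable. -/
abbrev setVar (v : ℕ) (e : NatExpr) : Prog := .setNat 2 (.const v) e

/-- `for v < e do p`. -/
def forLoop (v : ℕ) (e : NatExpr) (p : Prog) : Prog :=
  .seq (setVar v (.const 0)) (.loop (.natLt (var v) e)
    (.seq p (setVar v (.add (var v) (.const 1)))))

/-- The invariant must not depend on the loop variable, whose value is tracked separately; the body
has to restore it. The bound may be any expression that keeps its value under the invariant. -/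
lemma runs_forLoop {v : ℕ} {e : NatExpr} {p : Prog} (Inv : ℕ → Mem → Prop) (T b : ℕ)
    (hv : ∀ i s x, Inv i s → Inv i (s.setNat 2 v x)) (he : ∀ i s, Inv i s → e.eval s = b)
    (hstep : ∀ i s, i < b → Inv i s → s.nat 2 v = i →
      Runs p s T (fun s' => s'.nat 2 v = i ∧ Inv (i + 1) s')) {s : Mem} (h0 : Inv 0 s) :
    Runs (forLoop v e p) s ((b + 1) * (T + e.cost + 13)) (Inv b) := by
  have h1 : Runs (setVar v (.const 0)) s 3 (fun s' => Inv 0 s' ∧ s'.nat 2 v = 0 ∧ 0 ≤ b) :=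
    (runs_setNat (Q := fun s' => Inv 0 s' ∧ s'.nat 2 v = 0 ∧ 0 ≤ b)
      ⟨hv _ _ _ h0, by simp [Mem.setNat_nat, NatExpr.eval]⟩)
  have h2 := Runs.seq h1 fun s' hs' => runs_loop (b := .natLt (var v) e)
    (p := .seq p (setVar v (.add (var v) (.const 1))))
    (fun i s => Inv i s ∧ s.nat 2 v = i ∧ i ≤ b) (T + 6) b (by
      rintro i s ⟨hi, hvi, hib⟩ hb
      have hlt : i < b := by
        have := he i s hi
        simpa [Test.Holds, NatExpr.eval, hvi, this] using hb
      refine ⟨hlt, Runs.seq (hstep i s hlt hi hvi) fun s' ⟨h3, h4⟩ =>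
        Runs.mono (runs_setNat (Q := fun s => Inv (i + 1) s ∧ s.nat 2 v = i + 1 ∧ i + 1 ≤ b) ?_)
          (by simp [NatExpr.cost]) fun _ h => h⟩
      refine ⟨hv _ _ _ h4, ?_, hlt⟩
      simp [Mem.setNat_nat, NatExpr.eval, h3]) hs'
  refine h2.mono ?_ ?_
  · simp only [Test.cost, NatExpr.cost]; nlinarith
  · rintro s' ⟨hnb, i, him, hi, hvi, -⟩
    have : i = b := by
      have := he i s' hi
      simp only [Test.Holds, NatExpr.eval, hvi, this, not_lt] at hnb
      omega
    exact this ▸ hi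

/-- The memories `s` and `s'` agree, except for the loop variables and the entries of the array `A`
of reals from `b₀` on. -/
structure TabFrame (A b₀ : ℕ) (s s' : Mem) : Prop where
  nat : ∀ a, a ≠ 2 → s'.nat a = s.nat a
  var : ∀ i, 3 ≤ i → s'.nat 2 i = s.nat 2 i
  real : ∀ a, a ≠ A → s'.real a = s.real a
  low : ∀ x, x < b₀ → s'.real A x = s.real A x

/-- Index of the entry that the program `tab` computes. -/
abbrev tabIdx (off e₂ : NatExpr) : NatExpr := .add off (.add (.mul (var 0) e₂) (var 1))

/-- For all `i < e₁`, `j < e₂`, store `init + ∑ k < e₃, ex` in entry `off + (i * e₂ + j)` of the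
array `A` of reals. -/
def tab (A : ℕ) (off e₁ e₂ e₃ : NatExpr) (init ex : RealExpr) : Prog :=
  forLoop 0 e₁ (forLoop 1 e₂ (.seq (.setReal A (tabIdx off e₂) init)
    (forLoop 2 e₃ (.setReal A (tabIdx off e₂) (.add (.read A (tabIdx off e₂)) ex)))))

/-- Constant in the running time of `tab`. -/
def tabCost (off e₁ e₂ e₃ : NatExpr) (init ex : RealExpr) : ℕ :=
  11 * (off.cost + e₁.cost + e₂.cost + e₃.cost + init.cost + ex.cost + 50)

lemma TabFrame.refl (A b₀ : ℕ) (s : Mem) : TabFrame A b₀ s s :=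
  ⟨fun _ _ => rfl, fun _ _ => rfl, fun _ _ => rfl, fun _ _ => rfl⟩

lemma TabFrame.setVar {A b₀ : ℕ} {s s' : Mem} (h : TabFrame A b₀ s s') {v : ℕ} (hv : v < 3) (x : ℕ) :
    TabFrame A b₀ s (s'.setNat 2 v x) := by
  refine ⟨fun a ha => ?_, fun i hi => ?_, h.real, h.low⟩
  · rw [← h.nat a ha]; funext j; simp [Mem.setNat_nat, ha]
  · rw [← h.var i hi, Mem.setNat_nat, if_neg (by omega)]

lemma TabFrame.setCell {A b₀ : ℕ} {s s' : Mem} (h : TabFrame A b₀ s s') (l : ℕ) (x : ℝ) :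
    TabFrame A b₀ s (s'.setReal A (b₀ + l) x) := by
  refine ⟨h.nat, h.var, fun a ha => ?_, fun y hy => ?_⟩
  · rw [← h.real a ha]; funext j; simp [Mem.setReal_real, ha]
  · rw [← h.low y hy, Mem.setReal_real, if_neg (by omega)]

/-- State of the program `tab` before the entry `m` is computed. -/
structure TabInv (A b₀ b₂ : ℕ) (G : ℕ → ℕ → ℝ) (s : Mem) (m : ℕ) (s' : Mem) : Prop where
  frame : TabFrame A b₀ s s'
  high : ∀ l, m ≤ l → s'.real A (b₀ + l) = s.real A (b₀ + l)
  done : ∀ i j, j < b₂ → i * b₂ + j < m → s'.real A (b₀ + (i * b₂ + j)) = G i j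

lemma TabInv.setVar {A b₀ b₂ m : ℕ} {G : ℕ → ℕ → ℝ} {s s' : Mem} (h : TabInv A b₀ b₂ G s m s')
    {v : ℕ} (hv : v < 3) (x : ℕ) : TabInv A b₀ b₂ G s m (s'.setNat 2 v x) :=
  ⟨h.frame.setVar hv x, h.high, h.done⟩

lemma mul_add_inj {b i j i' j' : ℕ} (hj : j < b) (hj' : j' < b) (h : i * b + j = i' * b + j') :
    i = i' ∧ j = j' := by
  have hb : 0 < b := by omega
  have h1 : (i * b + j) / b = i := by
    rw [mul_comm, Nat.mul_add_div hb, Nat.div_eq_of_lt hj, add_zero]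
  have h2 : (i' * b + j') / b = i' := by
    rw [mul_comm, Nat.mul_add_div hb, Nat.div_eq_of_lt hj', add_zero]
  have : i = i' := by rw [← h1, h, h2]
  subst this
  exact ⟨rfl, by omega⟩

/-- All matrix computations of the algorithm are instances of this triple loop. The expression
`init` may read the cell that is about to be overwritten, since that cell still has its old value;
this permits updates in place. The expression `ex` may use the array `A` only below the offset `b₀`.
-/
lemma runs_tab {A : ℕ} {off e₁ e₂ e₃ : NatExpr} {init ex : RealExpr} (s : Mem)
    (b₀ b₁ b₂ b₃ : ℕ) (g₀ : ℕ → ℕ → ℝ) (g : ℕ → ℕ → ℕ → ℝ)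
    (hb : ∀ s', TabFrame A b₀ s s' →
      off.eval s' = b₀ ∧ e₁.eval s' = b₁ ∧ e₂.eval s' = b₂ ∧ e₃.eval s' = b₃)
    (hinit : ∀ i j s', i < b₁ → j < b₂ → TabFrame A b₀ s s' → s'.nat 2 0 = i → s'.nat 2 1 = j →
      s'.real A (b₀ + (i * b₂ + j)) = s.real A (b₀ + (i * b₂ + j)) → init.eval s' = g₀ i j)
    (hex : ∀ i j k s', i < b₁ → j < b₂ → k < b₃ → TabFrame A b₀ s s' → s'.nat 2 0 = i →
      s'.nat 2 1 = j → s'.nat 2 2 = k → ex.eval s' = g i j k) :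
    Runs (tab A off e₁ e₂ e₃ init ex) s
      (tabCost off e₁ e₂ e₃ init ex * ((b₁ + 1) * ((b₂ + 1) * (b₃ + 1))))
      (fun s' => TabFrame A b₀ s s' ∧
        (∀ l, b₁ * b₂ ≤ l → s'.real A (b₀ + l) = s.real A (b₀ + l)) ∧
        ∀ i j, i < b₁ → j < b₂ →
          s'.real A (b₀ + (i * b₂ + j)) = g₀ i j + ∑ k ∈ Finset.range b₃, g i j k) := by
  obtain ⟨K, hK⟩ : ∃ K, K = off.cost + e₁.cost + e₂.cost + e₃.cost + init.cost + ex.cost + 50 :=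
    ⟨_, rfl⟩
  set G : ℕ → ℕ → ℝ := fun i j => g₀ i j + ∑ k ∈ Finset.range b₃, g i j k with hG
  have hidx : ∀ i j s', TabFrame A b₀ s s' → s'.nat 2 0 = i → s'.nat 2 1 = j →
      (tabIdx off e₂).eval s' = b₀ + (i * b₂ + j) := by
    intro i j s' hf h0 h1
    obtain ⟨ho, -, h2, -⟩ := hb s' hf
    simp [NatExpr.eval, ho, h2, h0, h1]
  have hcell : ∀ i j s', i < b₁ → j < b₂ → TabInv A b₀ b₂ G s (i * b₂ + j) s' → s'.nat 2 0 = i →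
      s'.nat 2 1 = j → Runs (.seq (.setReal A (tabIdx off e₂) init)
        (forLoop 2 e₃ (.setReal A (tabIdx off e₂) (.add (.read A (tabIdx off e₂)) ex)))) s'
        (9 * K * (b₃ + 1))
        (fun s' => TabInv A b₀ b₂ G s (i * b₂ + (j + 1)) s' ∧ s'.nat 2 0 = i ∧ s'.nat 2 1 = j) := by
    intro i j s' hi hj hs' h0 h1
    let Mid : ℕ → Mem → Prop := fun k s'' => TabFrame A b₀ s s'' ∧
      (∀ l, i * b₂ + j < l → s''.real A (b₀ + l) = s.real A (b₀ + l)) ∧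
      (∀ i' j', j' < b₂ → i' * b₂ + j' < i * b₂ + j →
        s''.real A (b₀ + (i' * b₂ + j')) = G i' j') ∧
      s''.nat 2 0 = i ∧ s''.nat 2 1 = j ∧
      s''.real A (b₀ + (i * b₂ + j)) = g₀ i j + ∑ k ∈ Finset.range k, g i j k
    have hset : ∀ (s'' : Mem) x, TabFrame A b₀ s s'' →
        (∀ l, i * b₂ + j < l → s''.real A (b₀ + l) = s.real A (b₀ + l)) →
        (∀ i' j', j' < b₂ → i' * b₂ + j' < i * b₂ + j →
          s''.real A (b₀ + (i' * b₂ + j')) = G i' j') → s''.nat 2 0 = i → s''.nat 2 1 = j →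
        ∀ k, x = g₀ i j + ∑ k ∈ Finset.range k, g i j k →
          Mid k (s''.setReal A (b₀ + (i * b₂ + j)) x) := by
      intro s'' x hf hh hd h0 h1 k hx
      refine ⟨hf.setCell _ _, fun l hl => ?_, fun i' j' hj' hl => ?_, h0, h1, ?_⟩
      · rw [Mem.setReal_real, if_neg (by omega), hh l hl]
      · rw [Mem.setReal_real, if_neg (by omega), hd i' j' hj' hl]
      · rw [Mem.setReal_real, if_pos ⟨rfl, rfl⟩, hx]
    have h2 : Runs (.setReal A (tabIdx off e₂) init) s' (2 * K) (Mid 0) := by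
      refine (runs_setReal ?_).mono ?_ fun _ h => h
      · rw [hidx i j s' hs'.frame h0 h1]
        refine hset s' _ hs'.frame (fun l hl => hs'.high l hl.le) hs'.done h0 h1 0 ?_
        rw [hinit i j s' hi hj hs'.frame h0 h1 (hs'.high _ le_rfl)]; simp
      · simp only [NatExpr.cost]; omega
    refine (h2.seq fun s'' hs'' => runs_forLoop Mid (4 * K) b₃ ?_ ?_ ?_ hs'').mono ?_ ?_
    · rintro k s x ⟨h1, h2, h3, h4, h5, h6⟩
      refine ⟨h1.setVar (by norm_num) x, h2, h3, ?_, ?_, h6⟩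
      · simpa [Mem.setNat_nat] using h4
      · simpa [Mem.setNat_nat] using h5
    · intro k s h; exact (hb s h.1).2.2.2
    · rintro k s'' hk ⟨h1, h2, h3, h4, h5, h6⟩ hvk
      refine (runs_setReal ?_).mono ?_ fun _ h => h
      · rw [hidx i j s'' h1 h4 h5]
        refine ⟨by simpa [Mem.setReal_nat] using hvk, hset s'' _ h1 h2 h3 h4 h5 (k + 1) ?_⟩
        have e1 : (RealExpr.read A (tabIdx off e₂)).eval s'' =
            s''.real A (b₀ + (i * b₂ + j)) := by
          rw [RealExpr.eval, hidx i j s'' h1 h4 h5]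
        rw [RealExpr.eval, e1, h6, hex i j k s'' hi hj hk h1 h4 h5 hvk, Finset.sum_range_succ]
        ring
      · simp only [NatExpr.cost, RealExpr.cost]; omega
    · have h3 : (b₃ + 1) * (4 * K + e₃.cost + 13) ≤ (b₃ + 1) * (5 * K) :=
        Nat.mul_le_mul_left _ (by omega)
      have h4 : 2 * K + (b₃ + 1) * (5 * K) + 2 * K + 4 * K * b₃ = 9 * K * (b₃ + 1) := by ring
      omega
    · rintro s'' ⟨h1, h2, h3, h4, h5, h6⟩
      refine ⟨⟨h1, fun l hl => h2 l (by omega), fun i' j' hj' hl => ?_⟩, h4, h5⟩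
      rcases Nat.lt_or_ge (i' * b₂ + j') (i * b₂ + j) with h | h
      · exact h3 i' j' hj' h
      · obtain ⟨rfl, rfl⟩ := mul_add_inj hj' hj (by omega : i' * b₂ + j' = i * b₂ + j)
        exact h6
  have hrow : ∀ i s', i < b₁ → TabInv A b₀ b₂ G s (i * b₂) s' → s'.nat 2 0 = i →
      Runs (forLoop 1 e₂ (.seq (.setReal A (tabIdx off e₂) init)
        (forLoop 2 e₃ (.setReal A (tabIdx off e₂) (.add (.read A (tabIdx off e₂)) ex))))) s'
        ((b₂ + 1) * (10 * K * (b₃ + 1)))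
        (fun s' => s'.nat 2 0 = i ∧ TabInv A b₀ b₂ G s ((i + 1) * b₂) s') := by
    intro i s' hi hs' h0
    refine (runs_forLoop (fun j s' => TabInv A b₀ b₂ G s (i * b₂ + j) s' ∧ s'.nat 2 0 = i)
      (9 * K * (b₃ + 1)) b₂ ?_ ?_ ?_ ⟨hs', h0⟩).mono ?_ ?_
    · rintro j s' x ⟨h1, h2⟩
      exact ⟨h1.setVar (by norm_num) x, by simpa [Mem.setNat_nat] using h2⟩
    · rintro j s' ⟨h1, -⟩; exact (hb s' h1.frame).2.2.1
    · rintro j s' hj ⟨h1, h2⟩ h3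
      exact (hcell i j s' hi hj h1 h2 h3).mono le_rfl fun s'' ⟨h4, h5, h6⟩ => ⟨h6, h4, h5⟩
    · have h5 : e₂.cost + 13 ≤ K * (b₃ + 1) :=
        (by omega : e₂.cost + 13 ≤ K).trans (Nat.le_mul_of_pos_right _ (by positivity))
      refine Nat.mul_le_mul_left _ ?_
      have : 9 * K * (b₃ + 1) + K * (b₃ + 1) = 10 * K * (b₃ + 1) := by ring
      omega
    · rintro s' ⟨h1, h2⟩
      refine ⟨h2, ?_⟩
      rwa [show (i + 1) * b₂ = i * b₂ + b₂ by ring]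
  refine (runs_forLoop (fun i s' => TabInv A b₀ b₂ G s (i * b₂) s')
    ((b₂ + 1) * (10 * K * (b₃ + 1))) b₁ ?_ ?_ ?_ ?_).mono ?_ ?_
  · intro i s' x h; exact h.setVar (by norm_num) x
  · intro i s' h; exact (hb s' h.frame).2.1
  · intro i s' hi h h0; exact hrow i s' hi h h0
  · exact ⟨TabFrame.refl _ _ _, fun _ _ => rfl, fun i j _ h => by omega⟩
  · have h5 : e₁.cost + 13 ≤ K := by omega
    have h6 : e₁.cost + 13 ≤ K * ((b₂ + 1) * (b₃ + 1)) := h5.trans (Nat.le_mul_of_pos_right _ (by positivity))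
    rw [tabCost, ← hK]
    have h7 : (b₂ + 1) * (10 * K * (b₃ + 1)) + K * ((b₂ + 1) * (b₃ + 1)) =
        11 * K * ((b₂ + 1) * (b₃ + 1)) := by ring
    calc _ ≤ (b₁ + 1) * (11 * K * ((b₂ + 1) * (b₃ + 1))) := Nat.mul_le_mul_left _ (by omega)
      _ = _ := by ring
  · intro s' h
    refine ⟨h.frame, h.high, fun i j hi hj => h.done i j hj ?_⟩
    calc i * b₂ + j < i * b₂ + b₂ := by omega
      _ = (i + 1) * b₂ := by ring
      _ ≤ b₁ * b₂ := Nat.mul_le_mul_right _ hi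

end RealRAM

/-! ### Residuals and Landweber iteration on the machine -/

namespace RealRAM

/-- The expression `e ^ k`. -/
def NatExpr.npow (e : NatExpr) : ℕ → NatExpr
  | 0 => .const 1
  | k + 1 => .mul (e.npow k) e

@[simp] lemma NatExpr.eval_npow (s : Mem) (e : NatExpr) (k : ℕ) :
    (e.npow k).eval s = e.eval s ^ k := by
  induction k with
  | zero => rfl
  | succ k ih => rw [npow, eval, ih, pow_succ]

/-- The expression that is `1` if `e = f`, and `0` otherwise. -/
def NatExpr.eqInd (e f : NatExpr) : NatExpr := .sub (.const 1) (.add (.sub e f) (.sub f e))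

lemma NatExpr.eval_eqInd (s : Mem) (e f : NatExpr) :
    (e.eqInd f).eval s = if e.eval s = f.eval s then 1 else 0 := by
  simp only [eqInd, eval]
  split_ifs <;> omega

/-- The memories `s` and `s'` agree, except for the scalar variables in `X` and the arrays of reals
in `Y`. -/
structure Frame (X Y : Finset ℕ) (s s' : Mem) : Prop where
  nat : ∀ a, a ≠ 2 → s'.nat a = s.nat a
  var : ∀ i, i ∉ X → s'.nat 2 i = s.nat 2 i
  real : ∀ a, a ∉ Y → s'.real a = s.real a

lemma Frame.refl (X Y : Finset ℕ) (s : Mem) : Frame X Y s s :=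
  ⟨fun _ _ => rfl, fun _ _ => rfl, fun _ _ => rfl⟩

lemma Frame.trans {X Y : Finset ℕ} {s s' s'' : Mem} (h : Frame X Y s s') (h' : Frame X Y s' s'') :
    Frame X Y s s'' :=
  ⟨fun a ha => (h'.nat a ha).trans (h.nat a ha), fun a ha => (h'.var a ha).trans (h.var a ha),
    fun a ha => (h'.real a ha).trans (h.real a ha)⟩

lemma Frame.mono {X Y X' Y' : Finset ℕ} {s s' : Mem} (h : Frame X Y s s') (hX : X ⊆ X')
    (hY : Y ⊆ Y') : Frame X' Y' s s' :=
  ⟨h.nat, fun a ha => h.var a fun h => ha (hX h), fun a ha => h.real a fun h => ha (hY h)⟩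

lemma Frame.setVar {X Y : Finset ℕ} {s s' : Mem} (h : Frame X Y s s') {v : ℕ} (hv : v ∈ X) (x : ℕ) :
    Frame X Y s (s'.setNat 2 v x) := by
  refine ⟨fun a ha => ?_, fun i hi => ?_, h.real⟩
  · rw [← h.nat a ha]; funext j; simp [Mem.setNat_nat, ha]
  · rw [← h.var i hi, Mem.setNat_nat, if_neg]
    rintro ⟨-, rfl⟩; exact hi hv

lemma TabFrame.toFrame {A b₀ : ℕ} {s s' : Mem} (h : TabFrame A b₀ s s') :
    Frame {0, 1, 2} {A} s s' := by
  refine ⟨h.nat, fun i hi => h.var i ?_, fun a ha => h.real a ?_⟩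
  · by_contra h0
    have : i = 0 ∨ i = 1 ∨ i = 2 := by omega
    simp [this] at hi
  · simpa using ha

/-- Program for the residual `r = T y - h`, for matrices `T` of size `e₁ × e₂` and `y` of size
`e₂ × e₃`. -/
def residProg (T h y r : ℕ) (e₁ e₂ e₃ : NatExpr) : Prog :=
  tab r (.const 0) e₁ e₃ e₂ (.sub (.ofNat (.const 0)) (.read h (.add (.mul (var 0) e₃) (var 1))))
    (.mul (.read T (.add (.mul (var 0) e₂) (var 2))) (.read y (.add (.mul (var 2) e₃) (var 1))))

/-- Program for the step `y ← y - Tᵀ r / B ^ a`. -/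
def descentProg (T y r : ℕ) (e₁ e₂ e₃ : NatExpr) (a : ℕ) : Prog :=
  tab y (.const 0) e₂ e₃ e₁ (.read y (.add (.mul (var 0) e₃) (var 1)))
    (.sub (.ofNat (.const 0)) (.mul (.mul (.div (.ofNat (.const 1)) (.ofNat ((var 10).npow a)))
      (.read T (.add (.mul (var 2) e₂) (var 0)))) (.read r (.add (.mul (var 2) e₃) (var 1)))))

/-- Program for `B ^ l` rounds of the Landweber iteration with step `1 / B ^ a`, where `B` is the
scalar variable number `10`. -/
def landweberProg (T h y r : ℕ) (e₁ e₂ e₃ : NatExpr) (a l : ℕ) : Prog :=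
  .seq (tab y (.const 0) e₂ e₃ (.const 0) (.ofNat (.const 0)) (.ofNat (.const 0)))
    (forLoop 3 ((var 10).npow l)
      (.seq (residProg T h y r e₁ e₂ e₃) (descentProg T y r e₁ e₂ e₃ a)))

section landweber
variable {T h y r : ℕ} {e₁ e₂ e₃ : NatExpr} {a l : ℕ} {d₁ d₂ e B : ℕ}

/-- The dimensions of a linear system are stored in `s`. -/
def HasDims (Y : Finset ℕ) (e₁ e₂ e₃ : NatExpr) (d₁ d₂ e B : ℕ) (s : Mem) : Prop :=
  ∀ s', Frame {0, 1, 2, 3} Y s s' →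
    e₁.eval s' = d₁ ∧ e₂.eval s' = d₂ ∧ e₃.eval s' = e ∧ s'.nat 2 10 = B

lemma HasDims.of_tabFrame {Y : Finset ℕ} {s s' : Mem} {A b₀ : ℕ}
    (hd : HasDims Y e₁ e₂ e₃ d₁ d₂ e B s) (hA : A ∈ Y) (h : TabFrame A b₀ s s') :
    e₁.eval s' = d₁ ∧ e₂.eval s' = d₂ ∧ e₃.eval s' = e ∧ s'.nat 2 10 = B :=
  hd s' (h.toFrame.mono (by decide) (by simpa using hA))

lemma HasDims.of_frame {Y : Finset ℕ} {s s' : Mem} (hd : HasDims Y e₁ e₂ e₃ d₁ d₂ e B s)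
    (h : Frame {0, 1, 2, 3} Y s s') : HasDims Y e₁ e₂ e₃ d₁ d₂ e B s' :=
  fun s'' h' => hd s'' (h.trans h')

lemma runs_residProg (hTr : T ≠ r) (hhr : h ≠ r) (hyr : y ≠ r) :
    ∃ K : ℕ, ∀ (Y : Finset ℕ) (s : Mem) (d₁ d₂ e B : ℕ), r ∈ Y → HasDims Y e₁ e₂ e₃ d₁ d₂ e B s →
      Runs (residProg T h y r e₁ e₂ e₃) s (K * ((d₁ + 1) * (d₂ + 1) * (e + 1)))
        (fun s' => TabFrame r 0 s s' ∧ ∀ J c, J < d₁ → c < e → s'.real r (J * e + c) =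
          lwResid (Finset.range d₂) (fun J I => s.real T (J * d₂ + I))
            (fun J => s.real h (J * e + c)) (fun I => s.real y (I * e + c)) J) := by
  -- The constant stays open until the time bound of `tab` determines it; it depends on the
  -- expressions of the program only.
  apply Exists.intro
  intro Y s d₁ d₂ e B hr hd
  refine (runs_tab s 0 d₁ e d₂ (fun J c => -s.real h (J * e + c))
    (fun J c I => s.real T (J * d₂ + I) * s.real y (I * e + c)) ?_ ?_ ?_).mono ?_ ?_
  · intro s' h
    obtain ⟨h1, h2, h3, -⟩ := hd.of_tabFrame hr h
    exact ⟨rfl, h1, h3, h2⟩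
  · intro i j s' _ _ hf h0 h1 _
    obtain ⟨h2, h3, h4, -⟩ := hd.of_tabFrame hr hf
    simp [RealExpr.eval, NatExpr.eval, h0, h1, h4, hf.real _ hhr]
  · intro i j k s' _ _ _ hf h0 h1 hk
    obtain ⟨h2, h3, h4, -⟩ := hd.of_tabFrame hr hf
    simp [RealExpr.eval, NatExpr.eval, h0, h1, hk, h3, h4, hf.real _ hTr, hf.real _ hyr]
  · exact Nat.mul_le_mul_left _ (by rw [mul_assoc, mul_comm (e + 1)])
  · rintro s' ⟨h1, -, h2⟩
    refine ⟨h1, fun J c hJ hc => ?_⟩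
    have := h2 J c hJ hc
    rw [zero_add] at this
    rw [this]; rfl

lemma runs_descentProg (hTy : T ≠ y) (hry : r ≠ y) :
    ∃ K : ℕ, ∀ (Y : Finset ℕ) (s : Mem) (d₁ d₂ e B : ℕ), y ∈ Y → HasDims Y e₁ e₂ e₃ d₁ d₂ e B s →
      Runs (descentProg T y r e₁ e₂ e₃ a) s (K * ((d₁ + 1) * (d₂ + 1) * (e + 1)))
        (fun s' => TabFrame y 0 s s' ∧ ∀ I c, I < d₂ → c < e → s'.real y (I * e + c) =
          s.real y (I * e + c) + ∑ J ∈ Finset.range d₁,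
            -(1 / (B : ℝ) ^ a * s.real T (J * d₂ + I) * s.real r (J * e + c))) := by
  apply Exists.intro
  intro Y s d₁ d₂ e B hy hd
  refine (runs_tab s 0 d₂ e d₁ (fun I c => s.real y (I * e + c))
    (fun I c J => -(1 / (B : ℝ) ^ a * s.real T (J * d₂ + I) * s.real r (J * e + c)))
    ?_ ?_ ?_).mono ?_ ?_
  · intro s' h
    obtain ⟨h1, h2, h3, -⟩ := hd.of_tabFrame hy h
    exact ⟨rfl, h2, h3, h1⟩
  · intro i j s' _ _ hf h0 h1 h5
    obtain ⟨h2, h3, h4, -⟩ := hd.of_tabFrame hy hf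
    rw [zero_add] at h5
    simpa [RealExpr.eval, NatExpr.eval, h0, h1, h4] using h5
  · intro i j k s' _ _ _ hf h0 h1 hk
    obtain ⟨h2, h3, h4, h5⟩ := hd.of_tabFrame hy hf
    simp [RealExpr.eval, NatExpr.eval, h0, h1, hk, h3, h4, h5, hf.real _ hTy, hf.real _ hry]
  · refine Nat.mul_le_mul_left _ (le_of_eq (by ring))
  · rintro s' ⟨h1, -, h2⟩
    refine ⟨h1, fun J c hJ hc => ?_⟩
    have := h2 J c hJ hc
    rwa [zero_add] at this

/-- The Landweber program computes the Landweber iterates, column by column. -/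
lemma runs_landweberProg (hTr : T ≠ r) (hhr : h ≠ r) (hyr : y ≠ r) (hTy : T ≠ y) (hhy : h ≠ y) :
    ∃ K : ℕ, ∀ (s : Mem) (d₁ d₂ e B : ℕ), HasDims {y, r} e₁ e₂ e₃ d₁ d₂ e B s →
      Runs (landweberProg T h y r e₁ e₂ e₃ a l) s
        (K * ((d₁ + 1) * (d₂ + 1) * (e + 1) * (B ^ l + 1)))
        (fun s' => Frame {0, 1, 2, 3} {y, r} s s' ∧ ∀ I c, I < d₂ → c < e → s'.real y (I * e + c) =
          lwIter (Finset.range d₁) (Finset.range d₂) (fun J I => s.real T (J * d₂ + I))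
            (fun J => s.real h (J * e + c)) (1 / (B : ℝ) ^ a) (B ^ l) I) := by
  obtain ⟨K₁, hK₁⟩ := runs_residProg (e₁ := e₁) (e₂ := e₂) (e₃ := e₃) hTr hhr hyr
  obtain ⟨K₂, hK₂⟩ := runs_descentProg (e₁ := e₁) (e₂ := e₂) (e₃ := e₃) (a := a) hTy hyr.symm
  set K₀ := tabCost (.const 0) e₂ e₃ (.const 0) (.ofNat (.const 0)) (.ofNat (.const 0)) with hK₀
  refine ⟨K₀ + (K₁ + K₂ + ((var 10).npow l).cost + 13), fun s d₁ d₂ e B hd => ?_⟩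
  set Inv : ℕ → Mem → Prop := fun i s' => Frame {0, 1, 2, 3} {y, r} s s' ∧
    ∀ I c, I < d₂ → c < e → s'.real y (I * e + c) =
      lwIter (Finset.range d₁) (Finset.range d₂) (fun J I => s.real T (J * d₂ + I))
        (fun J => s.real h (J * e + c)) (1 / (B : ℝ) ^ a) i I with hInv
  set D := (d₁ + 1) * (d₂ + 1) * (e + 1) with hD
  have hD1 : 1 ≤ D := Nat.one_le_iff_ne_zero.2 (by positivity)
  have h0 : Runs (tab y (.const 0) e₂ e₃ (.const 0) (.ofNat (.const 0)) (.ofNat (.const 0))) s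
      (K₀ * D) (Inv 0) := by
    refine (runs_tab s 0 d₂ e 0 (fun _ _ => 0) (fun _ _ _ => 0) ?_ ?_ ?_).mono ?_ ?_
    · intro s' h
      obtain ⟨-, h2, h3, -⟩ := hd.of_tabFrame (by simp) h
      exact ⟨rfl, h2, h3, rfl⟩
    · intros; simp [RealExpr.eval, NatExpr.eval]
    · intros; simp [RealExpr.eval, NatExpr.eval]
    · refine Nat.mul_le_mul_left _ ?_
      rw [hD, zero_add, mul_one, mul_assoc]
      exact Nat.le_mul_of_pos_left _ (by positivity)
    · rintro s' ⟨h1, -, h2⟩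
      refine ⟨h1.toFrame.mono (by decide) (by simp), fun I c hI hc => ?_⟩
      have := h2 I c hI hc
      rw [zero_add] at this
      rw [this]; simp [lwIter]
  refine (h0.seq fun s₁ hs₁ => runs_forLoop Inv (K₁ * D + K₂ * D) (B ^ l) ?_ ?_ ?_ hs₁).mono ?_ ?_
  · rintro i s' x ⟨h1, h2⟩
    exact ⟨h1.setVar (by decide) x, h2⟩
  · rintro i s' ⟨h1, -⟩
    rw [NatExpr.eval_npow]
    have := (hd s' h1).2.2.2
    simp only [NatExpr.eval, this]
  · rintro i s' hi ⟨h1, h2⟩ hv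
    refine (hK₁ {y, r} s' d₁ d₂ e B (by simp) (hd.of_frame h1)).seq fun s₂ ⟨h3, h4⟩ => ?_
    have hf2 : Frame {0, 1, 2, 3} {y, r} s s₂ := h1.trans (h3.toFrame.mono (by decide) (by simp))
    refine (hK₂ {y, r} s₂ d₁ d₂ e B (by simp) (hd.of_frame hf2)).mono le_rfl ?_
    rintro s₃ ⟨h5, h6⟩
    refine ⟨?_, hf2.trans (h5.toFrame.mono (by decide) (by simp)), fun I c hI hc => ?_⟩
    · rw [h5.var 3 le_rfl, h3.var 3 le_rfl, hv]
    · have eT : s₂.real T = s.real T := hf2.real T (by simp [hTr, hTy])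
      have eh : s'.real h = s.real h := h1.real h (by simp [hhr, hhy])
      have eT' : s'.real T = s.real T := h1.real T (by simp [hTr, hTy])
      rw [h6 I c hI hc, h3.real y hyr, h2 I c hI hc, eT]
      simp only [lwIter]
      congr 1
      refine Finset.sum_congr rfl fun J hJ => ?_
      rw [h4 J c (Finset.mem_range.1 hJ) hc, eT', eh]
      congr 2
      exact lwResid_congr _ _ _ (fun I hI => h2 I c (Finset.mem_range.1 hI) hc) J
  · set c₀ := ((var 10).npow l).cost
    set L := B ^ l
    have : K₁ * D + K₂ * D + c₀ + 13 ≤ (K₁ + K₂ + c₀ + 13) * D := by nlinarith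
    calc K₀ * D + (L + 1) * (K₁ * D + K₂ * D + c₀ + 13)
        ≤ K₀ * D * (L + 1) + (L + 1) * ((K₁ + K₂ + c₀ + 13) * D) :=
          add_le_add (Nat.le_mul_of_pos_right _ (by positivity)) (Nat.mul_le_mul_left _ this)
      _ = _ := by ring
  · exact fun _ h => h

end landweber

end RealRAM

/-- Landweber iterates only depend on the entries of the system. -/
lemma lwIter_congr {ι κ : Type*} (s : Finset κ) (t : Finset ι) {A A' : κ → ι → ℝ} {h h' : κ → ℝ}
    (hA : ∀ J ∈ s, ∀ I ∈ t, A J I = A' J I) (hh : ∀ J ∈ s, h J = h' J) (σ : ℝ) (L : ℕ) :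
    ∀ I ∈ t, lwIter s t A h σ L I = lwIter s t A' h' σ L I := by
  induction L with
  | zero => intro I _; rfl
  | succ L ih =>
    intro I hI
    simp only [lwIter]
    rw [ih I hI]
    congr 1
    refine Finset.sum_congr rfl fun J hJ => ?_
    rw [hA J hJ I hI]
    congr 2
    simp only [lwResid]
    rw [hh J hJ]
    congr 1
    exact Finset.sum_congr rfl fun I' hI' => by rw [hA J hJ I' hI', ih I' hI']

/-! ### The quantities that the learning algorithm computes -/

/-- From the law `p` of a past block, an observation and a future block: the joint law of past and
future. -/
def lateMarg (n d : ℕ) (p : ℕ → ℝ) (J I : ℕ) : ℝ := ∑ x ∈ Finset.range n, p (I + d * (x + n * J))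

/-- The joint law of the past block and the block that follows it immediately. -/
def earlyMarg (n d : ℕ) (p : ℕ → ℝ) (J I : ℕ) : ℝ := ∑ y ∈ Finset.range n, p (I + d * (J + d * y))

/-- The joint law of the past block and the observation that follows it. -/
def obsMarg (n d : ℕ) (p : ℕ → ℝ) (x I : ℕ) : ℝ := ∑ J ∈ Finset.range d, p (I + d * (x + n * J))

/-- Matrix of the system that detects whether `lam` is the `α`-mean of the observation in some
state: the last row normalizes. -/
def slopeMat (n d : ℕ) (p : ℕ → ℝ) (α : ℕ → ℝ) (lam : ℝ) (J I : ℕ) : ℝ :=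
  if J < d then ∑ x ∈ Finset.range n, (α x - lam) * p (I + d * (x + n * J))
  else ∑ J' ∈ Finset.range d, lateMarg n d p J' I

/-- Right hand side of that system. -/
def slopeRhs (d J : ℕ) : ℝ := if J = d then 1 else 0

/-- The approximate solution for the `j`-th grid point. -/
noncomputable def candSol (n d B : ℕ) (p : ℕ → ℝ) (α : ℕ → ℝ) (j : ℕ) : ℕ → ℝ :=
  lwIter (Finset.range (d + 1)) (Finset.range d) (slopeMat n d p α (j / (B : ℝ) ^ 17)) (slopeRhs d)
    (1 / (B : ℝ) ^ 7) (B ^ 41)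

/-- Its squared residual. -/
noncomputable def candRes (n d B : ℕ) (p : ℕ → ℝ) (α : ℕ → ℝ) (j : ℕ) : ℝ :=
  nsq (Finset.range (d + 1)) (lwResid (Finset.range d) (slopeMat n d p α (j / (B : ℝ) ^ 17))
    (slopeRhs d) (candSol n d B p α j))

/-- Test on grid points. -/
def CandOk (n d B : ℕ) (p : ℕ → ℝ) (α : ℕ → ℝ) (j : ℕ) : Prop :=
  candRes n d B p α j < 1 / (B : ℝ) ^ 32

/-- Greedy selection, among the `j < G` that pass, of at most `R` numbers at distances at
least `W`. -/
structure Selected (pass : ℕ → Prop) (W R G cnt : ℕ) (js : ℕ → ℕ) : Prop where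
  le : cnt ≤ R
  lt : ∀ i < cnt, js i < G
  ok : ∀ i < cnt, pass (js i)
  apart : ∀ i i', i < i' → i' < cnt → js i + W ≤ js i'
  max : ∀ j < G, pass j → cnt = R ∨ ∃ i < cnt, js i ≤ j ∧ j < js i + W

/-- The `g`-th multiple of a unit vector with coefficient less than `L`. -/
def unitWeight (L g y : ℕ) : ℕ := (g - y * L) * (1 - (g + 1 - (y + 1) * L))

/-- Enumeration of the vectors of observation weights. -/
def weightVec (n L : ℕ) : ℕ → ℕ → ℕ
  | 0 => fun _ => 0
  | e + 1 => fun y => weightVec n L (e / (n * L)) y + unitWeight L (e % (n * L)) y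
termination_by e => e
decreasing_by exact Nat.lt_succ_of_le (Nat.div_le_self _ _)

/-! ### The search on the machine -/

namespace RealRAM

/-- Running times are recorded as powers of `B`, so that composing programs merely adds exponents.
-/
lemma pow_add_pow_le {B : ℕ} (hB : 2 ≤ B) (a b : ℕ) : B ^ a + B ^ b ≤ B ^ (a + b + 1) := by
  have h1 : B ^ a ≤ B ^ (a + b) := Nat.pow_le_pow_right (by omega) (by omega)
  have h2 : B ^ b ≤ B ^ (a + b) := Nat.pow_le_pow_right (by omega) (by omega)
  calc B ^ a + B ^ b ≤ B ^ (a + b) * 2 := by omega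
    _ ≤ _ := by rw [pow_succ]; exact Nat.mul_le_mul_left _ hB

lemma le_pow_base {B : ℕ} (hB : 2 ≤ B) (c : ℕ) : c ≤ B ^ c := (Nat.lt_pow_self hB).le

lemma Runs.seq_pow {p q : Prog} {s : Mem} {B a b : ℕ} {Q Q' : Mem → Prop} (hB : 2 ≤ B)
    (h : Runs p s (B ^ a) Q) (h' : ∀ s', Q s' → Runs q s' (B ^ b) Q') :
    Runs (.seq p q) s (B ^ (a + b + 1)) Q' :=
  (h.seq h').mono (pow_add_pow_le hB a b) fun _ h => h

lemma runs_branch_pow {b : Test} {p q : Prog} {s : Mem} {B a : ℕ} {Q : Mem → Prop} (hB : 2 ≤ B)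
    (hp : b.Holds s → Runs p s (B ^ a) Q) (hq : ¬ b.Holds s → Runs q s (B ^ a) Q) :
    Runs (.branch b p q) s (B ^ (b.cost + a + 1)) Q :=
  (runs_branch hp hq).mono ((Nat.add_le_add_right (le_pow_base hB _) _).trans
    (pow_add_pow_le hB _ _)) fun _ h => h

lemma runs_setNat_pow {s : Mem} {a B : ℕ} {i e : NatExpr} {Q : Mem → Prop} (hB : 2 ≤ B)
    (h : Q (s.setNat a (i.eval s) (e.eval s))) :
    Runs (.setNat a i e) s (B ^ (i.cost + e.cost + 1)) Q :=
  (runs_setNat h).mono (le_pow_base hB _) fun _ h => h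

lemma runs_skip_pow {s : Mem} {B a : ℕ} {Q : Mem → Prop} (hB : 2 ≤ B) (h : Q s) :
    Runs .skip s (B ^ a) Q :=
  (runs_skip h).mono (Nat.one_le_pow _ _ (by omega)) fun _ h => h

/-- `runs_tab` with a running time of the form `B ^ a`. -/
lemma runs_tab_pow {A : ℕ} {off e₁ e₂ e₃ : NatExpr} {init ex : RealExpr} (s : Mem) {B : ℕ}
    (hB : 2 ≤ B) (l b₀ b₁ b₂ b₃ : ℕ) (hb₁ : b₁ < B ^ l) (hb₂ : b₂ < B ^ l) (hb₃ : b₃ < B ^ l)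
    (g₀ : ℕ → ℕ → ℝ) (g : ℕ → ℕ → ℕ → ℝ)
    (hb : ∀ s', TabFrame A b₀ s s' →
      off.eval s' = b₀ ∧ e₁.eval s' = b₁ ∧ e₂.eval s' = b₂ ∧ e₃.eval s' = b₃)
    (hinit : ∀ i j s', i < b₁ → j < b₂ → TabFrame A b₀ s s' → s'.nat 2 0 = i → s'.nat 2 1 = j →
      s'.real A (b₀ + (i * b₂ + j)) = s.real A (b₀ + (i * b₂ + j)) → init.eval s' = g₀ i j)
    (hex : ∀ i j k s', i < b₁ → j < b₂ → k < b₃ → TabFrame A b₀ s s' → s'.nat 2 0 = i →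
      s'.nat 2 1 = j → s'.nat 2 2 = k → ex.eval s' = g i j k) :
    Runs (tab A off e₁ e₂ e₃ init ex) s (B ^ (tabCost off e₁ e₂ e₃ init ex + 3 * l))
      (fun s' => TabFrame A b₀ s s' ∧
        (∀ l, b₁ * b₂ ≤ l → s'.real A (b₀ + l) = s.real A (b₀ + l)) ∧
        ∀ i j, i < b₁ → j < b₂ →
          s'.real A (b₀ + (i * b₂ + j)) = g₀ i j + ∑ k ∈ Finset.range b₃, g i j k) := by
  refine (runs_tab s b₀ b₁ b₂ b₃ g₀ g hb hinit hex).mono ?_ fun _ h => h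
  rw [pow_add, show 3 * l = l + (l + l) by ring, pow_add, pow_add]
  exact Nat.mul_le_mul (le_pow_base hB _) (Nat.mul_le_mul hb₁ (Nat.mul_le_mul hb₂ hb₃))

/-- The parameters of the search are stored in `s`. -/
structure Params (n R d B L b : ℕ) (s : Mem) : Prop where
  hn : s.nat 0 0 = n
  hR : s.nat 0 1 = R
  hB : s.nat 2 10 = B
  hd : s.nat 2 11 = d
  hb : s.nat 2 12 = b
  hL : s.nat 2 14 = L

lemma Params.of_frame {n R d B L b : ℕ} {X Y : Finset ℕ} {s s' : Mem} (h : Params n R d B L b s)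
    (hf : Frame X Y s s') (hX : X ⊆ Finset.range 10) : Params n R d B L b s' := by
  have hv : ∀ i, 10 ≤ i → s'.nat 2 i = s.nat 2 i := fun i hi => hf.var i fun h => by
    have := Finset.mem_range.1 (hX h); omega
  have h0 := hf.nat 0 (by norm_num)
  exact ⟨by rw [h0, h.hn], by rw [h0, h.hR], by rw [hv _ (by norm_num), h.hB],
    by rw [hv _ (by norm_num), h.hd], by rw [hv _ (by norm_num), h.hb],
    by rw [hv _ (by norm_num), h.hL]⟩

lemma Params.of_tabFrame {n R d B L b A b₀ : ℕ} {s s' : Mem} (h : Params n R d B L b s)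
    (hf : TabFrame A b₀ s s') : Params n R d B L b s' :=
  h.of_frame hf.toFrame (by decide)

/-- The number of observation symbols. -/
abbrev eN : NatExpr := .read 0 (.const 0)

/-- The number of hidden states. -/
abbrev eR : NatExpr := .read 0 (.const 1)

/-- The number of blocks. -/
abbrev eD : NatExpr := var 11

/-- The real constant `0`. -/
abbrev eZero : RealExpr := .ofNat (.const 0)

/-- Entry `I + d * (x + n * J)` of the estimated law. -/
abbrev eLaw (I x J : NatExpr) : RealExpr := .read 5 (.add I (.mul eD (.add x (.mul eN J))))

/-- Program for the matrix `slopeMat`; the weights are in row `var 5 + 1` of array `12`, the number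
of the grid point is `var 4`. -/
def slopeProg : Prog :=
  .seq (tab 7 (.const 0) eD eD eN eZero
      (.mul (.sub (.read 12 (.add (.mul (.add (var 5) (.const 1)) eN) (var 2)))
        (.div (.ofNat (var 4)) (.ofNat ((var 10).npow 17)))) (eLaw (var 1) (var 2) (var 0))))
    (tab 7 (.mul eD eD) (.const 1) eD eD eZero (.read 6 (.add (.mul (var 2) eD) (var 1))))

/-- The data of the search are stored in `s`. -/
structure SearchData (n R d B L b : ℕ) (p : ℕ → ℝ) (s : Mem) : Prop extends
    Params n R d B L b s where
  law : s.real 5 = p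
  late : ∀ J I, J < d → I < d → s.real 6 (J * d + I) = lateMarg n d p J I
  rhs : ∀ J, J < d + 1 → s.real 8 J = slopeRhs d J

lemma SearchData.of_frame {n R d B L b : ℕ} {p : ℕ → ℝ} {X Y : Finset ℕ} {s s' : Mem}
    (h : SearchData n R d B L b p s) (hf : Frame X Y s s') (hX : X ⊆ Finset.range 10)
    (h5 : 5 ∉ Y) (h6 : 6 ∉ Y) (h8 : 8 ∉ Y) : SearchData n R d B L b p s' :=
  ⟨h.toParams.of_frame hf hX, by rw [hf.real 5 h5, h.law], by rw [hf.real 6 h6]; exact h.late,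
    by rw [hf.real 8 h8]; exact h.rhs⟩

section search
variable {n R d B L b : ℕ} {p : ℕ → ℝ}

lemma runs_slopeProg : ∃ K : ℕ, ∀ {n R d B L b : ℕ} {p : ℕ → ℝ} (s : Mem) (e j : ℕ) (α : ℕ → ℝ),
    2 ≤ B → d < B → n < B →
    SearchData n R d B L b p s → s.nat 2 5 = e → s.nat 2 4 = j →
    (∀ x < n, s.real 12 ((e + 1) * n + x) = α x) →
    Runs slopeProg s (B ^ K) (fun s' => Frame {0, 1, 2} {7} s s' ∧ ∀ J I, J < d + 1 → I < d →
      s'.real 7 (J * d + I) = slopeMat n d p α (j / (B : ℝ) ^ 17) J I) := by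
  apply Exists.intro
  intro n R d B L b p s e j α hB hdB hnB hs he hj hα
  refine Runs.seq_pow hB (runs_tab_pow s hB 1 0 d d n (by simpa) (by simpa) (by simpa)
    (fun _ _ => 0) (fun J I x => (α x - j / (B : ℝ) ^ 17) * p (I + d * (x + n * J))) ?_ ?_ ?_)
    fun s₁ ⟨h1, h2, h3⟩ => (runs_tab_pow s₁ hB 1 (d * d) 1 d d (by simp; omega) (by simpa) (by simpa)
    (fun _ _ => 0) (fun _ I J => lateMarg n d p J I) ?_ ?_ ?_).mono le_rfl ?_
  · intro s' h
    have h' := hs.toParams.of_tabFrame h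
    exact ⟨rfl, h'.hd, h'.hd, h'.hn⟩
  · intros; simp [RealExpr.eval, NatExpr.eval]
  · intro i j' k s' _ _ hk hf h0 h1 h2
    have h' := hs.toParams.of_tabFrame hf
    simp only [RealExpr.eval, NatExpr.eval, NatExpr.eval_npow, h0, h1, h2, h'.hn, h'.hd, h'.hB,
      hf.var 5 (by norm_num), hf.var 4 (by norm_num), he, hj, hf.real 12 (by norm_num), hα k hk,
      hf.real 5 (by norm_num), hs.law]
    push_cast; rfl
  · intro s' h
    have h' := (hs.toParams.of_tabFrame h1).of_tabFrame h
    exact ⟨by simp [NatExpr.eval, h'.hd], rfl, h'.hd, h'.hd⟩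
  · intros; simp [RealExpr.eval, NatExpr.eval]
  · intro i j' k s' _ hj' hk hf h0 h1' h2'
    have h' := (hs.toParams.of_tabFrame h1).of_tabFrame hf
    simp only [RealExpr.eval, NatExpr.eval, h1', h2', h'.hd, hf.real 6 (by norm_num),
      h1.real 6 (by norm_num), hs.late k j' hk hj']
  · rintro s₂ ⟨h4, -, h5⟩
    refine ⟨h1.toFrame.trans h4.toFrame, fun J I hJ hI => ?_⟩
    by_cases hJd : J < d
    · rw [h4.low _ (by nlinarith), slopeMat, if_pos hJd]
      have := h3 J I hJd hI
      rw [zero_add, zero_add] at this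
      exact this
    · obtain rfl : J = d := by omega
      have := h5 0 I one_pos hI
      rw [zero_mul, zero_add, zero_add] at this
      rw [slopeMat, if_neg hJd, this]

/-- Program that computes the approximate solution and its squared residual for one grid point. -/
def candProg : Prog :=
  .seq slopeProg (.seq (landweberProg 7 8 9 10 (.add eD (.const 1)) eD (.const 1) 7 41)
    (.seq (residProg 7 8 9 10 (.add eD (.const 1)) eD (.const 1))
      (tab 11 (.const 0) (.const 1) (.const 1) (.add eD (.const 1)) eZero
        (.mul (.read 10 (var 2)) (.read 10 (var 2))))))

lemma Params.hasDims {n R d B L b : ℕ} {s : Mem} (h : Params n R d B L b s) (Y : Finset ℕ) :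
    HasDims Y (.add eD (.const 1)) eD (.const 1) (d + 1) d 1 B s := by
  intro s' hf
  have h' := h.of_frame hf (by decide)
  exact ⟨by simp [NatExpr.eval, h'.hd], h'.hd, rfl, h'.hB⟩

lemma runs_candProg : ∃ K : ℕ, ∀ {n R d B L b : ℕ} {p : ℕ → ℝ} (s : Mem) (e j : ℕ) (α : ℕ → ℝ),
    2 ≤ B → d + 1 < B → n < B →
    SearchData n R d B L b p s → s.nat 2 5 = e → s.nat 2 4 = j →
    (∀ x < n, s.real 12 ((e + 1) * n + x) = α x) →
    Runs candProg s (B ^ K) (fun s' => Frame {0, 1, 2, 3} {7, 9, 10, 11} s s' ∧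
      (∀ I < d, s'.real 9 I = candSol n d B p α j I) ∧ s'.real 11 0 = candRes n d B p α j) := by
  obtain ⟨K₁, hK₁⟩ := runs_slopeProg
  obtain ⟨K₂, hK₂⟩ := runs_landweberProg (T := 7) (h := 8) (y := 9) (r := 10)
    (e₁ := .add eD (.const 1)) (e₂ := eD) (e₃ := .const 1) (a := 7) (l := 41)
    (by norm_num) (by norm_num) (by norm_num) (by norm_num) (by norm_num)
  obtain ⟨K₃, hK₃⟩ := runs_residProg (T := 7) (h := 8) (y := 9) (r := 10)
    (e₁ := .add eD (.const 1)) (e₂ := eD) (e₃ := .const 1)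
    (by norm_num) (by norm_num) (by norm_num)
  apply Exists.intro
  intro n R d B L b p s e j α hB hdB hnB hs he hj hα
  apply Runs.seq_pow hB (hK₁ s e j α hB (by omega) hnB hs he hj hα)
  rintro s₁ ⟨f1, v1⟩
  have hs1 := hs.of_frame f1 (by decide) (by decide) (by decide) (by decide)
  have hD : (d + 1 + 1) * (d + 1) * (1 + 1) ≤ B ^ 3 := by
    calc _ ≤ B * B * B := Nat.mul_le_mul (Nat.mul_le_mul (by omega) (by omega)) (by omega)
      _ = _ := by ring
  have hA : ∀ J ∈ Finset.range (d + 1), ∀ I ∈ Finset.range d, s₁.real 7 (J * d + I) =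
      slopeMat n d p α (j / (B : ℝ) ^ 17) J I := fun J hJ I hI =>
    v1 J I (Finset.mem_range.1 hJ) (Finset.mem_range.1 hI)
  have hh : ∀ J ∈ Finset.range (d + 1), s₁.real 8 (J * 1 + 0) = slopeRhs d J := fun J hJ => by
    rw [mul_one, add_zero]; exact hs1.rhs J (Finset.mem_range.1 hJ)
  have hlw := (hK₂ s₁ (d + 1) d 1 B (hs1.hasDims _)).mono (T' := B ^ (K₂ + (3 + 42))) (by
    rw [pow_add, pow_add]
    refine Nat.mul_le_mul (le_pow_base hB _) (Nat.mul_le_mul hD ?_)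
    have : 1 ≤ B ^ 41 := Nat.one_le_pow _ _ (by omega)
    calc B ^ 41 + 1 ≤ B ^ 41 * 2 := by omega
      _ ≤ B ^ 41 * B := Nat.mul_le_mul_left _ hB
      _ = _ := by ring) fun _ h => h
  apply Runs.seq_pow hB hlw
  rintro s₂ ⟨f2, v2⟩
  have hs2 := hs1.of_frame f2 (by decide) (by decide) (by decide) (by decide)
  have y2 : ∀ I ∈ Finset.range d, s₂.real 9 (I * 1 + 0) = candSol n d B p α j I := by
    intro I hI
    rw [v2 I 0 (Finset.mem_range.1 hI) one_pos]
    exact lwIter_congr _ _ hA hh _ _ I hI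
  have hres := (hK₃ {9, 10} s₂ (d + 1) d 1 B (by decide) (hs2.hasDims _)).mono
    (T' := B ^ (K₃ + 3)) (by
      rw [pow_add]
      exact Nat.mul_le_mul (le_pow_base hB _) hD) fun _ h => h
  apply Runs.seq_pow hB hres
  rintro s₃ ⟨f3, v3⟩
  have hs3 := hs2.toParams.of_tabFrame f3
  have r3 : ∀ J ∈ Finset.range (d + 1), s₃.real 10 J = lwResid (Finset.range d)
      (slopeMat n d p α (j / (B : ℝ) ^ 17)) (slopeRhs d) (candSol n d B p α j) J := by
    intro J hJ
    have := v3 J 0 (Finset.mem_range.1 hJ) one_pos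
    rw [mul_one, add_zero] at this
    rw [this]
    simp only [lwResid]
    rw [f2.real 8 (by decide), hh J hJ]
    congr 1
    refine Finset.sum_congr rfl fun I hI => ?_
    rw [y2 I hI, f2.real 7 (by decide), hA J hJ I hI]
  refine (runs_tab_pow s₃ hB 1 0 1 1 (d + 1) (by simp; omega) (by simp; omega) (by simpa)
    (fun _ _ => 0) (fun _ _ J => s₃.real 10 J * s₃.real 10 J) ?_ ?_ ?_).mono le_rfl ?_
  · intro s' h
    have h' := hs3.of_tabFrame h
    exact ⟨rfl, rfl, rfl, by simp [NatExpr.eval, h'.hd]⟩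
  · intros; simp [RealExpr.eval, NatExpr.eval]
  · intro i j' k s' _ _ hk hf h0 h1 h2
    simp only [RealExpr.eval, NatExpr.eval, h2, hf.real 10 (by norm_num)]
  · rintro s₄ ⟨f4, -, v4⟩
    refine ⟨?_, fun I hI => ?_, ?_⟩
    · exact (((f1.mono (by decide) (by decide)).trans (f2.mono (by decide) (by decide))).trans
        (f3.toFrame.mono (by decide) (by decide))).trans (f4.toFrame.mono (by decide) (by decide))
    · rw [f4.real 9 (by norm_num), f3.real 9 (by norm_num)]
      have := y2 I (Finset.mem_range.2 hI)
      rwa [mul_one, add_zero] at this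
    · have := v4 0 0 one_pos one_pos
      rw [zero_mul, zero_add, zero_add, zero_add] at this
      rw [this, candRes, nsq]
      exact Finset.sum_congr rfl fun J hJ => by rw [r3 J hJ, sq]

end search

end RealRAM

lemma Selected.reject {pass : ℕ → Prop} {W R j cnt : ℕ} {js : ℕ → ℕ}
    (h : Selected pass W R j cnt js)
    (hj : pass j → cnt = R ∨ ∃ i < cnt, js i ≤ j ∧ j < js i + W) :
    Selected pass W R (j + 1) cnt js := by
  refine ⟨h.le, fun i hi => (h.lt i hi).trans (Nat.lt_succ_self _), h.ok, h.apart, ?_⟩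
  intro j' hj' hp
  rcases Nat.lt_succ_iff_lt_or_eq.1 hj' with h' | rfl
  · exact h.max j' h' hp
  · exact hj hp

lemma Selected.accept {pass : ℕ → Prop} {W R j cnt : ℕ} {js : ℕ → ℕ}
    (h : Selected pass W R j cnt js) (hp : pass j) (hcnt : cnt < R)
    (hs : ∀ i < cnt, js i + W ≤ j) (hW : 0 < W) :
    Selected pass W R (j + 1) (cnt + 1) (Function.update js cnt j) := by
  have hne : ∀ i < cnt, Function.update js cnt j i = js i := fun i hi =>
    Function.update_of_ne hi.ne _ _
  have heq : Function.update js cnt j cnt = j := Function.update_self _ _ _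
  refine ⟨hcnt, ?_, ?_, ?_, ?_⟩
  · intro i hi
    rcases Nat.lt_succ_iff_lt_or_eq.1 hi with h' | rfl
    · rw [hne i h']; exact (h.lt i h').trans (Nat.lt_succ_self _)
    · rw [heq]; exact Nat.lt_succ_self _
  · intro i hi
    rcases Nat.lt_succ_iff_lt_or_eq.1 hi with h' | rfl
    · rw [hne i h']; exact h.ok i h'
    · rwa [heq]
  · intro i i' hii hi'
    rcases Nat.lt_succ_iff_lt_or_eq.1 hi' with h' | rfl
    · rw [hne i' h', hne i (hii.trans h')]; exact h.apart i i' hii h'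
    · rw [heq, hne i hii]; exact hs i hii
  · intro j' hj' hp'
    rcases Nat.lt_succ_iff_lt_or_eq.1 hj' with h' | rfl
    · rcases h.max j' h' hp' with h1 | ⟨i, hi, h1⟩
      · omega
      · exact Or.inr ⟨i, hi.trans (Nat.lt_succ_self _), by rwa [hne i hi]⟩
    · exact Or.inr ⟨cnt, Nat.lt_succ_self _, by rw [heq]; exact ⟨le_rfl, by omega⟩⟩

namespace RealRAM

lemma runs_branch_skip_pow {b : Test} {p : Prog} {s : Mem} {B a : ℕ} {Q : Mem → Prop} (hB : 2 ≤ B)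
    (hq : ¬ b.Holds s → Q s) (hp : b.Holds s → Runs p s (B ^ a) Q) :
    Runs (.branch b p .skip) s (B ^ (b.cost + a + 1)) Q :=
  runs_branch_pow hB hp fun h => runs_skip_pow hB (hq h)

lemma runs_skip_branch_pow {b : Test} {q : Prog} {s : Mem} {B a : ℕ} {Q : Mem → Prop} (hB : 2 ≤ B)
    (hp : b.Holds s → Q s) (hq : ¬ b.Holds s → Runs q s (B ^ a) Q) :
    Runs (.branch b .skip q) s (B ^ (b.cost + a + 1)) Q :=
  runs_branch_pow hB (fun h => runs_skip_pow hB (hp h)) hq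

/-- Program for one grid point: the approximate solution is stored if its residual is small and
the last stored solution belongs to a distant grid point. -/
def pickProg : Prog :=
  .seq candProg
    (.branch (.realLt (.read 11 (.const 0)) (.div (.ofNat (.const 1)) (.ofNat ((var 10).npow 32))))
      (.branch (.natLt (var 9) (.add (var 4) (.const 1)))
        (.branch (.natLt (var 8) eR)
          (.seq (tab 13 (.mul (var 8) eD) (.const 1) eD (.const 0) (.read 9 (var 1)) eZero)
            (.seq (setVar 9 (.add (var 4) ((var 10).npow 14))) (setVar 8 (.add (var 8) (.const 1)))))
          .skip) .skip) .skip)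

/-- State of the scan of the grid points before the `j`-th one. -/
structure ScanInv (n R d B : ℕ) (p α : ℕ → ℝ) (s : Mem) (j : ℕ) (s' : Mem) : Prop where
  frame : Frame {0, 1, 2, 3, 4, 8, 9} {7, 9, 10, 11, 13} s s'
  sel : ∃ js, Selected (CandOk n d B p α) (B ^ 14) R j (s'.nat 2 8) js ∧
    (∀ i < s'.nat 2 8, js i + B ^ 14 ≤ s'.nat 2 9) ∧
    (s'.nat 2 9 = 0 ∨ ∃ i < s'.nat 2 8, s'.nat 2 9 = js i + B ^ 14) ∧
    ∀ i < s'.nat 2 8, ∀ I < d, s'.real 13 (i * d + I) = candSol n d B p α (js i) I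

lemma runs_pickProg : ∃ K : ℕ, ∀ {n R d B L b : ℕ} {p : ℕ → ℝ} (s : Mem) (e : ℕ) (α : ℕ → ℝ),
    2 ≤ B → d + 1 < B → n < B → SearchData n R d B L b p s → s.nat 2 5 = e →
    (∀ x < n, s.real 12 ((e + 1) * n + x) = α x) →
    ∀ j s', ScanInv n R d B p α s j s' → s'.nat 2 4 = j →
    Runs pickProg s' (B ^ K) (fun s'' => s''.nat 2 4 = j ∧ ScanInv n R d B p α s (j + 1) s'') := by
  obtain ⟨K₁, hK₁⟩ := runs_candProg
  apply Exists.intro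
  intro n R d B L b p s e α hB hdB hnB hs he hα j s' hi hj
  have hs' := hs.of_frame hi.frame (by decide) (by decide) (by decide) (by decide)
  apply Runs.seq_pow hB (hK₁ s' e j α hB hdB hnB hs' ((hi.frame.var 5 (by decide)).trans he) hj
    (by rw [hi.frame.real 12 (by decide)]; exact hα))
  rintro s₁ ⟨f1, v1, r1⟩
  -- The variable `9` holds the first position far enough from the last selected point, or `0` if
  -- there is none. The scan moves upwards, so comparing with the last selected point suffices.
  obtain ⟨js, h1, h2, h3, h4⟩ := hi.sel
  have hs1 := hs'.of_frame f1 (by decide) (by decide) (by decide) (by decide)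
  have F1 : Frame {0, 1, 2, 3, 4, 8, 9} {7, 9, 10, 11, 13} s s₁ :=
    hi.frame.trans (f1.mono (by decide) (by decide))
  have e8 : s₁.nat 2 8 = s'.nat 2 8 := f1.var 8 (by decide)
  have e9 : s₁.nat 2 9 = s'.nat 2 9 := f1.var 9 (by decide)
  have e4 : s₁.nat 2 4 = j := (f1.var 4 (by decide)).trans hj
  have e13 : s₁.real 13 = s'.real 13 := f1.real 13 (by decide)
  have hrej : (CandOk n d B p α j → s'.nat 2 8 = R ∨
      ∃ i < s'.nat 2 8, js i ≤ j ∧ j < js i + B ^ 14) →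
      s₁.nat 2 4 = j ∧ ScanInv n R d B p α s (j + 1) s₁ := by
    intro h
    refine ⟨e4, F1, js, ?_⟩
    rw [e8, e9, e13]
    exact ⟨h1.reject h, h2, h3, h4⟩
  have hpass : (Test.realLt (.read 11 (.const 0)) (.div (.ofNat (.const 1))
      (.ofNat ((var 10).npow 32)))).Holds s₁ ↔ CandOk n d B p α j := by
    simp [Test.Holds, RealExpr.eval, NatExpr.eval, r1, hs1.hB, CandOk]
  apply runs_branch_skip_pow hB
  · intro hp
    rw [hpass] at hp; exact hrej fun h => absurd h hp
  intro hp
  rw [hpass] at hp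
  apply runs_branch_skip_pow hB
  · intro hn
    refine hrej fun _ => ?_
    simp only [Test.Holds, NatExpr.eval, e4, e9] at hn
    rcases h3 with h | ⟨i, hi1, hi2⟩
    · omega
    · exact Or.inr ⟨i, hi1, (h1.lt i hi1).le, by omega⟩
  intro hn
  apply runs_branch_skip_pow hB
  · intro hc
    refine hrej fun _ => Or.inl ?_
    simp only [Test.Holds, NatExpr.eval, e8, hs1.hR] at hc
    exact le_antisymm h1.le (by omega)
  intro hc
  simp only [Test.Holds, NatExpr.eval, e8, hs1.hR, e9, e4] at hc hn
  apply Runs.seq_pow hB (runs_tab_pow s₁ hB 1 (s'.nat 2 8 * d) 1 d 0 (by simp; omega)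
    (by simp; omega) (by simp; omega) (fun _ I => s₁.real 9 I) (fun _ _ _ => 0) ?_ ?_ ?_)
  · rintro s₂ ⟨f2, -, v2⟩
    have e8' : s₂.nat 2 8 = s'.nat 2 8 := by rw [f2.var 8 (by norm_num), e8]
    have e4' : s₂.nat 2 4 = j := by rw [f2.var 4 (by norm_num), e4]
    have e10' : s₂.nat 2 10 = B := by rw [f2.var 10 (by norm_num), hs1.hB]
    apply Runs.seq_pow hB (runs_setNat_pow (Q := fun s₃ => s₃ = s₂.setNat 2 9 (j + B ^ 14)) hB ?_)
    · rintro s₃ rfl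
      refine runs_setNat_pow hB ?_
      have e8'' : ((var 8).add (.const 1)).eval (s₂.setNat 2 9 (j + B ^ 14)) = s'.nat 2 8 + 1 := by
        simp [NatExpr.eval, Mem.setNat_nat, e8']
      rw [e8'']
      show ((s₂.setNat 2 9 (j + B ^ 14)).setNat 2 8 (s'.nat 2 8 + 1)).nat 2 4 = j ∧
        ScanInv n R d B p α s (j + 1) ((s₂.setNat 2 9 (j + B ^ 14)).setNat 2 8 (s'.nat 2 8 + 1))
      refine ⟨by simp [Mem.setNat_nat, e4'], ?_, ?_⟩
      · exact ((F1.trans (f2.toFrame.mono (by decide) (by decide))).setVar (by decide) _).setVar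
          (by decide) _
      · refine ⟨Function.update js (s'.nat 2 8) j, ?_⟩
        have g8 : ((s₂.setNat 2 9 (j + B ^ 14)).setNat 2 8 (s'.nat 2 8 + 1)).nat 2 8
            = s'.nat 2 8 + 1 := by simp [Mem.setNat_nat]
        have g9 : ((s₂.setNat 2 9 (j + B ^ 14)).setNat 2 8 (s'.nat 2 8 + 1)).nat 2 9
            = j + B ^ 14 := by simp [Mem.setNat_nat]
        rw [g8, g9]
        refine ⟨h1.accept hp hc (fun i hi => (h2 i hi).trans (by omega)) (by positivity), ?_, ?_, ?_⟩
        · intro i hi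
          rcases Nat.lt_succ_iff_lt_or_eq.1 hi with h' | rfl
          · rw [Function.update_of_ne h'.ne]; exact Nat.add_le_add_right (h1.lt i h').le _
          · rw [Function.update_self]
        · exact Or.inr ⟨_, Nat.lt_succ_self _, by rw [Function.update_self]⟩
        · intro i hi I hI
          rw [Mem.setNat_real, Mem.setNat_real]
          rcases Nat.lt_succ_iff_lt_or_eq.1 hi with h' | rfl
          · rw [Function.update_of_ne h'.ne, f2.low _ (by
              calc i * d + I < i * d + d := by omega
                _ = (i + 1) * d := by ring
                _ ≤ _ := Nat.mul_le_mul_right _ h'), e13, h4 i h' I hI]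
          · rw [Function.update_self, ← v1 I hI]
            have := v2 0 I one_pos hI
            rw [zero_mul, zero_add] at this
            rw [this]; simp
    · show _ = _
      congr 1
      simp [NatExpr.eval, e4', e10']
  · intro s₂ h
    have h' := hs1.toParams.of_tabFrame h
    exact ⟨by simp [NatExpr.eval, h'.hd, h.var 8, e8], rfl, h'.hd, rfl⟩
  · intro i j' s₂ _ _ hf _ hj' _
    simp [RealExpr.eval, NatExpr.eval, hj', hf.real 9]
  · intros; simp [RealExpr.eval, NatExpr.eval]

/-- Program that appends a row to the table of weight vectors. -/
def weightProg : Prog :=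
  tab 12 (.mul (.add (var 5) (.const 1)) eN) (.const 1) eN (.const 0)
    (.add (.read 12 (.add (.mul (var 6) eN) (var 1)))
      (.ofNat (.mul (.sub (var 7) (.mul (var 1) (var 14)))
        (.sub (.const 1) (.sub (.add (var 7) (.const 1)) (.mul (.add (var 1) (.const 1)) (var 14)))))))
    eZero

/-- Program that tries one vector of weights, unless an earlier one was successful. -/
def roundProg : Prog :=
  .branch (.natLt (var 8) eR)
    (.seq weightProg (.seq (setVar 8 (.const 0)) (.seq (setVar 9 (.const 0))
      (.seq (forLoop 4 (.add ((var 10).npow 18) (.const 1)) pickProg)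
        (.seq (setVar 7 (.add (var 7) (.const 1)))
          (.branch (.natLt (var 7) (.mul eN (var 14))) .skip
            (.seq (setVar 7 (.const 0)) (setVar 6 (.add (var 6) (.const 1)))))))))) .skip

/-- State of the search before the round `e`. -/
structure SearchInv (n R d B L : ℕ) (p : ℕ → ℝ) (s : Mem) (e : ℕ) (s' : Mem) : Prop where
  frame : Frame (Finset.range 10) {7, 9, 10, 11, 12, 13} s s'
  sel : (s'.nat 2 8 = R ∧ ∃ e' < e, ∃ js,
      Selected (CandOk n d B p fun x => weightVec n L (e' + 1) x) (B ^ 14) R (B ^ 18 + 1) R js ∧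
      ∀ i < R, ∀ I < d, s'.real 13 (i * d + I) =
        candSol n d B p (fun x => weightVec n L (e' + 1) x) (js i) I) ∨
    (s'.nat 2 8 < R ∧ s'.nat 2 6 = e / (n * L) ∧ s'.nat 2 7 = e % (n * L) ∧
      (∀ e' ≤ e, ∀ x < n, s'.real 12 (e' * n + x) = weightVec n L e' x) ∧
      ∀ e' < e, ∃ cnt < R, ∃ js,
        Selected (CandOk n d B p fun x => weightVec n L (e' + 1) x) (B ^ 14) R (B ^ 18 + 1) cnt js)

/-- The machine has no integer division, so quotient and remainder of the round number are carried
along and updated. -/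
lemma div_mod_succ {e q : ℕ} (hq : 0 < q) :
    (e % q + 1 < q → (e + 1) / q = e / q ∧ (e + 1) % q = e % q + 1) ∧
    (¬ e % q + 1 < q → (e + 1) / q = e / q + 1 ∧ (e + 1) % q = 0) := by
  have h1 := Nat.div_add_mod e q
  have h2 := Nat.mod_lt e hq
  constructor
  · intro h
    have h3 : e + 1 = (e % q + 1) + q * (e / q) := by omega
    constructor
    · rw [h3, Nat.add_mul_div_left _ _ hq, Nat.div_eq_of_lt h, zero_add]
    · rw [h3, Nat.add_mul_mod_self_left, Nat.mod_eq_of_lt h]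
  · intro h
    have h3 : e + 1 = q * (e / q + 1) := by rw [mul_add]; omega
    constructor
    · rw [h3, Nat.mul_div_cancel_left _ hq]
    · rw [h3, Nat.mul_mod_right]

lemma runs_roundProg : ∃ K : ℕ, ∀ {n R d B L b : ℕ} {p : ℕ → ℝ} (s : Mem),
    2 ≤ B → d + 1 < B → n < B → 0 < n * L → SearchData n R d B L b p s →
    ∀ e s', SearchInv n R d B L p s e s' → s'.nat 2 5 = e →
    Runs roundProg s' (B ^ K) (fun s'' => s''.nat 2 5 = e ∧ SearchInv n R d B L p s (e + 1) s'') := by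
  obtain ⟨K₁, hK₁⟩ := runs_pickProg
  apply Exists.intro
  intro n R d B L b p s hB hdB hnB hnL hs e s' hi he
  have hs' := hs.of_frame hi.frame (by decide) (by decide) (by decide) (by decide)
  apply runs_branch_skip_pow hB
  · intro hc
    simp only [Test.Holds, NatExpr.eval, hs'.hR] at hc
    refine ⟨he, hi.frame, Or.inl ?_⟩
    rcases hi.sel with ⟨h1, e', h2, h3⟩ | ⟨h1, -⟩
    · exact ⟨h1, e', h2.trans (Nat.lt_succ_self _), h3⟩
    · exact absurd h1 hc
  intro hc
  simp only [Test.Holds, NatExpr.eval, hs'.hR] at hc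
  obtain ⟨-, e6, e7, htab, hfail⟩ := hi.sel.resolve_left (by rintro ⟨h, -⟩; omega)
  apply Runs.seq_pow hB (runs_tab_pow s' hB 1 ((e + 1) * n) 1 n 0 (by simp; omega)
    (by simpa) (by simp; omega) (fun _ y => (weightVec n L (e + 1) y : ℝ)) (fun _ _ _ => 0) ?_ ?_ ?_)
  rotate_left 2
  · intro s₁ h
    have h' := hs'.toParams.of_tabFrame h
    exact ⟨by simp [NatExpr.eval, h'.hn, h.var 5, he], rfl, h'.hn, rfl⟩
  · intro i y s₁ _ hy hf _ hy' _
    have h' := hs'.toParams.of_tabFrame hf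
    -- Vector `e + 1` is vector `e / (n * L)` plus a multiple of a unit vector. The former has an
    -- index of at most `e`, so its row lies below the row being written.
    have h6 : s₁.real 12 (e / (n * L) * n + y) = weightVec n L (e / (n * L)) y := by
      rw [hf.low, htab _ (Nat.div_le_self _ _) y hy]
      calc _ < e / (n * L) * n + n := by omega
        _ = (e / (n * L) + 1) * n := by ring
        _ ≤ _ := Nat.mul_le_mul_right _ (Nat.succ_le_succ (Nat.div_le_self _ _))
    simp only [RealExpr.eval, NatExpr.eval, h'.hn, h'.hL, hy', hf.var 6 (by norm_num),
      hf.var 7 (by norm_num), e6, e7, h6]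
    rw [weightVec]
    simp only [unitWeight]
    push_cast; rfl
  · intros; simp [RealExpr.eval, NatExpr.eval]
  rintro s₁ ⟨f1, -, v1⟩
  have hv1 : ∀ x < n, s₁.real 12 ((e + 1) * n + x) = weightVec n L (e + 1) x := by
    intro x hx
    have := v1 0 x one_pos hx
    rw [zero_mul, zero_add] at this
    rw [this]; simp
  have htab1 : ∀ e' ≤ e + 1, ∀ x < n, s₁.real 12 (e' * n + x) = weightVec n L e' x := by
    intro e' he' x hx
    rcases Nat.le_succ_iff.1 he' with h | rfl
    · rw [f1.low, htab e' h x hx]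
      calc _ < e' * n + n := by omega
        _ = (e' + 1) * n := by ring
        _ ≤ _ := Nat.mul_le_mul_right _ (Nat.succ_le_succ h)
    · exact hv1 x hx
  apply Runs.seq_pow hB (runs_setNat_pow (Q := fun s₂ => s₂ = s₁.setNat 2 8 0) hB rfl)
  rintro s₂ rfl
  apply Runs.seq_pow hB (runs_setNat_pow
    (Q := fun s₂ => s₂ = (s₁.setNat 2 8 0).setNat 2 9 0) hB rfl)
  rintro s₂ hs₂
  have f2 : Frame (Finset.range 10) {7, 9, 10, 11, 12, 13} s s₂ := by
    rw [hs₂]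
    exact ((hi.frame.trans (f1.toFrame.mono (by decide) (by decide))).setVar (by decide) _).setVar
      (by decide) _
  have hd2 := hs.of_frame f2 (by decide) (by decide) (by decide) (by decide)
  have n2 : ∀ i, i ≠ 8 → i ≠ 9 → 3 ≤ i → s₂.nat 2 i = s'.nat 2 i := by
    intro i h8 h9 h3
    rw [hs₂, Mem.setNat_nat, if_neg (by simp [h9]), Mem.setNat_nat, if_neg (by simp [h8]),
      f1.var i h3]
  have r2 : s₂.real = s₁.real := by rw [hs₂]; rfl
  have h8 : s₂.nat 2 8 = 0 := by rw [hs₂]; simp [Mem.setNat_nat]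
  have h9 : s₂.nat 2 9 = 0 := by rw [hs₂]; simp [Mem.setNat_nat]
  have h5 : s₂.nat 2 5 = e := by rw [n2 5 (by norm_num) (by norm_num) (by norm_num), he]
  have hloop := (runs_forLoop (v := 4) (e := .add ((var 10).npow 18) (.const 1)) (p := pickProg)
    (ScanInv n R d B p (fun x => weightVec n L (e + 1) x) s₂) (B ^ K₁) (B ^ 18 + 1)
    (fun i s₃ x h => ⟨h.frame.setVar (by decide) x, h.sel⟩) (fun i s₃ h => by
      have := (hd2.of_frame h.frame (by decide) (by decide) (by decide) (by decide)).hB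
      simp [NatExpr.eval, this])
    (fun j s₃ _ h h4 => hK₁ s₂ e _ hB hdB hnB hd2 h5 (by rw [r2]; exact hv1) j s₃ h h4)
    (s := s₂) ⟨Frame.refl _ _ _, fun _ => 0, by
      rw [h8]
      exact ⟨⟨Nat.zero_le _, by simp, by simp, by simp, by simp⟩, by simp, Or.inl h9, by simp⟩⟩).mono
    (T' := B ^ (19 + 1 + (K₁ + ((NatExpr.add ((var 10).npow 18) (.const 1)).cost + 13) + 1))) (by
      rw [pow_add]
      refine Nat.mul_le_mul ?_ ?_
      · have h1 : 1 ≤ B ^ 18 := Nat.one_le_pow _ _ (by omega)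
        have h2 : B ^ 20 = B ^ 18 * B * B := by ring
        show B ^ 18 + 1 + 1 ≤ B ^ 20
        rw [h2]
        have h3 := Nat.mul_le_mul (Nat.mul_le_mul (le_refl (B ^ 18)) hB) hB
        omega
      · rw [add_assoc]
        exact (Nat.add_le_add_left (le_pow_base hB _) _).trans (pow_add_pow_le hB _ _)) fun _ h => h
  apply Runs.seq_pow hB hloop
  rintro s₃ ⟨f3, js, h1, -, -, h4⟩
  have f3' : Frame (Finset.range 10) {7, 9, 10, 11, 12, 13} s s₃ :=
    f2.trans (f3.mono (by decide) (by decide))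
  have hd3 := hs.of_frame f3' (by decide) (by decide) (by decide) (by decide)
  have e7' : s₃.nat 2 7 = e % (n * L) := by
    rw [f3.var 7 (by decide), n2 7 (by norm_num) (by norm_num) (by norm_num), e7]
  have e6' : s₃.nat 2 6 = e / (n * L) := by
    rw [f3.var 6 (by decide), n2 6 (by norm_num) (by norm_num) (by norm_num), e6]
  have e5' : s₃.nat 2 5 = e := by rw [f3.var 5 (by decide), h5]
  have r12 : s₃.real 12 = s₁.real 12 := by rw [f3.real 12 (by decide), r2]
  have hfin : ∀ s₄, Frame {6, 7} ∅ s₃ s₄ → s₄.nat 2 6 = (e + 1) / (n * L) →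
      s₄.nat 2 7 = (e + 1) % (n * L) →
      s₄.nat 2 5 = e ∧ SearchInv n R d B L p s (e + 1) s₄ := by
    intro s₄ f4 g6 g7
    have r4 : ∀ a, s₄.real a = s₃.real a := fun a => f4.real a (by simp)
    have g8 : s₄.nat 2 8 = s₃.nat 2 8 := f4.var 8 (by decide)
    refine ⟨(f4.var 5 (by decide)).trans e5', f3'.trans (f4.mono (by decide) (by decide)), ?_⟩
    rw [g8, r4, r4]
    rcases h1.le.lt_or_eq with h | h
    · refine Or.inr ⟨h, g6, g7, by rw [r12]; exact htab1, fun e' he' => ?_⟩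
      rcases Nat.lt_succ_iff_lt_or_eq.1 he' with h' | rfl
      · exact hfail e' h'
      · exact ⟨_, h, js, h1⟩
    · rw [h] at h1 h4 ⊢
      exact Or.inl ⟨rfl, e, Nat.lt_succ_self _, js, h1, h4⟩
  apply Runs.seq_pow hB (runs_setNat_pow
    (Q := fun s₄ => s₄ = s₃.setNat 2 7 (e % (n * L) + 1)) hB (by
      simp [NatExpr.eval, e7']))
  rintro s₄ rfl
  have hdm := div_mod_succ (e := e) hnL
  have hL3 := hd3.hL
  have hn3 := hd3.hn
  have c7 : (var 7).eval (s₃.setNat 2 7 (e % (n * L) + 1)) = e % (n * L) + 1 := by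
    simp [NatExpr.eval, Mem.setNat_nat]
  have c8 : (NatExpr.mul eN (var 14)).eval (s₃.setNat 2 7 (e % (n * L) + 1)) = n * L := by
    simp [NatExpr.eval, Mem.setNat_nat, hL3, hn3]
  apply runs_skip_branch_pow hB
  · intro h
    simp only [Test.Holds, c7, c8] at h
    obtain ⟨h1, h2⟩ := hdm.1 h
    refine hfin _ ((Frame.refl _ _ _).setVar (by decide) _) ?_ ?_
    · simp [Mem.setNat_nat, e6', h1]
    · simp [Mem.setNat_nat, h2]
  · intro h
    simp only [Test.Holds, c7, c8] at h
    obtain ⟨h1, h2⟩ := hdm.2 h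
    have h7 : Runs (setVar 7 (.const 0)) (s₃.setNat 2 7 (e % (n * L) + 1))
        (B ^ ((NatExpr.const 7).cost + (NatExpr.const 0).cost + 1))
        (fun s₄ => s₄ = (s₃.setNat 2 7 (e % (n * L) + 1)).setNat 2 7 0) := runs_setNat_pow hB rfl
    apply Runs.seq_pow hB h7
    rintro s₄ rfl
    refine runs_setNat_pow hB ?_
    have h6 : ((var 6).add (.const 1)).eval ((s₃.setNat 2 7 (e % (n * L) + 1)).setNat 2 7 0) =
        e / (n * L) + 1 := by
      simp [NatExpr.eval, Mem.setNat_nat, e6']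
    rw [h6]
    refine hfin (((s₃.setNat 2 7 (e % (n * L) + 1)).setNat 2 7 0).setNat 2 6 (e / (n * L) + 1))
      ((((Frame.refl _ _ _).setVar (by decide) _).setVar (by decide) _).setVar
      (by decide) _) ?_ ?_
    · simp [Mem.setNat_nat, h1]
    · simp [Mem.setNat_nat, h2]

/-- Program for the search through the vectors of weights. -/
def searchProg : Prog := forLoop 5 (var 12) roundProg

/-- One round costs a power of `B`; the number `b` of rounds is kept apart, because it is not
polynomial in the parameters. -/
lemma runs_searchProg : ∃ K : ℕ, ∀ {n R d B L b : ℕ} {p : ℕ → ℝ} (s : Mem),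
    2 ≤ B → d + 1 < B → n < B → 0 < n * L → 0 < R → SearchData n R d B L b p s →
    s.nat 2 8 = 0 → s.nat 2 6 = 0 → s.nat 2 7 = 0 → s.real 12 = 0 →
    Runs searchProg s ((b + 1) * B ^ K) (SearchInv n R d B L p s b) := by
  obtain ⟨K, hK⟩ := runs_roundProg
  apply Exists.intro
  intro n R d B L b p s hB hdB hnB hnL hR hs h8 h6 h7 h12
  refine (runs_forLoop (v := 5) (e := var 12) (SearchInv n R d B L p s) (B ^ K) b
    (fun i s₃ x h => ⟨h.frame.setVar (by decide) x, h.sel⟩) (fun i s₃ h =>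
      (hs.of_frame h.frame (by decide) (by decide) (by decide) (by decide)).hb)
    (fun e s₃ _ h h4 => hK s hB hdB hnB hnL hs e s₃ h h4)
    ⟨Frame.refl _ _ _, Or.inr ⟨by omega, by simp [h6], by simp [h7], ?_, by simp⟩⟩).mono
    ?_ fun _ h => h
  · intro e' he' x _
    obtain rfl : e' = 0 := by omega
    rw [h12, weightVec]; simp
  · refine Nat.mul_le_mul_left _ ?_
    rw [add_assoc]
    exact (Nat.add_le_add_left (le_pow_base hB _) _).trans (pow_add_pow_le hB _ _)

end RealRAM

/-! ### Preparation on the machine: scale, parameters, empirical law and marginals -/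

lemma HMM.blockCode_injective {n m : ℕ} :
    Function.Injective (HMM.blockCode : (Fin m → Fin n) → ℕ) := by
  intro x y h
  simp only [HMM.blockCode, ← finFunctionFinEquiv_apply] at h
  exact finFunctionFinEquiv.injective (Fin.ext h)

namespace RealRAM

/-- Code of the first `i` observations of the sample `var 2`, for samples of length `m`. -/
def codeExpr (m : ℕ) : ℕ → NatExpr
  | 0 => .const 0
  | i + 1 => .add (codeExpr m i)
      (.mul (.read 1 (.add (.mul (var 2) (.const m)) (.const i))) (eN.npow i))

lemma eval_codeExpr (m i : ℕ) (s : Mem) : (codeExpr m i).eval s =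
    ∑ j ∈ Finset.range i, s.nat 1 (s.nat 2 2 * m + j) * s.nat 0 0 ^ j := by
  induction i with
  | zero => rfl
  | succ i ih => rw [codeExpr, Finset.sum_range_succ, ← ih]; simp [NatExpr.eval]

/-- Program that computes the empirical law of the blocks of `m` observations. -/
def empProg (m : ℕ) : Prog :=
  tab 5 (.const 0) (.const 1) (eN.npow m) (.read 0 (.const 2)) eZero
    (.div (.ofNat ((var 1).eqInd (codeExpr m m))) (.ofNat (.read 0 (.const 2))))

/-- Program for the least number `B` with `N ≤ B ^ D`. -/
def scaleProg (D : ℕ) : Prog :=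
  .loop (.natLt ((var 10).npow D) (.read 0 (.const 2))) (setVar 10 (.add (var 10) (.const 1)))

/-- Program for the parameters of the search. -/
def paramProg (a : ℕ) : Prog :=
  .seq (setVar 11 (eN.npow a)) (.seq (setVar 14 (.add (.mul eR eR) (.const 1)))
    (.seq (setVar 12 (.const 1)) (forLoop 0 (.mul eR eR)
      (setVar 12 (.mul (var 12) (.add (.mul eN (var 14)) (.const 1)))))))

/-- Program for the marginals of the empirical law. -/
def margProg : Prog :=
  .seq (tab 6 (.const 0) eD eD eN eZero (eLaw (var 1) (var 2) (var 0)))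
    (.seq (tab 15 (.const 0) eD eD eN eZero
        (.read 5 (.add (var 1) (.mul eD (.add (var 0) (.mul eD (var 2)))))))
      (.seq (tab 18 (.const 0) eN eD eD eZero (eLaw (var 1) (var 0) (var 2)))
        (.setReal 8 eD (.ofNat (.const 1)))))

/-- Program that prepares the search. -/
def setupProg (D a m : ℕ) : Prog :=
  .seq (scaleProg D) (.seq (paramProg a) (.seq (empProg m) margProg))

section input
variable {n R N m : ℕ} {η τ γ₁ γ₂ : ℝ} {S : Fin N → Fin m → Fin n}

lemma code_input (hm : 0 < m) {k : ℕ} (hk : k < N) :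
    ∑ j ∈ Finset.range m, (input n R η τ γ₁ γ₂ S).nat 1 (k * m + j) * n ^ j =
      HMM.blockCode (S ⟨k, hk⟩) := by
  rw [HMM.blockCode, Finset.sum_range]
  refine Finset.sum_congr rfl fun j _ => ?_
  have h1 : (k * m + j) / m = k := by
    rw [mul_comm, Nat.mul_add_div hm, Nat.div_eq_of_lt j.2, add_zero]
  have h2 : (k * m + (j : ℕ)) % m = j := by
    rw [mul_comm, Nat.mul_add_mod, Nat.mod_eq_of_lt j.2]
  simp only [input, one_ne_zero, if_false, if_true, h1, h2]
  rw [dif_pos ⟨hk, j.2⟩]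

/-- The memory after the empirical law has been computed. -/
structure SetupData (n R d B L b : ℕ) {N m : ℕ} (S : Fin N → Fin m → Fin n) (p : ℕ → ℝ)
    (s : Mem) : Prop extends SearchData n R d B L b p s where
  emp : ∀ x : Fin m → Fin n, p (HMM.blockCode x) = empFreq S x
  early : ∀ J I, J < d → I < d → s.real 15 (J * d + I) = earlyMarg n d p J I
  obs : ∀ x I, x < n → I < d → s.real 18 (x * d + I) = obsMarg n d p x I

lemma runs_scaleProg (D : ℕ) : ∃ K : ℕ, ∀ {n R N m B : ℕ} {η τ γ₁ γ₂ : ℝ}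
    {S : Fin N → Fin m → Fin n}, 2 ≤ B → N ≤ B ^ D → (∀ j < B, j ^ D < N) →
    Runs (scaleProg D) (input n R η τ γ₁ γ₂ S) (B ^ K) (fun s =>
      Frame {10} ∅ (input n R η τ γ₁ γ₂ S) s ∧ s.nat 2 10 = B) := by
  refine ⟨2 + (6 + (Test.natLt ((var 10).npow D) (.read 0 (.const 2))).cost), ?_⟩
  intro n R N m B η τ γ₁ γ₂ S hB hN hlt
  -- The variable `10` starts at `0` and counts upwards. Every value below `B` fails the test `N ≤ j
  -- ^ D`, so linear search stops at `B` after `B` rounds.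
  refine (runs_loop (fun i s => Frame {10} ∅ (input n R η τ γ₁ γ₂ S) s ∧ s.nat 2 10 = i ∧
    ∀ j < i, j ^ D < N) 6 B ?_ ⟨Frame.refl _ _ _, by simp [input], by simp⟩).mono ?_ ?_
  · rintro i s ⟨h1, h2, h3⟩ hb
    have hN0 : s.nat 0 2 = N := by rw [h1.nat 0 (by norm_num)]; simp [input]
    simp only [Test.Holds, NatExpr.eval_npow, NatExpr.eval, h2, hN0] at hb
    refine ⟨?_, (runs_setNat ?_).mono (by simp [NatExpr.cost]) fun _ h => h⟩
    · by_contra hle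
      have := Nat.pow_le_pow_left (not_lt.1 hle) D
      omega
    · refine ⟨h1.setVar (by simp [NatExpr.eval]) _, by simp [Mem.setNat_nat, NatExpr.eval, h2], fun j hj => ?_⟩
      rcases Nat.lt_succ_iff_lt_or_eq.1 hj with h | rfl
      · exact h3 j h
      · exact hb
  · rw [pow_add]
    refine Nat.mul_le_mul ?_ (le_pow_base hB _)
    rw [sq]; nlinarith
  · rintro s ⟨hb, i, hi, h1, h2, h3⟩
    refine ⟨h1, ?_⟩
    have hN0 : s.nat 0 2 = N := by rw [h1.nat 0 (by norm_num)]; simp [input]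
    simp only [Test.Holds, NatExpr.eval_npow, NatExpr.eval, h2, hN0, not_lt] at hb
    rw [h2]
    refine le_antisymm hi (not_lt.1 fun h => ?_)
    have := hlt i h
    omega

/-- The block length `a` is a constant of the program, but the exponent `R * R` in the number of
weight vectors is part of the input, hence the loop of multiplications. -/
lemma runs_paramProg (a : ℕ) : ∃ K : ℕ, ∀ {n R B : ℕ} (s : Mem), 2 ≤ B → R * R < B →
    s.nat 0 0 = n → s.nat 0 1 = R → s.nat 2 10 = B →
    Runs (paramProg a) s (B ^ K) (fun s' => Frame {0, 11, 12, 14} ∅ s s' ∧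
      Params n R (n ^ a) B (R * R + 1) ((n * (R * R + 1) + 1) ^ (R * R)) s') := by
  apply Exists.intro
  intro n R B s hB hR2 hn hR hBv
  have h0 : ∀ {X : Finset ℕ} {s' : Mem}, Frame X ∅ s s' → s'.nat 0 0 = n ∧ s'.nat 0 1 = R :=
    fun h => by rw [h.nat 0 (by norm_num)]; exact ⟨hn, hR⟩
  apply Runs.seq_pow hB (runs_setNat_pow (Q := fun s' => Frame {0, 11, 12, 14} ∅ s s' ∧
    s'.nat 2 11 = n ^ a) hB ⟨(Frame.refl _ _ _).setVar (by simp [NatExpr.eval]) _, by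
      simp [Mem.setNat_nat, NatExpr.eval, hn]⟩)
  rintro s₁ ⟨f1, h11⟩
  apply Runs.seq_pow hB (runs_setNat_pow (Q := fun s' => Frame {0, 11, 12, 14} ∅ s s' ∧
    s'.nat 2 11 = n ^ a ∧ s'.nat 2 14 = R * R + 1) hB
      ⟨f1.setVar (by simp [NatExpr.eval]) _, by simp [Mem.setNat_nat, NatExpr.eval, h11], by
      simp [Mem.setNat_nat, NatExpr.eval, (h0 f1).2]⟩)
  rintro s₂ ⟨f2, h11', h14⟩
  apply Runs.seq_pow hB (runs_setNat_pow (Q := fun s' => Frame {0, 11, 12, 14} ∅ s s' ∧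
    s'.nat 2 11 = n ^ a ∧ s'.nat 2 14 = R * R + 1 ∧ s'.nat 2 12 = 1) hB
      ⟨f2.setVar (by simp [NatExpr.eval]) _, by simp [Mem.setNat_nat, NatExpr.eval, h11'], by
      simp [Mem.setNat_nat, NatExpr.eval, h14], by simp [Mem.setNat_nat, NatExpr.eval]⟩)
  rintro s₃ ⟨f3, h11'', h14', h12⟩
  refine (runs_forLoop (fun i s' => Frame {0, 11, 12, 14} ∅ s s' ∧ s'.nat 2 11 = n ^ a ∧
    s'.nat 2 14 = R * R + 1 ∧ s'.nat 2 12 = (n * (R * R + 1) + 1) ^ i) 13 (R * R) ?_ ?_ ?_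
    ⟨f3, h11'', h14', by simpa using h12⟩).mono (T' := B ^ (1 + 31)) ?_ ?_
  · rintro i s' x ⟨h1, h2, h3, h4⟩
    exact ⟨h1.setVar (by simp) _, by simpa [Mem.setNat_nat] using h2,
      by simpa [Mem.setNat_nat] using h3, by simpa [Mem.setNat_nat] using h4⟩
  · rintro i s' ⟨h1, -⟩
    simp [NatExpr.eval, (h0 h1).2]
  · rintro i s' _ ⟨h1, h2, h3, h4⟩ hi
    refine (runs_setNat ?_).mono (by simp [NatExpr.cost]) fun _ h => h
    refine ⟨by simpa [Mem.setNat_nat, NatExpr.eval] using hi,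
      h1.setVar (by simp [NatExpr.eval]) _, by simpa [Mem.setNat_nat, NatExpr.eval] using h2,
      by simpa [Mem.setNat_nat, NatExpr.eval] using h3, ?_⟩
    simp [Mem.setNat_nat, NatExpr.eval, h3, h4, (h0 h1).1, pow_succ]
  · rw [pow_add]
    exact Nat.mul_le_mul (by simpa using hR2) ((by simp [NatExpr.cost] :
      13 + (NatExpr.mul eR eR).cost + 13 ≤ 31).trans (le_pow_base hB _))
  · rintro s' ⟨h1, h2, h3, h4⟩
    exact ⟨h1, (h0 h1).1, (h0 h1).2, by rw [h1.var 10 (by decide), hBv], h2, h4, h3⟩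

lemma runs_setupProg (D a m : ℕ) : ∃ K : ℕ, ∀ {n R N B : ℕ} {η τ γ₁ γ₂ : ℝ}
    (S : Fin N → Fin m → Fin n), 0 < m → 2 ≤ B → N < B ^ (D + 1) → N ≤ B ^ D → (∀ j < B, j ^ D < N) →
    R * R < B → n < B → n ^ a < B → n ^ m < B →
    Runs (setupProg D a m) (input n R η τ γ₁ γ₂ S) (B ^ K) (fun s =>
      Frame {0, 1, 2, 10, 11, 12, 14} {5, 6, 8, 15, 18} (input n R η τ γ₁ γ₂ S) s ∧ ∃ p,
      SetupData n R (n ^ a) B (R * R + 1) ((n * (R * R + 1) + 1) ^ (R * R)) S p s) := by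
  obtain ⟨K₁, hK₁⟩ := runs_scaleProg D
  obtain ⟨K₂, hK₂⟩ := runs_paramProg a
  apply Exists.intro
  intro n R N B η τ γ₁ γ₂ S hm hB hN1 hN hlt hR2 hnB hdB hmB
  set s₀ := input n R η τ γ₁ γ₂ S with hs₀
  have i0 : s₀.nat 0 0 = n := by simp [hs₀, input]
  have i1 : s₀.nat 0 1 = R := by simp [hs₀, input]
  have i2 : s₀.nat 0 2 = N := by simp [hs₀, input]
  have hl : B ^ 1 ≤ B ^ (D + 1) := Nat.pow_le_pow_right (by omega) (by omega)
  rw [pow_one] at hl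
  apply Runs.seq_pow hB (hK₁ hB hN hlt)
  rintro s₁ ⟨f1, h10⟩
  have h0 := f1.nat 0 (by norm_num)
  apply Runs.seq_pow hB (hK₂ s₁ hB hR2 (by rw [h0, i0]) (by rw [h0, i1]) h10)
  rintro s₂ ⟨f2, hp⟩
  have f12 : Frame {0, 1, 2, 10, 11, 12, 14} {5, 6, 8, 15, 18} s₀ s₂ :=
    (f1.mono (by decide) (by decide)).trans (f2.mono (by decide) (by decide))
  have hr2 : ∀ a, s₂.real a = s₀.real a := fun a => by
    rw [f2.real a (by simp), f1.real a (by simp)]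
  apply Runs.seq_pow hB (runs_tab_pow s₂ hB (D + 1) 0 1 (n ^ m) N (by omega) (by omega) hN1
    (fun _ _ => 0) (fun _ x k => if h : k < N then
      (if x = HMM.blockCode (S ⟨k, h⟩) then 1 else 0) / (N : ℝ) else 0) ?_ ?_ ?_)
  rotate_left 2
  · intro s' h
    have h' := h.nat 0 (by norm_num)
    refine ⟨rfl, rfl, ?_, ?_⟩
    · simp [NatExpr.eval, h', hp.hn]
    · simp [NatExpr.eval, h', f12.nat 0 (by norm_num), i2]
  · intros; simp [RealExpr.eval, NatExpr.eval]
  · intro i x k s' _ _ hk hf _ hx hk'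
    have h' : s'.nat 0 = s₀.nat 0 := (hf.nat 0 (by norm_num)).trans (f12.nat 0 (by norm_num))
    have h1 : s'.nat 1 = s₀.nat 1 := (hf.nat 1 (by norm_num)).trans (f12.nat 1 (by norm_num))
    have hc : (codeExpr m m).eval s' = HMM.blockCode (S ⟨k, hk⟩) := by
      rw [eval_codeExpr, hk', h', h1, i0, hs₀]
      exact code_input hm hk
    rw [dif_pos hk]
    simp only [RealExpr.eval, NatExpr.eval_eqInd, NatExpr.eval, hc, hx, h', i2]
    push_cast; rfl
  rintro s₃ ⟨f3, -, v3⟩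
  have f13 : Frame {0, 1, 2, 10, 11, 12, 14} {5, 6, 8, 15, 18} s₀ s₃ :=
    f12.trans (f3.toFrame.mono (by decide) (by decide))
  have hp3 := hp.of_tabFrame f3
  set d := n ^ a with hd
  set p := s₃.real 5 with hp5
  have hemp : ∀ x : Fin m → Fin n, p (HMM.blockCode x) = empFreq S x := by
    intro x
    have := v3 0 (HMM.blockCode x) one_pos (HMM.blockCode_lt x)
    rw [zero_mul, zero_add, zero_add, zero_add, Finset.sum_range] at this
    rw [this, empFreq, Finset.sum_div]
    refine Finset.sum_congr rfl fun k _ => ?_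
    rw [dif_pos k.2]
    simp only [HMM.blockCode_injective.eq_iff, Fin.eta, eq_comm (a := x)]
  apply Runs.seq_pow hB (runs_tab_pow s₃ hB 1 0 d d n (by simpa) (by simpa) (by simpa)
    (fun _ _ => 0) (fun J I x => p (I + d * (x + n * J))) ?_ ?_ ?_)
  rotate_left 2
  · intro s' h
    have h' := hp3.of_tabFrame h
    exact ⟨rfl, h'.hd, h'.hd, h'.hn⟩
  · intros; simp [RealExpr.eval, NatExpr.eval]
  · intro i j k s' _ _ _ hf g0 g1 g2
    have h' := hp3.of_tabFrame hf
    simp only [RealExpr.eval, NatExpr.eval, g0, g1, g2, h'.hn, h'.hd, hf.real 5 (by norm_num)]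
    rfl
  rintro s₄ ⟨f4, -, v4⟩
  have hp4 := hp3.of_tabFrame f4
  have e4 : s₄.real 5 = p := f4.real 5 (by norm_num)
  apply Runs.seq_pow hB (runs_tab_pow s₄ hB 1 0 d d n (by simpa) (by simpa) (by simpa)
    (fun _ _ => 0) (fun J I y => p (I + d * (J + d * y))) ?_ ?_ ?_)
  rotate_left 2
  · intro s' h
    have h' := hp4.of_tabFrame h
    exact ⟨rfl, h'.hd, h'.hd, h'.hn⟩
  · intros; simp [RealExpr.eval, NatExpr.eval]
  · intro i j k s' _ _ _ hf g0 g1 g2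
    have h' := hp4.of_tabFrame hf
    simp only [RealExpr.eval, NatExpr.eval, g0, g1, g2, h'.hd, hf.real 5 (by norm_num), e4]
  rintro s₅ ⟨f5, -, v5⟩
  have hp5' := hp4.of_tabFrame f5
  have e5 : s₅.real 5 = p := (f5.real 5 (by norm_num)).trans e4
  apply Runs.seq_pow hB (runs_tab_pow s₅ hB 1 0 n d d (by simpa) (by simpa) (by simpa)
    (fun _ _ => 0) (fun x I J => p (I + d * (x + n * J))) ?_ ?_ ?_)
  rotate_left 2
  · intro s' h
    have h' := hp5'.of_tabFrame h
    exact ⟨rfl, h'.hn, h'.hd, h'.hd⟩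
  · intros; simp [RealExpr.eval, NatExpr.eval]
  · intro i j k s' _ _ _ hf g0 g1 g2
    have h' := hp5'.of_tabFrame hf
    simp only [RealExpr.eval, NatExpr.eval, g0, g1, g2, h'.hn, h'.hd, hf.real 5 (by norm_num), e5]
  rintro s₆ ⟨f6, -, v6⟩
  have hp6 := hp5'.of_tabFrame f6
  have f16 : Frame {0, 1, 2, 10, 11, 12, 14} {5, 6, 8, 15, 18} s₀ s₆ :=
    ((f13.trans (f4.toFrame.mono (by decide) (by decide))).trans
      (f5.toFrame.mono (by decide) (by decide))).trans (f6.toFrame.mono (by decide) (by decide))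
  -- Array `8` has not been written yet, so the right hand side only needs its entry `d`, which
  -- carries the normalization.
  have h8 : s₆.real 8 = 0 := by
    rw [f6.real 8 (by norm_num), f5.real 8 (by norm_num), f4.real 8 (by norm_num),
      f3.real 8 (by norm_num), hr2 8, hs₀]
    funext i; simp [input]
  refine (runs_setReal ?_).mono (le_pow_base hB _) fun _ h => h
  have hi : eD.eval s₆ = d := hp6.hd
  have hv : (RealExpr.ofNat (.const 1)).eval s₆ = 1 := by simp [RealExpr.eval, NatExpr.eval]
  rw [hi, hv]
  have hne : ∀ a, a ≠ 8 → (s₆.setReal 8 d 1).real a = s₆.real a := fun a ha => by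
    funext j; simp [Mem.setReal_real, ha]
  refine ⟨f16.trans ⟨fun _ _ => rfl, fun _ _ => rfl, fun a ha => hne a ?_⟩, p, ?_⟩
  · rintro rfl; simp at ha
  · refine ⟨⟨⟨hp6.hn, hp6.hR, hp6.hB, hp6.hd, hp6.hb, hp6.hL⟩, ?_, ?_, ?_⟩, hemp, ?_, ?_⟩
    · rw [hne 5 (by norm_num), f6.real 5 (by norm_num), e5]
    · intro J I hJ hI
      have := v4 J I hJ hI
      rw [zero_add, zero_add] at this
      rw [hne 6 (by norm_num), f6.real 6 (by norm_num), f5.real 6 (by norm_num), this, lateMarg]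
    · intro J _
      simp [Mem.setReal_real, h8, slopeRhs]
    · intro J I hJ hI
      have := v5 J I hJ hI
      rw [zero_add, zero_add] at this
      rw [hne 15 (by norm_num), f6.real 15 (by norm_num), this, earlyMarg]
    · intro J I hJ hI
      have := v6 J I hJ hI
      rw [zero_add, zero_add] at this
      rw [hne 18 (by norm_num), this, obsMarg]

end input

end RealRAM

/-! ### The output stage and the complete program -/

/-- Outcome of the search: either one vector of weights separates `R` solutions `Φ i`, or all
vectors fail. -/
def SearchResult (n R d B L b : ℕ) (p : ℕ → ℝ) (Φ : ℕ → ℕ → ℝ) : Prop :=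
  (∃ e < b, ∃ js,
    Selected (CandOk n d B p fun x => weightVec n L (e + 1) x) (B ^ 14) R (B ^ 18 + 1) R js ∧
    ∀ i < R, ∀ I < d, Φ i I = candSol n d B p (fun x => weightVec n L (e + 1) x) (js i) I) ∨
  ∀ e < b, ∃ cnt < R, ∃ js,
    Selected (CandOk n d B p fun x => weightVec n L (e + 1) x) (B ^ 14) R (B ^ 18 + 1) cnt js

/-- Estimated observation probabilities. -/
def estObs (n d : ℕ) (p : ℕ → ℝ) (Φ : ℕ → ℕ → ℝ) (x i : ℕ) : ℝ :=
  ∑ I ∈ Finset.range d, obsMarg n d p x I * Φ i I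

/-- Estimated law of a block, given the state at its beginning. -/
def estEarly (n d : ℕ) (p : ℕ → ℝ) (Φ : ℕ → ℕ → ℝ) (J i : ℕ) : ℝ :=
  ∑ I ∈ Finset.range d, earlyMarg n d p J I * Φ i I

/-- Estimated law of a block, given the state one step before its beginning. -/
def estLate (n d : ℕ) (p : ℕ → ℝ) (Φ : ℕ → ℕ → ℝ) (J i : ℕ) : ℝ :=
  ∑ I ∈ Finset.range d, lateMarg n d p J I * Φ i I

/-- Estimated coefficients of the law `h` of a block. -/
noncomputable def estCoef (n R d B : ℕ) (p : ℕ → ℝ) (Φ : ℕ → ℕ → ℝ) (h : ℕ → ℝ) : ℕ → ℝ :=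
  lwIter (Finset.range d) (Finset.range R) (estEarly n d p Φ) h (1 / (B : ℝ) ^ 3) (B ^ 10)

namespace RealRAM

lemma Runs.seq_mul {p q : Prog} {s : Mem} {B a c b : ℕ} {Q Q' : Mem → Prop} (hB : 2 ≤ B)
    (h : Runs p s ((b + 1) * B ^ a) Q) (h' : ∀ s', Q s' → Runs q s' ((b + 1) * B ^ c) Q') :
    Runs (.seq p q) s ((b + 1) * B ^ (a + c + 1)) Q' :=
  (h.seq h').mono (by rw [← mul_add]; exact Nat.mul_le_mul_left _ (pow_add_pow_le hB a c))
    fun _ h => h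

lemma Runs.to_mul {p : Prog} {s : Mem} {B a b : ℕ} {Q : Mem → Prop}
    (h : Runs p s (B ^ a) Q) : Runs p s ((b + 1) * B ^ a) Q :=
  h.mono (Nat.le_mul_of_pos_left _ (Nat.succ_pos _)) fun _ h => h

/-- Program that solves the final linear systems. -/
def coefProg (h y : ℕ) (e : NatExpr) : Prog := landweberProg 14 h y 10 eD eR e 3 10

/-- Program for the output. -/
def outProg : Prog :=
  .seq (tab 14 (.const 0) eD eR eD eZero (.mul (.read 15 (.add (.mul (var 0) eD) (var 2)))
      (.read 13 (.add (.mul (var 1) eD) (var 2)))))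
    (.seq (tab 16 (.const 0) eD eR eD eZero (.mul (.read 6 (.add (.mul (var 0) eD) (var 2)))
        (.read 13 (.add (.mul (var 1) eD) (var 2)))))
      (.seq (tab 17 (.const 0) eD (.const 1) eD eZero (.read 15 (.add (.mul (var 0) eD) (var 2))))
        (.seq (tab 2 (.const 0) eN eR eD eZero (.mul (.read 18 (.add (.mul (var 0) eD) (var 2)))
            (.read 13 (.add (.mul (var 1) eD) (var 2)))))
          (.seq (coefProg 16 1 eR) (coefProg 17 3 (.const 1))))))

/-- The estimates are stored in `s`. -/
structure Output (n R d B : ℕ) (p : ℕ → ℝ) (Φ : ℕ → ℕ → ℝ) (s : Mem) : Prop where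
  obs : ∀ x < n, ∀ i < R, s.real 2 (x * R + i) = estObs n d p Φ x i
  trans : ∀ r < R, ∀ i < R, s.real 1 (r * R + i) =
    estCoef n R d B p Φ (fun J => estLate n d p Φ J i) r
  stat : ∀ r < R, s.real 3 r =
    estCoef n R d B p Φ (fun J => ∑ I ∈ Finset.range d, earlyMarg n d p J I) r

lemma runs_coefProg {h y : ℕ} {e : NatExpr} (h1 : h ≠ 10) (h2 : y ≠ 10) (h3 : (14 : ℕ) ≠ y)
    (h4 : h ≠ y) : ∃ K : ℕ, ∀ {n R d B L b E : ℕ} (s : Mem), 2 ≤ B → d < B → R < B → E < B →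
    Params n R d B L b s → (∀ s', Frame {0, 1, 2, 3} {y, 10} s s' → e.eval s' = E) →
    Runs (coefProg h y e) s (B ^ K) (fun s' => Frame {0, 1, 2, 3} {y, 10} s s' ∧ ∀ I c, I < R →
      c < E → s'.real y (I * E + c) = lwIter (Finset.range d) (Finset.range R)
        (fun J I => s.real 14 (J * R + I)) (fun J => s.real h (J * E + c))
        (1 / (B : ℝ) ^ 3) (B ^ 10) I) := by
  obtain ⟨K, hK⟩ := runs_landweberProg (T := 14) (h := h) (y := y) (r := 10)
    (e₁ := eD) (e₂ := eR) (e₃ := e) (a := 3) (l := 10) (by norm_num) h1 h2 h3 h4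
  refine ⟨K + (3 + 11), fun {n R d B L b E} s hB hdB hRB hEB hs he => ?_⟩
  refine (hK s d R E B fun s' hf => ?_).mono ?_ fun _ h => h
  · have h' := hs.of_frame hf (by decide)
    exact ⟨h'.hd, h'.hR, he s' hf, h'.hB⟩
  · rw [pow_add, pow_add]
    refine Nat.mul_le_mul (le_pow_base hB _) (Nat.mul_le_mul ?_ ?_)
    · calc _ ≤ B * B * B := Nat.mul_le_mul (Nat.mul_le_mul hdB hRB) hEB
        _ = _ := by ring
    · have : 1 ≤ B ^ 10 := Nat.one_le_pow _ _ (by omega)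
      calc B ^ 10 + 1 ≤ B ^ 10 * 2 := by omega
        _ ≤ B ^ 10 * B := Nat.mul_le_mul_left _ hB
        _ = _ := by ring

lemma runs_outProg : ∃ K : ℕ, ∀ {n R d B L b : ℕ} {p : ℕ → ℝ} {Φ : ℕ → ℕ → ℝ} (s : Mem),
    2 ≤ B → d < B → n < B → R < B → Params n R d B L b s →
    (∀ J I, J < d → I < d → s.real 6 (J * d + I) = lateMarg n d p J I) →
    (∀ J I, J < d → I < d → s.real 15 (J * d + I) = earlyMarg n d p J I) →
    (∀ x I, x < n → I < d → s.real 18 (x * d + I) = obsMarg n d p x I) →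
    (∀ i < R, ∀ I < d, s.real 13 (i * d + I) = Φ i I) →
    Runs outProg s (B ^ K) (Output n R d B p Φ) := by
  obtain ⟨K₁, hK₁⟩ := runs_coefProg (h := 16) (y := 1) (e := eR) (by norm_num) (by norm_num)
    (by norm_num) (by norm_num)
  obtain ⟨K₂, hK₂⟩ := runs_coefProg (h := 17) (y := 3) (e := .const 1) (by norm_num) (by norm_num)
    (by norm_num) (by norm_num)
  apply Exists.intro
  intro n R d B L b p Φ s hB hdB hnB hRB hs h6 h15 h18 h13
  apply Runs.seq_pow hB (runs_tab_pow s hB 1 0 d R d (by simpa) (by simpa) (by simpa)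
    (fun _ _ => 0) (fun J i I => earlyMarg n d p J I * Φ i I) ?_ ?_ ?_)
  rotate_left 2
  · intro s' h
    have h' := hs.of_tabFrame h
    exact ⟨rfl, h'.hd, h'.hR, h'.hd⟩
  · intros; simp [RealExpr.eval, NatExpr.eval]
  · intro i j k s' hi hj hk hf g0 g1 g2
    have h' := hs.of_tabFrame hf
    simp only [RealExpr.eval, NatExpr.eval, g0, g1, g2, h'.hd, hf.real 15 (by norm_num),
      hf.real 13 (by norm_num), h15 i k hi hk, h13 j hj k hk]
  rintro s₁ ⟨f1, -, v1⟩
  have hs1 := hs.of_tabFrame f1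
  apply Runs.seq_pow hB (runs_tab_pow s₁ hB 1 0 d R d (by simpa) (by simpa) (by simpa)
    (fun _ _ => 0) (fun J i I => lateMarg n d p J I * Φ i I) ?_ ?_ ?_)
  rotate_left 2
  · intro s' h
    have h' := hs1.of_tabFrame h
    exact ⟨rfl, h'.hd, h'.hR, h'.hd⟩
  · intros; simp [RealExpr.eval, NatExpr.eval]
  · intro i j k s' hi hj hk hf g0 g1 g2
    have h' := hs1.of_tabFrame hf
    simp only [RealExpr.eval, NatExpr.eval, g0, g1, g2, h'.hd, hf.real 6 (by norm_num),
      hf.real 13 (by norm_num), f1.real 6 (by norm_num), f1.real 13 (by norm_num), h6 i k hi hk,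
      h13 j hj k hk]
  rintro s₂ ⟨f2, -, v2⟩
  have hs2 := hs1.of_tabFrame f2
  apply Runs.seq_pow hB (runs_tab_pow s₂ hB 1 0 d 1 d (by simpa) (by simp; omega) (by simpa)
    (fun _ _ => 0) (fun J _ I => earlyMarg n d p J I) ?_ ?_ ?_)
  rotate_left 2
  · intro s' h
    have h' := hs2.of_tabFrame h
    exact ⟨rfl, h'.hd, rfl, h'.hd⟩
  · intros; simp [RealExpr.eval, NatExpr.eval]
  · intro i j k s' hi hj hk hf g0 g1 g2
    have h' := hs2.of_tabFrame hf
    simp only [RealExpr.eval, NatExpr.eval, g0, g2, h'.hd, hf.real 15 (by norm_num),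
      f2.real 15 (by norm_num), f1.real 15 (by norm_num), h15 i k hi hk]
  rintro s₃ ⟨f3, -, v3⟩
  have hs3 := hs2.of_tabFrame f3
  apply Runs.seq_pow hB (runs_tab_pow s₃ hB 1 0 n R d (by simpa) (by simpa) (by simpa)
    (fun _ _ => 0) (fun x i I => obsMarg n d p x I * Φ i I) ?_ ?_ ?_)
  rotate_left 2
  · intro s' h
    have h' := hs3.of_tabFrame h
    exact ⟨rfl, h'.hn, h'.hR, h'.hd⟩
  · intros; simp [RealExpr.eval, NatExpr.eval]
  · intro i j k s' hi hj hk hf g0 g1 g2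
    have h' := hs3.of_tabFrame hf
    simp only [RealExpr.eval, NatExpr.eval, g0, g1, g2, h'.hd, hf.real 18 (by norm_num),
      hf.real 13 (by norm_num), f3.real 18 (by norm_num), f3.real 13 (by norm_num),
      f2.real 18 (by norm_num), f2.real 13 (by norm_num), f1.real 18 (by norm_num),
      f1.real 13 (by norm_num), h18 i k hi hk, h13 j hj k hk]
  rintro s₄ ⟨f4, -, v4⟩
  have hs4 := hs3.of_tabFrame f4
  apply Runs.seq_pow hB (hK₁ (E := R) s₄ hB hdB hRB hRB hs4
    fun s' hf => (hs4.of_frame hf (by decide)).hR)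
  rintro s₅ ⟨f5, v5⟩
  have hs5 := hs4.of_frame f5 (by decide)
  refine (hK₂ (E := 1) s₅ hB hdB hRB (by omega) hs5 fun s' hf => rfl).mono le_rfl ?_
  rintro s₆ ⟨f6, v6⟩
  have e14 : ∀ J ∈ Finset.range d, ∀ i ∈ Finset.range R,
      s₄.real 14 (J * R + i) = estEarly n d p Φ J i := by
    intro J hJ i hi
    have := v1 J i (Finset.mem_range.1 hJ) (Finset.mem_range.1 hi)
    rw [zero_add, zero_add] at this
    rw [f4.real 14 (by norm_num), f3.real 14 (by norm_num), f2.real 14 (by norm_num), this, estEarly]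
  refine ⟨fun x hx i hi => ?_, fun r hr i hi => ?_, fun r hr => ?_⟩
  · have := v4 x i hx hi
    rw [zero_add, zero_add] at this
    rw [f6.real 2 (by decide), f5.real 2 (by decide), this, estObs]
  · rw [f6.real 1 (by decide), v5 r i hr hi, estCoef]
    refine lwIter_congr _ _ e14 (fun J hJ => ?_) _ _ r (Finset.mem_range.2 hr)
    have := v2 J i (Finset.mem_range.1 hJ) hi
    rw [zero_add, zero_add] at this
    rw [f4.real 16 (by norm_num), f3.real 16 (by norm_num), this, estLate]
  · have h := v6 r 0 hr one_pos
    rw [mul_one, add_zero] at h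
    rw [h, estCoef, f5.real 14 (by decide)]
    refine lwIter_congr _ _ e14 (fun J hJ => ?_) _ _ r (Finset.mem_range.2 hr)
    have := v3 J 0 (Finset.mem_range.1 hJ) one_pos
    rw [zero_add, zero_add] at this
    rw [f5.real 17 (by decide), f4.real 17 (by norm_num), this]

/-- The learning algorithm, for blocks of length `a` and samples of length `m`. -/
def learnProg (D a m : ℕ) : Prog :=
  .branch (.natLt eN (.const 2)) .skip
    (.branch (.realLt (.ofNat eR) (.mul (.read 0 (.const 0)) (.read 0 (.const 0)))) .skip
      (.seq (setupProg D a m) (.seq searchProg outProg)))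

/-- Degenerate inputs are left alone. For `n = 1` the required probability is `0`; for `R < η ^ 2`
the zero matrices already in memory are accurate enough. Excluding the latter is what allows the
time bound to absorb powers of `R`. -/
lemma learnProg_trivial (D a : ℕ) {n R N m : ℕ} {η τ γ₁ γ₂ : ℝ} (S : Fin N → Fin m → Fin n)
    (h : n < 2 ∨ (R : ℝ) < η * η) :
    Runs (learnProg D a m) (input n R η τ γ₁ γ₂ S) 16
      (fun s => s = input n R η τ γ₁ γ₂ S) := by
  have e0 : (input n R η τ γ₁ γ₂ S).nat 0 0 = n := by simp [input]
  have e1 : (input n R η τ γ₁ γ₂ S).nat 0 1 = R := by simp [input]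
  have e2 : (input n R η τ γ₁ γ₂ S).real 0 0 = η := by simp [input]
  refine (runs_branch (Q := fun s => s = input n R η τ γ₁ γ₂ S) (T := 10)
    (fun _ => (runs_skip (Q := fun s => s = input n R η τ γ₁ γ₂ S) rfl).mono
      (by norm_num) fun _ h => h)
    fun h1 => ?_).mono (by simp [Test.cost, NatExpr.cost]) fun _ h => h
  refine (runs_branch (Q := fun s => s = input n R η τ γ₁ γ₂ S) (T := 1)
    (fun _ => runs_skip rfl) fun h2 => ?_).mono
    (by simp [Test.cost, NatExpr.cost, RealExpr.cost]) fun _ h => h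
  simp only [Test.Holds, NatExpr.eval, RealExpr.eval, e0, e1, e2] at h1 h2
  tauto

/-- The interface between machine and analysis. It holds for every sample sequence; all later
arguments about correctness use only `SearchResult`, `Output` and the identification of `p` with the
empirical law. -/
lemma runs_learnProg (D a m : ℕ) : ∃ K : ℕ, ∀ {n R N B : ℕ} {η τ γ₁ γ₂ : ℝ}
    (S : Fin N → Fin m → Fin n), 2 ≤ n → η * η ≤ R → 0 < R → 0 < m → 2 ≤ B →
    N ≤ B ^ D → (∀ j < B, j ^ D < N) → R * R < B → n < B → n ^ a + 1 < B → n ^ m < B →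
    Runs (learnProg D a m) (input n R η τ γ₁ γ₂ S)
      (((n * (R * R + 1) + 1) ^ (R * R) + 1) * B ^ K) (fun s => ∃ p Φ,
        (∀ x : Fin m → Fin n, p (HMM.blockCode x) = empFreq S x) ∧
        SearchResult n R (n ^ a) B (R * R + 1) ((n * (R * R + 1) + 1) ^ (R * R)) p Φ ∧
        Output n R (n ^ a) B p Φ s) := by
  obtain ⟨K₁, hK₁⟩ := runs_setupProg D a m
  obtain ⟨K₂, hK₂⟩ := runs_searchProg
  obtain ⟨K₃, hK₃⟩ := runs_outProg
  refine ⟨16 + (K₁ + (K₂ + K₃ + 1) + 1) + 1, ?_⟩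
  intro n R N B η τ γ₁ γ₂ S hn hη hR hm hB hN hlt hR2 hnB hdB hmB
  have e0 : (input n R η τ γ₁ γ₂ S).nat 0 0 = n := by simp [input]
  have e1 : (input n R η τ γ₁ γ₂ S).nat 0 1 = R := by simp [input]
  have e2 : (input n R η τ γ₁ γ₂ S).real 0 0 = η := by simp [input]
  set b := (n * (R * R + 1) + 1) ^ (R * R) with hb
  have hRB : R < B := lt_of_le_of_lt (Nat.le_mul_of_pos_left _ hR) hR2
  have hmain : Runs (.seq (setupProg D a m) (.seq searchProg outProg)) (input n R η τ γ₁ γ₂ S)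
      ((b + 1) * B ^ (K₁ + (K₂ + K₃ + 1) + 1)) (fun s => ∃ p Φ,
        (∀ x : Fin m → Fin n, p (HMM.blockCode x) = empFreq S x) ∧
        SearchResult n R (n ^ a) B (R * R + 1) b p Φ ∧ Output n R (n ^ a) B p Φ s) := by
    have hN1 : N < B ^ (D + 1) := lt_of_le_of_lt hN (Nat.pow_lt_pow_right (by omega) (by omega))
    apply Runs.seq_mul hB (hK₁ S hm hB hN1 hN hlt hR2 hnB (by omega) hmB).to_mul
    rintro s₁ ⟨f1, p, hs1⟩
    have z8 : s₁.nat 2 8 = 0 := by rw [f1.var 8 (by decide)]; simp [input]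
    have z6 : s₁.nat 2 6 = 0 := by rw [f1.var 6 (by decide)]; simp [input]
    have z7 : s₁.nat 2 7 = 0 := by rw [f1.var 7 (by decide)]; simp [input]
    have z12 : s₁.real 12 = 0 := by rw [f1.real 12 (by decide)]; funext i; simp [input]
    apply Runs.seq_mul hB (hK₂ s₁ hB hdB hnB (by positivity) hR hs1.toSearchData z8 z6 z7 z12)
    intro s₂ h2
    have hp2 := hs1.toParams.of_frame h2.frame (by decide)
    refine ((hK₃ (p := p) (Φ := fun i I => s₂.real 13 (i * n ^ a + I)) s₂ hB (by omega) hnB hRB hp2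
      ?_ ?_ ?_ fun _ _ _ _ => rfl).to_mul).mono le_rfl fun s₃ h3 => ⟨p, _, hs1.emp, ?_, h3⟩
    · rw [h2.frame.real 6 (by decide)]; exact hs1.late
    · rw [h2.frame.real 15 (by decide)]; exact hs1.early
    · rw [h2.frame.real 18 (by decide)]; exact hs1.obs
    · rcases h2.sel with ⟨-, h⟩ | ⟨-, -, -, -, h⟩
      · exact Or.inl h
      · exact Or.inr h
  have h16 : 15 + (b + 1) * B ^ (K₁ + (K₂ + K₃ + 1) + 1) ≤
      (b + 1) * B ^ (16 + (K₁ + (K₂ + K₃ + 1) + 1) + 1) := by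
    have h1 : 15 ≤ (b + 1) * B ^ 16 :=
      (le_pow_base hB 16 |>.trans' (by norm_num)).trans (Nat.le_mul_of_pos_left _ (Nat.succ_pos _))
    refine (Nat.add_le_add_right h1 _).trans ?_
    rw [← mul_add]
    exact Nat.mul_le_mul_left _ (pow_add_pow_le hB _ _)
  refine ((runs_branch (fun h1 => absurd h1 ?_) fun _ => runs_branch (fun h2 => absurd h2 ?_)
    fun _ => hmain)).mono ?_ fun _ h => h
  · simp only [Test.Holds, NatExpr.eval, e0]; omega
  · simp only [Test.Holds, NatExpr.eval, RealExpr.eval, e1, e2]; exact not_lt.2 hη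
  · refine le_trans ?_ h16
    simp only [Test.cost, NatExpr.cost, RealExpr.cost]
    omega

end RealRAM

/-! ### Weights that separate the hidden states -/

/-- Truncated subtraction acts as a case distinction: the first factor vanishes for `y > x`, the
second for `y < x`. -/
lemma unitWeight_mul_add {L c : ℕ} (hc : c < L) (x y : ℕ) :
    unitWeight L (x * L + c) y = if y = x then c else 0 := by
  unfold unitWeight
  rcases lt_trichotomy y x with h | rfl | h
  · rw [if_neg h.ne]
    have : (y + 1) * L ≤ x * L := Nat.mul_le_mul_right _ h
    have h1 : 1 - (x * L + c + 1 - (y + 1) * L) = 0 := by omega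
    rw [h1, mul_zero]
  · rw [if_pos rfl, add_mul]
    have h1 : 1 - (y * L + c + 1 - (y * L + 1 * L)) = 1 := by omega
    rw [h1]; omega
  · rw [if_neg h.ne']
    have h2 : (x + 1) * L ≤ y * L := Nat.mul_le_mul_right _ h
    have h1 : x * L + c - y * L = 0 := by rw [add_mul] at h2; omega
    rw [h1, zero_mul]

lemma unitWeight_le (L g y : ℕ) : unitWeight L g y ≤ L := by
  unfold unitWeight
  by_cases h : g + 1 ≤ (y + 1) * L
  · have h1 : 1 - (g + 1 - (y + 1) * L) = 1 := by omega
    rw [h1]; rw [add_mul] at h; omega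
  · have h1 : 1 - (g + 1 - (y + 1) * L) = 0 := by omega
    rw [h1]; omega

/-- Each summand divides the index by `n * L ≥ 2`, so an index below `2 ^ k` has at most `k`
summands, each of them at most `L`. -/
lemma weightVec_le {n L : ℕ} (hq : 2 ≤ n * L) (k : ℕ) :
    ∀ e < 2 ^ k, ∀ y, weightVec n L e y ≤ k * L := by
  induction k with
  | zero => intro e he y; obtain rfl : e = 0 := by simpa using he
            simp [weightVec]
  | succ k ih =>
    intro e he y
    cases e with
    | zero => simp [weightVec]
    | succ e =>
      rw [weightVec, add_mul, one_mul]
      refine Nat.add_le_add (ih _ ?_ y) (unitWeight_le _ _ _)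
      rw [pow_succ] at he
      refine lt_of_le_of_lt (Nat.div_le_div_left hq (by norm_num)) ?_
      omega

/-- The enumeration may repeat vectors and include longer sums, so weights are bounded through the
size of the index. A crude bound on its logarithm is enough, as it need only be polynomial. -/
lemma weightVec_le_of_lt {n L k e : ℕ} (hq : 2 ≤ n * L) (he : e ≤ (n * L + 1) ^ k) (y : ℕ) :
    weightVec n L e y ≤ ((n * L + 1) * k + 1) * L := by
  refine weightVec_le hq _ e (lt_of_le_of_lt he ?_) y
  calc (n * L + 1) ^ k ≤ (2 ^ (n * L + 1)) ^ k := Nat.pow_le_pow_left Nat.lt_two_pow_self.le _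
    _ = 2 ^ ((n * L + 1) * k) := by rw [pow_mul]
    _ < _ := Nat.pow_lt_pow_right (by norm_num) (Nat.lt_succ_self _)

/-- All sums of multiples of unit vectors are enumerated. -/
lemma exists_weightVec_eq {ι : Type*} [DecidableEq ι] {n L : ℕ} (x : ι → ℕ) (hx : ∀ i, x i < n)
    (c : ι → Fin L) (s : Finset ι) : ∃ e < (n * L + 1) ^ s.card,
      ∀ y, weightVec n L e y = ∑ i ∈ s, if y = x i then (c i : ℕ) else 0 := by
  induction s using Finset.induction_on with
  | empty => exact ⟨0, by simp, fun y => by simp [weightVec]⟩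
  | insert i s hi ih =>
    obtain ⟨e, he, h⟩ := ih
    have hlt : x i * L + c i < n * L := by
      calc x i * L + c i < x i * L + L := Nat.add_lt_add_left (c i).2 _
        _ = (x i + 1) * L := by ring
        _ ≤ _ := Nat.mul_le_mul_right _ (hx i)
    have hpos : 0 < n * L := by omega
    refine ⟨(x i * L + c i) + n * L * e + 1, ?_, fun y => ?_⟩
    · rw [Finset.card_insert_of_notMem hi, pow_succ]
      nlinarith
    · rw [weightVec, Nat.add_mul_div_left _ _ hpos, Nat.div_eq_of_lt hlt, zero_add]
      beta_reduce
      rw [h, Nat.add_mul_mod_self_left, Nat.mod_eq_of_lt hlt, unitWeight_mul_add (c i).2,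
        Finset.sum_insert hi, add_comm]

/-- Linear forms with a large coefficient have a common point in a grid at which none is small. -/
lemma exists_grid_point {ι : Type*} [Fintype ι] [DecidableEq ι] (T : Finset ι) (v : ι → ι → ℝ)
    {g : ℝ} (hv : ∀ i ∈ T, g ≤ |v i i|) {L : ℕ} (hL : Fintype.card ι < L) :
    ∃ c : ι → Fin L, ∀ i ∈ T, g / 2 ≤ |∑ j, ((c j : ℕ) : ℝ) * v j i| := by
  by_contra hcon
  push Not at hcon
  let bad : ι → Finset (ι → Fin L) := fun i =>
    Finset.univ.filter fun c => |∑ j, ((c j : ℕ) : ℝ) * v j i| < g / 2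
  -- A line in direction `i` contains at most one bad point: two different values of `c i` change
  -- the form by at least `g`, while two bad values differ by less than `g`.
  have hcard : ∀ i ∈ T, (bad i).card * L ≤ L ^ Fintype.card ι := by
    intro i hi
    have h1 : (bad i ×ˢ (Finset.univ : Finset (Fin L))).card ≤
        (Finset.univ : Finset (ι → Fin L)).card := by
      refine Finset.card_le_card_of_injOn (fun q => Function.update q.1 i q.2)
        (fun _ _ => Finset.mem_coe.2 (Finset.mem_univ _)) ?_
      rintro ⟨c, t⟩ hc ⟨c', t'⟩ hc' h
      simp only [bad, Finset.coe_product, Set.mem_prod, Finset.mem_coe, Finset.mem_filter,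
        Finset.mem_univ, true_and, and_true] at hc hc'
      have hne : ∀ j, j ≠ i → c j = c' j := fun j hj => by
        have := congrFun h j
        simpa [Function.update_of_ne hj] using this
      have ht : t = t' := by simpa using congrFun h i
      have hd : (∑ j, ((c j : ℕ) : ℝ) * v j i) - ∑ j, ((c' j : ℕ) : ℝ) * v j i =
          (((c i : ℕ) : ℝ) - ((c' i : ℕ) : ℝ)) * v i i := by
        rw [← Finset.sum_sub_distrib, Finset.sum_eq_single i]
        · ring
        · intro j _ hj; rw [hne j hj]; ring
        · intro h; exact absurd (Finset.mem_univ i) h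
      have hlt : |(((c i : ℕ) : ℝ) - ((c' i : ℕ) : ℝ)) * v i i| < g := by
        rw [← hd]
        exact (abs_sub _ _).trans_lt (by linarith)
      have hci : c i = c' i := by
        by_contra hci
        have h2 : (1 : ℝ) ≤ |((c i : ℕ) : ℝ) - ((c' i : ℕ) : ℝ)| := by
          have : ((c i : ℕ) : ℤ) - ((c' i : ℕ) : ℤ) ≠ 0 := by
            intro h0; exact hci (Fin.ext (by omega))
          have := Int.one_le_abs this
          exact_mod_cast this
        rw [abs_mul] at hlt
        nlinarith [hv i hi, abs_nonneg (v i i)]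
      have : c = c' := by
        funext j
        by_cases hj : j = i
        · rw [hj, hci]
        · exact hne j hj
      rw [this, ht]
    simpa using h1
  have hcover : (Finset.univ : Finset (ι → Fin L)) ⊆ T.biUnion bad := by
    intro c _
    obtain ⟨i, hi, h⟩ := hcon c
    exact Finset.mem_biUnion.2 ⟨i, hi, by simpa [bad] using h⟩
  -- The bad sets would have to cover the grid, but even `Fintype.card ι < L` of them, each a
  -- fraction `1 / L` of the grid, do not.
  have h1 : L ^ Fintype.card ι ≤ ∑ i ∈ T, (bad i).card := by
    have := (Finset.card_le_card hcover).trans Finset.card_biUnion_le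
    simpa using this
  have h2 : (∑ i ∈ T, (bad i).card) * L ≤ Fintype.card ι * L ^ Fintype.card ι := by
    rw [Finset.sum_mul]
    refine (Finset.sum_le_card_nsmul T _ _ hcard).trans ?_
    rw [smul_eq_mul]
    exact Nat.mul_le_mul_right _ (Finset.card_le_univ T)
  have h3 : 0 < L ^ Fintype.card ι := Nat.pow_pos (by omega)
  have h4 := (Nat.mul_le_mul_right L h1).trans h2
  nlinarith

/-- Some vector in the enumeration separates the means of the observation in different hidden
states. -/
lemma exists_separating_weightVec {n R : ℕ} (hR : 0 < R) (M : ℕ → Fin R → ℝ) {g : ℝ}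
    (hM : ∀ r s, r ≠ s → ∃ x < n, g ≤ |M x r - M x s|) (hn : 0 < n) :
    ∃ e < (n * (R * R + 1) + 1) ^ (R * R), ∀ r s, r ≠ s →
      g / 2 ≤ |∑ x ∈ Finset.range n, (weightVec n (R * R + 1) (e + 1) x : ℝ) * M x r -
        ∑ x ∈ Finset.range n, (weightVec n (R * R + 1) (e + 1) x : ℝ) * M x s| := by
  -- One distinguishing observation per ordered pair of states. Its coefficient in the difference of
  -- means for that pair is the large one required by `exists_grid_point`.
  have hx : ∀ i : Fin R × Fin R, ∃ x < n, i.1 ≠ i.2 → g ≤ |M x i.1 - M x i.2| := by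
    intro i
    by_cases h : i.1 = i.2
    · exact ⟨0, hn, fun h' => absurd h h'⟩
    · obtain ⟨x, hx, h1⟩ := hM _ _ h
      exact ⟨x, hx, fun _ => h1⟩
  choose x hxn hxg using hx
  have hcard : Fintype.card (Fin R × Fin R) = R * R := by simp
  obtain ⟨c, hc⟩ := exists_grid_point (Finset.univ.filter fun i : Fin R × Fin R => i.1 ≠ i.2)
    (fun j i => M (x j) i.1 - M (x j) i.2) (g := g) (L := R * R + 1)
    (fun i hi => hxg i (Finset.mem_filter.1 hi).2) (by rw [hcard]; exact Nat.lt_succ_self _)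
  obtain ⟨e, he, hw⟩ := exists_weightVec_eq x hxn c Finset.univ
  rw [Finset.card_univ, hcard] at he
  have hsum : ∀ r, ∑ y ∈ Finset.range n, (weightVec n (R * R + 1) e y : ℝ) * M y r =
      ∑ j, ((c j : ℕ) : ℝ) * M (x j) r := by
    intro r
    simp only [hw, Nat.cast_sum, Nat.cast_ite, Nat.cast_zero, Finset.sum_mul]
    rw [Finset.sum_comm]
    refine Finset.sum_congr rfl fun j _ => ?_
    rw [Finset.sum_eq_single (x j)]
    · simp
    · intro y _ hy; simp [hy]
    · intro h; exact absurd (Finset.mem_range.2 (hxn j)) h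
  -- The search tries the vectors with positive index. Nothing is lost, since vectors `0` and `1`
  -- are both zero.
  obtain ⟨e', he', heq⟩ : ∃ e' < (n * (R * R + 1) + 1) ^ (R * R), ∀ y,
      weightVec n (R * R + 1) (e' + 1) y = weightVec n (R * R + 1) e y := by
    cases e with
    | zero => exact ⟨0, by positivity, fun y => by simp [weightVec, unitWeight]⟩
    | succ e => exact ⟨e, by omega, fun y => rfl⟩
  refine ⟨e', he', fun r s hrs => ?_⟩
  simp only [heq, hsum, ← Finset.sum_sub_distrib, ← mul_sub]
  exact hc (r, s) (by simpa using hrs)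

/-- Numerical constants are absorbed into powers of `b`, which is why `b ≥ 32` is assumed
throughout. -/
lemma const_div_pow_le {b : ℝ} (hb : 32 ≤ b) {c : ℝ} (i k : ℕ) (hc : c ≤ 32 ^ k) :
    c / b ^ (i + k) ≤ 1 / b ^ i := by
  have h0 : (0 : ℝ) < b := by linarith
  have h1 : (32 : ℝ) ^ k ≤ b ^ k := pow_le_pow_left₀ (by norm_num) hb k
  rw [div_le_div_iff₀ (by positivity) (by positivity), pow_add]
  nlinarith [pow_pos h0 i]

lemma abs_sum_mul_sub_le {ι : Type*} {s : Finset ι} {a f g : ι → ℝ} {C e : ℝ}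
    (ha : ∀ i ∈ s, |a i| ≤ C) (h : ∀ i ∈ s, |f i - g i| ≤ e) (hC : 0 ≤ C) :
    |∑ i ∈ s, a i * f i - ∑ i ∈ s, a i * g i| ≤ s.card * (C * e) := by
  rw [← Finset.sum_sub_distrib]
  refine (Finset.abs_sum_le_sum_abs _ _).trans ?_
  rw [← nsmul_eq_mul]
  refine Finset.sum_le_card_nsmul _ _ _ fun i hi => ?_
  rw [← mul_sub, abs_mul]
  exact mul_le_mul (ha i hi) (h i hi) (abs_nonneg _) hC

lemma abs_sum_sub_le {ι : Type*} {s : Finset ι} {f g : ι → ℝ} {e : ℝ}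
    (h : ∀ i ∈ s, |f i - g i| ≤ e) : |∑ i ∈ s, f i - ∑ i ∈ s, g i| ≤ s.card * e := by
  simpa using abs_sum_mul_sub_le (a := fun _ => 1) (C := 1) (by simp) h zero_le_one

lemma sq_sum_mul_le {ι : Type*} {s : Finset ι} {f φ : ι → ℝ} {e C : ℝ}
    (h : ∀ i ∈ s, |f i| ≤ e) (hφ : nsq s φ ≤ C) :
    (∑ i ∈ s, f i * φ i) ^ 2 ≤ s.card * e ^ 2 * C := by
  have h1 : nsq s f ≤ s.card * e ^ 2 :=
    nsq_le_card fun i hi => sq_le_sq' (abs_le.1 (h i hi)).1 (abs_le.1 (h i hi)).2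
  exact (sum_mul_sq_le_nsq s f φ).trans
    (mul_le_mul h1 hφ (nsq_nonneg _ _) (h1.trans' (nsq_nonneg _ _)))

/-! ### Approximate mixtures and the test on grid points -/

/-- An approximation `p` of a mixture `∑ s, U I s * M x s * V J s`, with quantitative
nondegeneracy of `U`, `V` and the factors `F` of an approximate two-fold mixture. -/
structure Mixture (n R d b : ℕ) (p : ℕ → ℝ) (U V F M : ℕ → Fin R → ℝ) (w : Fin R → ℝ) : Prop where
  b_ge : 32 ≤ (b : ℝ)
  d_le : (d : ℝ) + 1 ≤ b
  n_le : (n : ℝ) ≤ b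
  R_le : (R : ℝ) + 1 ≤ b
  U_nonneg : ∀ I s, 0 ≤ U I s
  V_nonneg : ∀ J s, 0 ≤ V J s
  F_nonneg : ∀ J s, 0 ≤ F J s
  M_nonneg : ∀ x s, 0 ≤ M x s
  w_nonneg : ∀ s, 0 ≤ w s
  U_sum : ∀ s, ∑ I ∈ Finset.range d, U I s = w s
  V_sum : ∀ s, ∑ J ∈ Finset.range d, V J s = 1
  F_sum : ∀ s, ∑ J ∈ Finset.range d, F J s = 1
  M_sum : ∀ s, ∑ x ∈ Finset.range n, M x s = 1
  w_sum : ∑ s, w s = 1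
  law : ∀ I < d, ∀ J < d, ∀ x < n,
    |p (I + d * (x + n * J)) - ∑ s, U I s * M x s * V J s| ≤ 1 / (b : ℝ) ^ 37
  early : ∀ I < d, ∀ J < d, |earlyMarg n d p J I - ∑ s, U I s * F J s| ≤ 1 / (b : ℝ) ^ 36
  rep : RowRep (Finset.range d) U ⊤ b
  lowV : ∀ z : Fin R → ℝ,
    nsq Finset.univ z ≤ b * nsq (Finset.range d) fun J => ∑ r, V J r * z r
  lowF : ∀ z : Fin R → ℝ,
    nsq Finset.univ z ≤ b * nsq (Finset.range d) fun J => ∑ r, F J r * z r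

/-- Mean of the weight of the observation in the state `s`. -/
def stateMean {R : ℕ} (n : ℕ) (M : ℕ → Fin R → ℝ) (α : ℕ → ℝ) (s : Fin R) : ℝ :=
  ∑ x ∈ Finset.range n, α x * M x s

namespace Mixture
variable {n R d b : ℕ} {p : ℕ → ℝ} {U V F M : ℕ → Fin R → ℝ} {w : Fin R → ℝ}

/-- Exact version of `slopeMat`. -/
def exactMat (n d : ℕ) (U V M : ℕ → Fin R → ℝ) (α : ℕ → ℝ) (lam : ℝ) (J I : ℕ) : ℝ :=
  if J < d then ∑ s, V J s * (stateMean n M α s - lam) * U I s else ∑ s, U I s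

lemma sum_exactMat (α : ℕ → ℝ) (lam : ℝ) (φ : ℕ → ℝ) (J : ℕ) :
    ∑ I ∈ Finset.range d, exactMat n d U V M α lam J I * φ I =
      if J < d then ∑ s, V J s * ((stateMean n M α s - lam) * ∑ I ∈ Finset.range d, U I s * φ I)
      else ∑ s, ∑ I ∈ Finset.range d, U I s * φ I := by
  unfold exactMat
  split_ifs
  · simp only [Finset.sum_mul, Finset.mul_sum]
    rw [Finset.sum_comm]
    exact Finset.sum_congr rfl fun s _ => Finset.sum_congr rfl fun I _ => by ring
  · simp only [Finset.sum_mul]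
    rw [Finset.sum_comm]

lemma b_pos (h : Mixture n R d b p U V F M w) : (0 : ℝ) < b := by have := h.b_ge; linarith

lemma d_le_b (h : Mixture n R d b p U V F M w) : d ≤ b := by
  have h1 : (d : ℝ) ≤ b := by linarith [h.d_le]
  exact_mod_cast h1

lemma n_le_b (h : Mixture n R d b p U V F M w) : n ≤ b := by exact_mod_cast h.n_le

lemma w_le_one (h : Mixture n R d b p U V F M w) (s : Fin R) : w s ≤ 1 :=
  h.w_sum ▸ Finset.single_le_sum (fun s _ => h.w_nonneg s) (Finset.mem_univ s)

lemma U_le_one (h : Mixture n R d b p U V F M w) {I : ℕ} (hI : I < d) (s : Fin R) : U I s ≤ 1 :=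
  (h.U_sum s ▸ Finset.single_le_sum (f := fun I => U I s) (fun I _ => h.U_nonneg I s)
    (Finset.mem_range.2 hI)).trans (h.w_le_one s)

lemma V_le_one (h : Mixture n R d b p U V F M w) {J : ℕ} (hJ : J < d) (s : Fin R) : V J s ≤ 1 :=
  h.V_sum s ▸ Finset.single_le_sum (f := fun I => V I s) (fun I _ => h.V_nonneg I s)
    (Finset.mem_range.2 hJ)

lemma F_le_one (h : Mixture n R d b p U V F M w) {J : ℕ} (hJ : J < d) (s : Fin R) : F J s ≤ 1 :=
  h.F_sum s ▸ Finset.single_le_sum (f := fun I => F I s) (fun I _ => h.F_nonneg I s)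
    (Finset.mem_range.2 hJ)

lemma M_le_one (h : Mixture n R d b p U V F M w) {x : ℕ} (hx : x < n) (s : Fin R) : M x s ≤ 1 :=
  h.M_sum s ▸ Finset.single_le_sum (f := fun I => M I s) (fun I _ => h.M_nonneg I s)
    (Finset.mem_range.2 hx)

lemma lateMarg_approx (h : Mixture n R d b p U V F M w) {I J : ℕ} (hI : I < d) (hJ : J < d) :
    |lateMarg n d p J I - ∑ s, U I s * V J s| ≤ 1 / (b : ℝ) ^ 36 := by
  have e : ∑ s, U I s * V J s = ∑ x ∈ Finset.range n, ∑ s, U I s * M x s * V J s := by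
    rw [Finset.sum_comm]
    refine Finset.sum_congr rfl fun s _ => ?_
    rw [← Finset.sum_mul, ← Finset.mul_sum, h.M_sum, mul_one]
  rw [e, lateMarg]
  refine (abs_sum_sub_le fun x hx => h.law I hI J hJ x (Finset.mem_range.1 hx)).trans ?_
  rw [Finset.card_range]
  have hb := h.b_pos
  calc (n : ℝ) * (1 / (b : ℝ) ^ 37) ≤ b * (1 / (b : ℝ) ^ 37) := by
        gcongr; exact h.n_le_b
    _ = _ := by field_simp

lemma obsMarg_approx (h : Mixture n R d b p U V F M w) {I x : ℕ} (hI : I < d) (hx : x < n) :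
    |obsMarg n d p x I - ∑ s, U I s * M x s| ≤ 1 / (b : ℝ) ^ 36 := by
  have e : ∑ s, U I s * M x s = ∑ J ∈ Finset.range d, ∑ s, U I s * M x s * V J s := by
    rw [Finset.sum_comm]
    refine Finset.sum_congr rfl fun s _ => ?_
    rw [← Finset.mul_sum, h.V_sum, mul_one]
  rw [e, obsMarg]
  refine (abs_sum_sub_le fun J hJ => h.law I hI J (Finset.mem_range.1 hJ) x hx).trans ?_
  rw [Finset.card_range]
  have hb := h.b_pos
  calc (d : ℝ) * (1 / (b : ℝ) ^ 37) ≤ b * (1 / (b : ℝ) ^ 37) := by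
        gcongr; exact h.d_le_b
    _ = _ := by field_simp

/-- Of the accuracy `b ^ (-37)` two powers are lost: in the contracted rows to the weights and the
number of observations, in the last row to two summations. -/
lemma slopeMat_approx (h : Mixture n R d b p U V F M w) {α : ℕ → ℝ} {lam : ℝ}
    (hα : ∀ x < n, 0 ≤ α x ∧ α x ≤ b)
    (hl : 0 ≤ lam ∧ lam ≤ b) {J I : ℕ} (hI : I < d) :
    |slopeMat n d p α lam J I - exactMat n d U V M α lam J I| ≤ 1 / (b : ℝ) ^ 35 := by
  have hb := h.b_pos
  unfold slopeMat exactMat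
  split_ifs with hJ
  · have e : ∑ s, V J s * (stateMean n M α s - lam) * U I s =
        ∑ x ∈ Finset.range n, (α x - lam) * ∑ s, U I s * M x s * V J s := by
      simp only [Finset.mul_sum]
      rw [Finset.sum_comm]
      refine Finset.sum_congr rfl fun s _ => ?_
      have : stateMean n M α s - lam = ∑ x ∈ Finset.range n, (α x - lam) * M x s := by
        simp only [sub_mul, Finset.sum_sub_distrib, ← Finset.mul_sum, h.M_sum, mul_one, stateMean]
      rw [this, Finset.mul_sum, Finset.sum_mul]
      exact Finset.sum_congr rfl fun x _ => by ring
    rw [e]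
    refine (abs_sum_mul_sub_le (C := b) (fun x hx => ?_)
      (fun x hx => h.law I hI J hJ x (Finset.mem_range.1 hx)) hb.le).trans ?_
    · have := hα x (Finset.mem_range.1 hx)
      rw [abs_le]; constructor <;> linarith
    · rw [Finset.card_range]
      calc (n : ℝ) * (b * (1 / (b : ℝ) ^ 37)) ≤ b * (b * (1 / (b : ℝ) ^ 37)) := by
            gcongr; exact h.n_le_b
        _ = _ := by field_simp
  · have e : ∑ s, U I s = ∑ J' ∈ Finset.range d, ∑ s, U I s * V J' s := by
      rw [Finset.sum_comm]
      refine Finset.sum_congr rfl fun s _ => ?_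
      rw [← Finset.mul_sum, h.V_sum, mul_one]
    rw [e]
    refine (abs_sum_sub_le fun J' hJ' => h.lateMarg_approx hI (Finset.mem_range.1 hJ')).trans ?_
    rw [Finset.card_range]
    calc (d : ℝ) * (1 / (b : ℝ) ^ 36) ≤ b * (1 / (b : ℝ) ^ 36) := by
          gcongr; exact h.d_le_b
      _ = _ := by field_simp

lemma stateMean_mem (h : Mixture n R d b p U V F M w) {α : ℕ → ℝ}
    (hα : ∀ x < n, 0 ≤ α x ∧ α x ≤ b) (s : Fin R) :
    0 ≤ stateMean n M α s ∧ stateMean n M α s ≤ b := by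
  refine ⟨Finset.sum_nonneg fun x hx =>
    mul_nonneg (hα x (Finset.mem_range.1 hx)).1 (h.M_nonneg _ _), ?_⟩
  calc _ ≤ ∑ x ∈ Finset.range n, b * M x s := Finset.sum_le_sum fun x hx =>
        mul_le_mul_of_nonneg_right (hα x (Finset.mem_range.1 hx)).2 (h.M_nonneg _ _)
    _ = b := by rw [← Finset.mul_sum, h.M_sum, mul_one]

lemma abs_exactMat_le (h : Mixture n R d b p U V F M w) {α : ℕ → ℝ} {lam : ℝ}
    (hα : ∀ x < n, 0 ≤ α x ∧ α x ≤ b)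
    (hl : 0 ≤ lam ∧ lam ≤ b) {J I : ℕ} (hI : I < d) :
    |exactMat n d U V M α lam J I| ≤ R * b := by
  have hb := h.b_ge
  unfold exactMat
  have key : ∀ f : Fin R → ℝ, (∀ s, |f s| ≤ b) → |∑ s, f s| ≤ R * b := fun f hf => by
    simpa using abs_sum_sub_le (s := Finset.univ) (f := f) (g := fun _ => 0) (e := b)
      (by simpa using hf)
  split_ifs with hJ
  · refine key _ fun s => ?_
    have h1 := h.stateMean_mem hα s
    rw [abs_mul, abs_mul, abs_of_nonneg (h.V_nonneg _ _), abs_of_nonneg (h.U_nonneg _ _)]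
    have h2 : |stateMean n M α s - lam| ≤ b := by rw [abs_le]; constructor <;> linarith
    calc _ ≤ 1 * |stateMean n M α s - lam| * 1 := by
          gcongr
          · exact h.U_nonneg _ _
          · exact h.V_le_one hJ s
          · exact h.U_le_one hI s
      _ ≤ b := by linarith
  · refine key _ fun s => ?_
    rw [abs_of_nonneg (h.U_nonneg _ _)]
    linarith [h.U_le_one hI s]

/-- This justifies the step `1 / b ^ 7` in `candSol`. -/
lemma sum_slopeMat_sq_le (h : Mixture n R d b p U V F M w) {α : ℕ → ℝ} {lam : ℝ}
    (hα : ∀ x < n, 0 ≤ α x ∧ α x ≤ b)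
    (hl : 0 ≤ lam ∧ lam ≤ b) :
    ∑ J ∈ Finset.range (d + 1), ∑ I ∈ Finset.range d, slopeMat n d p α lam J I ^ 2 ≤ (b : ℝ) ^ 7 := by
  have hb := h.b_ge
  have hb0 := h.b_pos
  refine (sum_sum_sq_le (e := (b : ℝ) ^ 2) fun J _ I hI => ?_).trans ?_
  · have h1 := h.slopeMat_approx hα hl (J := J) (Finset.mem_range.1 hI)
    have h2 := h.abs_exactMat_le hα hl (J := J) (Finset.mem_range.1 hI)
    have h3 := const_div_pow_le hb (c := 1) 0 35 (by norm_num)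
    have h4 : (R : ℝ) * b ≤ (b - 1) * b := by gcongr; linarith [h.R_le]
    have h5 := abs_add_le (slopeMat n d p α lam J I - exactMat n d U V M α lam J I)
      (exactMat n d U V M α lam J I)
    rw [sub_add_cancel] at h5
    norm_num at h3 h1
    nlinarith
  · simp only [Finset.card_range]
    push_cast
    have h1 : (d : ℝ) ≤ b := by linarith [h.d_le]
    calc ((d : ℝ) + 1) * (d * ((b : ℝ) ^ 2) ^ 2) ≤ b * (b * ((b : ℝ) ^ 2) ^ 2) := by
          gcongr; exact h.d_le
      _ = (b : ℝ) ^ 6 := by ring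
      _ ≤ _ := pow_le_pow_right₀ (by linarith) (by norm_num)

/-- The error of the system matrix, applied to a vector. -/
lemma nsq_error_le (h : Mixture n R d b p U V F M w) {α : ℕ → ℝ} {lam : ℝ}
    (hα : ∀ x < n, 0 ≤ α x ∧ α x ≤ b)
    (hl : 0 ≤ lam ∧ lam ≤ b) {φ : ℕ → ℝ} {C : ℝ} (hφ : nsq (Finset.range d) φ ≤ C) :
    nsq (Finset.range (d + 1)) (fun J => ∑ I ∈ Finset.range d,
      (slopeMat n d p α lam J I - exactMat n d U V M α lam J I) * φ I) ≤ C / (b : ℝ) ^ 68 := by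
  have hb0 := h.b_pos
  have hC : 0 ≤ C := (nsq_nonneg _ _).trans hφ
  refine (nsq_le_card fun J _ => sq_sum_mul_le
    (fun I hI => h.slopeMat_approx hα hl (Finset.mem_range.1 hI)) hφ).trans ?_
  simp only [Finset.card_range]
  push_cast
  have h1 : (d : ℝ) ≤ b := by linarith [h.d_le]
  calc ((d : ℝ) + 1) * (d * (1 / (b : ℝ) ^ 35) ^ 2 * C) ≤ b * (b * (1 / (b : ℝ) ^ 35) ^ 2 * C) := by
        gcongr; exact h.d_le
    _ = _ := by field_simp

lemma lwResid_split (α : ℕ → ℝ) (lam : ℝ) (φ : ℕ → ℝ) (J : ℕ) :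
    lwResid (Finset.range d) (slopeMat n d p α lam) (slopeRhs d) φ J =
      (-slopeRhs d J + ∑ I ∈ Finset.range d, exactMat n d U V M α lam J I * φ I) +
      ∑ I ∈ Finset.range d, (slopeMat n d p α lam J I - exactMat n d U V M α lam J I) * φ I := by
  simp only [lwResid, sub_mul, Finset.sum_sub_distrib]; ring

lemma grid_mem (hb : 32 ≤ (b : ℝ)) {j : ℕ} (hj : j ≤ b ^ 18) :
    0 ≤ (j : ℝ) / (b : ℝ) ^ 17 ∧ (j : ℝ) / (b : ℝ) ^ 17 ≤ b := by
  have hb0 : (0 : ℝ) < b := by linarith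
  refine ⟨by positivity, ?_⟩
  rw [div_le_iff₀ (by positivity)]
  have : (j : ℝ) ≤ (b : ℝ) ^ 18 := by exact_mod_cast hj
  calc (j : ℝ) ≤ (b : ℝ) ^ 18 := this
    _ = _ := by ring

/-- Grid points close to the mean of a state pass the test. -/
lemma candOk_of_close (h : Mixture n R d b p U V F M w) {α : ℕ → ℝ}
    (hα : ∀ x < n, 0 ≤ α x ∧ α x ≤ b) {j : ℕ} (hj : j ≤ b ^ 18)
    (s : Fin R) (hs : |stateMean n M α s - j / (b : ℝ) ^ 17| ≤ 1 / (b : ℝ) ^ 17) :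
    CandOk n d b p α j := by
  have hb := h.b_ge
  have hb0 := h.b_pos
  have hl := grid_mem hb hj
  set lam := (j : ℝ) / (b : ℝ) ^ 17 with hlam
  -- `z` isolates the state `s`: its coefficients against `U` are the unit vector of `s`. It solves
  -- the normalization exactly and the other rows up to `|μ_s - λ|`, so it serves as comparison
  -- vector for the iteration.
  obtain ⟨z, hz, hzn⟩ := h.rep (Pi.single s 1) trivial
  have hone : nsq Finset.univ (Pi.single s (1 : ℝ)) = 1 := by
    simp [nsq, Pi.single_apply, ite_pow]
  rw [hone, mul_one] at hzn
  have h1 : nsq (Finset.range (d + 1)) (fun J => -slopeRhs d J +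
      ∑ I ∈ Finset.range d, exactMat n d U V M α lam J I * z I) ≤ 1 / (b : ℝ) ^ 33 := by
    refine (nsq_le_card (c := (1 / (b : ℝ) ^ 17) ^ 2) fun J hJ => ?_).trans ?_
    · rw [sum_exactMat]
      simp only [hz]
      have hJ' := Finset.mem_range.1 hJ
      split_ifs with hJd
      · rw [slopeRhs, if_neg hJd.ne, Finset.sum_eq_single s]
        · simp only [Pi.single_eq_same, mul_one, neg_zero, zero_add]
          rw [sq_le_sq, abs_mul, abs_of_nonneg (h.V_nonneg _ _), abs_of_pos (a := 1 / (b : ℝ) ^ 17)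
            (by positivity)]
          calc _ ≤ 1 * |stateMean n M α s - lam| := by
                gcongr; exact h.V_le_one hJd s
            _ ≤ _ := by rw [one_mul]; exact hs
        · intro r _ hr; simp [hr]
        · simp
      · rw [slopeRhs, if_pos (by omega)]
        simp
    · rw [Finset.card_range]
      push_cast
      calc ((d : ℝ) + 1) * (1 / (b : ℝ) ^ 17) ^ 2 ≤ b * (1 / (b : ℝ) ^ 17) ^ 2 := by
            gcongr; exact h.d_le
        _ = _ := by field_simp
  have h2 : nsq (Finset.range (d + 1)) (lwResid (Finset.range d) (slopeMat n d p α lam)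
      (slopeRhs d) z) ≤ 3 / (b : ℝ) ^ 33 := by
    rw [nsq_congr fun J _ => lwResid_split α lam z J]
    refine (nsq_add_le _ _ _).trans ?_
    have h3 := h.nsq_error_le hα hl hzn
    have h4 : (b : ℝ) / (b : ℝ) ^ 68 = (1 / (b : ℝ) ^ 34) * (1 / (b : ℝ) ^ 33) := by field_simp
    have h5 := const_div_pow_le hb (c := 2) 0 34 (by norm_num)
    have h6 : 0 < 1 / (b : ℝ) ^ 33 := by positivity
    have h7 : 3 / (b : ℝ) ^ 33 = 3 * (1 / (b : ℝ) ^ 33) := by ring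
    rw [h4] at h3
    rw [h7]
    have h8 : 2 * (1 / (b : ℝ) ^ 34) ≤ 1 := by rw [mul_one_div]; simpa using h5
    nlinarith
  -- The `b ^ 41` rounds reduce the contribution of `‖z‖² ≤ b` to `2 / b ^ 33`. Together with four
  -- times the residual of `z` this is `14 / b ^ 33`, below the threshold `1 / b ^ 32`.
  have h3 := lw_resid_le (Finset.range (d + 1)) (Finset.range d) (slopeMat n d p α lam) (slopeRhs d)
    (C := (b : ℝ) ^ 7) (by positivity) (h.sum_slopeMat_sq_le hα hl) z (L := b ^ 41)
    (Nat.pow_pos (by exact_mod_cast hb0))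
  have h4 : 2 * (b : ℝ) ^ 7 * nsq (Finset.range d) z / ((b ^ 41 : ℕ) : ℝ) ≤ 2 / (b : ℝ) ^ 33 := by
    push_cast
    calc 2 * (b : ℝ) ^ 7 * nsq (Finset.range d) z / (b : ℝ) ^ 41
        ≤ 2 * (b : ℝ) ^ 7 * b / (b : ℝ) ^ 41 := by gcongr
      _ = _ := by field_simp
  replace h2 := mul_le_mul_of_nonneg_left h2 (zero_le_four (α := ℝ))
  refine lt_of_le_of_lt (h3.trans (add_le_add h4 h2)) ?_
  have h5 : 2 / (b : ℝ) ^ 33 + 4 * (3 / (b : ℝ) ^ 33) = 14 / (b : ℝ) ^ 33 := by ring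
  rw [h5, div_lt_div_iff₀ (by positivity) (by positivity)]
  have : 0 < (b : ℝ) ^ 32 := by positivity
  rw [pow_succ (b : ℝ) 32]
  nlinarith

/-- The coefficients of a solution that passes the test. -/
lemma coef_of_candOk (h : Mixture n R d b p U V F M w) {α : ℕ → ℝ}
    (hα : ∀ x < n, 0 ≤ α x ∧ α x ≤ b) {j : ℕ} (hj : j ≤ b ^ 18)
    (hok : CandOk n d b p α j) :
    nsq (Finset.range d) (candSol n d b p α j) ≤ 2 * (b : ℝ) ^ 34 ∧
    (∀ s, ((stateMean n M α s - j / (b : ℝ) ^ 17) *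
      ∑ I ∈ Finset.range d, U I s * candSol n d b p α j I) ^ 2 ≤ 3 / (b : ℝ) ^ 31) ∧
    (∑ s, ∑ I ∈ Finset.range d, U I s * candSol n d b p α j I - 1) ^ 2 ≤ 3 / (b : ℝ) ^ 32 := by
  have hb := h.b_ge
  have hb0 := h.b_pos
  have hl := grid_mem hb hj
  set φ := candSol n d b p α j with hφ
  unfold CandOk candRes at hok
  set lam := (j : ℝ) / (b : ℝ) ^ 17 with hlam
  -- Comparison with the zero vector, whose squared residual is `1`: the iterate satisfies `‖φ‖² ≤ 2
  -- b ^ 41 / b ^ 7`. This bound is what the matrix error `b ^ (-35)` has to beat.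
  have hn1 : nsq (Finset.range d) φ ≤ 2 * (b : ℝ) ^ 34 := by
    have h3 := lw_dist_le (Finset.range (d + 1)) (Finset.range d) (slopeMat n d p α lam) (slopeRhs d)
      (C := (b : ℝ) ^ 7) (by positivity) (h.sum_slopeMat_sq_le hα hl) (fun _ => 0) (b ^ 41)
    have h4 : nsq (Finset.range (d + 1)) (lwResid (Finset.range d) (slopeMat n d p α lam)
        (slopeRhs d) fun _ => 0) = 1 := by
      simp only [nsq, lwResid, mul_zero, Finset.sum_const_zero, add_zero]
      rw [Finset.sum_eq_single d]
      · simp [slopeRhs]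
      · intro J _ hJ; simp [slopeRhs, hJ]
      · simp
    have h5 : nsq (Finset.range d) (fun _ => (0 : ℝ)) = 0 := by simp [nsq]
    rw [h4, h5] at h3
    simp only [sub_zero, zero_add, mul_one] at h3
    refine h3.trans (le_of_eq ?_)
    push_cast
    field_simp
  have hθ : nsq (Finset.range (d + 1)) (fun J => -slopeRhs d J +
      ∑ I ∈ Finset.range d, exactMat n d U V M α lam J I * φ I) ≤ 3 / (b : ℝ) ^ 32 := by
    have e : ∀ J ∈ Finset.range (d + 1), -slopeRhs d J +
        ∑ I ∈ Finset.range d, exactMat n d U V M α lam J I * φ I =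
        lwResid (Finset.range d) (slopeMat n d p α lam) (slopeRhs d) φ J + (-1) *
        ∑ I ∈ Finset.range d, (slopeMat n d p α lam J I - exactMat n d U V M α lam J I) * φ I :=
      fun J _ => by rw [lwResid_split]; ring
    rw [nsq_congr e]
    refine (nsq_add_le _ _ _).trans ?_
    rw [nsq_smul]
    have h3 := h.nsq_error_le hα hl hn1
    have h4 : 2 * (b : ℝ) ^ 34 / (b : ℝ) ^ 68 = (2 / (b : ℝ) ^ 2) * (1 / (b : ℝ) ^ 32) := by
      field_simp
    have h5 := const_div_pow_le hb (c := 4) 0 2 (by norm_num)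
    have h6 : 0 < 1 / (b : ℝ) ^ 32 := by positivity
    have h7 : 3 / (b : ℝ) ^ 32 = 3 * (1 / (b : ℝ) ^ 32) := by ring
    have h8 : 2 * (2 / (b : ℝ) ^ 2) ≤ 1 := by
      have e : 2 * (2 / (b : ℝ) ^ 2) = 4 / (b : ℝ) ^ (0 + 2) := by ring
      rw [e]; simpa using h5
    rw [h4] at h3
    rw [h7]
    nlinarith
  -- The first `d` rows apply `V` to the numbers `(μ_s - λ) c_s`, which are small since `V` is
  -- bounded below; the last row measures the deviation of `∑ c_s` from `1`.
  have hsplit : nsq (Finset.range (d + 1)) (fun J => -slopeRhs d J +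
      ∑ I ∈ Finset.range d, exactMat n d U V M α lam J I * φ I) =
      nsq (Finset.range d) (fun J => ∑ s, V J s * ((stateMean n M α s - lam) *
        ∑ I ∈ Finset.range d, U I s * φ I)) +
      (∑ s, ∑ I ∈ Finset.range d, U I s * φ I - 1) ^ 2 := by
    simp only [nsq]
    rw [Finset.sum_range_succ]
    congr 1
    · refine Finset.sum_congr rfl fun J hJ => ?_
      have hJ' := Finset.mem_range.1 hJ
      rw [sum_exactMat, if_pos hJ', slopeRhs, if_neg hJ'.ne, neg_zero, zero_add]
    · rw [sum_exactMat, if_neg (lt_irrefl _), slopeRhs, if_pos rfl]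
      ring
  rw [hsplit] at hθ
  refine ⟨hn1, fun s => ?_, ?_⟩
  · refine (sq_le_nsq (fun s => (stateMean n M α s - lam) * ∑ I ∈ Finset.range d, U I s * φ I)
      (Finset.mem_univ s)).trans ((h.lowV _).trans ?_)
    have h3 : nsq (Finset.range d) (fun J => ∑ s, V J s * ((stateMean n M α s - lam) *
        ∑ I ∈ Finset.range d, U I s * φ I)) ≤ 3 / (b : ℝ) ^ 32 :=
      le_trans (le_add_of_nonneg_right (sq_nonneg _)) hθ
    calc _ ≤ (b : ℝ) * (3 / (b : ℝ) ^ 32) := mul_le_mul_of_nonneg_left h3 hb0.le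
      _ = _ := by field_simp
  · exact le_trans (le_add_of_nonneg_left (nsq_nonneg _ _)) hθ

end Mixture

lemma abs_le_of_sq_le_div {x c b : ℝ} (hb : 32 ≤ b) (i k : ℕ) (hc : c ≤ 32 ^ k)
    (h : x ^ 2 ≤ c / b ^ (2 * i + k)) : |x| ≤ 1 / b ^ i := by
  have h0 : (0 : ℝ) < b := by linarith
  have h1 := h.trans (const_div_pow_le hb (2 * i) k hc)
  refine abs_le_of_sq_le_sq (h1.trans (le_of_eq ?_)) (by positivity)
  rw [div_pow, one_pow, ← pow_mul, mul_comm i 2]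

/-- The final linear systems. -/
lemma nsq_lwIter_sub_le {d R b : ℕ} (hb : 32 ≤ (b : ℝ)) (hd : (d : ℝ) ≤ b) (hR : (R : ℝ) ≤ b)
    {A A' : ℕ → ℕ → ℝ} {h y : ℕ → ℝ}
    (hA : ∀ J < d, ∀ i < R, |A J i - A' J i| ≤ 1 / (b : ℝ) ^ 8)
    (hA1 : ∀ J < d, ∀ i < R, |A' J i| ≤ 1)
    (hlow : ∀ z : ℕ → ℝ, nsq (Finset.range R) z ≤
      b * nsq (Finset.range d) fun J => ∑ i ∈ Finset.range R, A' J i * z i)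
    (hy0 : ∀ i < R, 0 ≤ y i) (hy1 : ∑ i ∈ Finset.range R, y i = 1)
    (hh : ∀ J < d, |h J - ∑ i ∈ Finset.range R, A' J i * y i| ≤ 1 / (b : ℝ) ^ 8) :
    nsq (Finset.range R) (fun i =>
      lwIter (Finset.range d) (Finset.range R) A h (1 / (b : ℝ) ^ 3) (b ^ 10) i - y i) ≤
      1 / (b : ℝ) ^ 5 := by
  have hb0 : (0 : ℝ) < b := by linarith
  have hd' : d ≤ b := by exact_mod_cast hd
  have hR' : R ≤ b := by exact_mod_cast hR
  set u := lwIter (Finset.range d) (Finset.range R) A h (1 / (b : ℝ) ^ 3) (b ^ 10) with hu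
  have hyn : nsq (Finset.range R) y ≤ 1 :=
    nsq_le_one_of_sum (fun i hi => hy0 i (Finset.mem_range.1 hi)) hy1
  have hsmall := const_div_pow_le hb (c := 1) 0 8 (by norm_num)
  rw [zero_add, pow_zero, div_one] at hsmall
  have hC : ∑ J ∈ Finset.range d, ∑ i ∈ Finset.range R, A J i ^ 2 ≤ (b : ℝ) ^ 3 := by
    refine (sum_sum_sq_le (e := 2) fun J hJ i hi => ?_).trans ?_
    · have h1 := hA J (Finset.mem_range.1 hJ) i (Finset.mem_range.1 hi)
      have h2 := hA1 J (Finset.mem_range.1 hJ) i (Finset.mem_range.1 hi)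
      have h5 := abs_add_le (A J i - A' J i) (A' J i)
      rw [sub_add_cancel] at h5
      linarith
    · simp only [Finset.card_range]
      calc (d : ℝ) * (R * 2 ^ 2) ≤ (b : ℝ) * ((b : ℝ) * 2 ^ 2) := by gcongr
        _ ≤ (b : ℝ) * ((b : ℝ) * b) := by gcongr; linarith
        _ = _ := by ring
  have hres : nsq (Finset.range d) (lwResid (Finset.range R) A h y) ≤ 4 / (b : ℝ) ^ 15 := by
    refine (nsq_le_card (c := (2 / (b : ℝ) ^ 8) ^ 2) fun J hJ => ?_).trans ?_
    · have hJ' := Finset.mem_range.1 hJ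
      have e : lwResid (Finset.range R) A h y J = -(h J - ∑ i ∈ Finset.range R, A' J i * y i) +
          ∑ i ∈ Finset.range R, (A J i - A' J i) * y i := by
        simp only [lwResid, sub_mul, Finset.sum_sub_distrib]; ring
      have h1 : |∑ i ∈ Finset.range R, (A J i - A' J i) * y i| ≤ 1 / (b : ℝ) ^ 8 := by
        refine (Finset.abs_sum_le_sum_abs _ _).trans ?_
        have e1 : 1 / (b : ℝ) ^ 8 = ∑ i ∈ Finset.range R, 1 / (b : ℝ) ^ 8 * y i := by
          rw [← Finset.mul_sum, hy1, mul_one]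
        rw [e1]
        refine Finset.sum_le_sum fun i hi => ?_
        rw [abs_mul, abs_of_nonneg (hy0 i (Finset.mem_range.1 hi))]
        exact mul_le_mul_of_nonneg_right (hA J hJ' i (Finset.mem_range.1 hi))
          (hy0 i (Finset.mem_range.1 hi))
      rw [e, sq_le_sq, abs_of_pos (a := 2 / (b : ℝ) ^ 8) (by positivity)]
      refine (abs_add_le _ _).trans ?_
      rw [abs_neg]
      calc _ ≤ 1 / (b : ℝ) ^ 8 + 1 / (b : ℝ) ^ 8 := add_le_add (hh J hJ') h1
        _ = _ := by ring
    · rw [Finset.card_range]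
      calc (d : ℝ) * (2 / (b : ℝ) ^ 8) ^ 2 ≤ b * (2 / (b : ℝ) ^ 8) ^ 2 := by gcongr
        _ = _ := by field_simp; norm_num
  have hLpos : 0 < b ^ 10 := Nat.pow_pos (by exact_mod_cast hb0)
  have e7 : 0 < 1 / (b : ℝ) ^ 7 := by positivity
  have h8 : 1 / (b : ℝ) ^ 8 ≤ 1 / 32 * (1 / (b : ℝ) ^ 7) := by
    rw [one_div_mul_one_div, one_div_le_one_div (by positivity) (by positivity), pow_succ (b : ℝ) 7]
    nlinarith [pow_pos hb0 7]
  have h15 : 1 / (b : ℝ) ^ 15 ≤ 1 / 32 * (1 / (b : ℝ) ^ 7) := by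
    refine le_trans ?_ h8
    exact one_div_pow_le_one_div_pow_of_le (by linarith) (by norm_num)
  have hr1 : nsq (Finset.range d) (lwResid (Finset.range R) A h u) ≤ 3 * (1 / (b : ℝ) ^ 7) := by
    refine (lw_resid_le (Finset.range d) (Finset.range R) A h (C := (b : ℝ) ^ 3) (by positivity) hC y
      hLpos).trans ?_
    have h1 : 2 * (b : ℝ) ^ 3 * nsq (Finset.range R) y / ((b ^ 10 : ℕ) : ℝ) ≤
        2 * (1 / (b : ℝ) ^ 7) := by
      push_cast
      calc _ ≤ 2 * (b : ℝ) ^ 3 * 1 / (b : ℝ) ^ 10 := by gcongr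
        _ = _ := by field_simp
    have h2 : 4 / (b : ℝ) ^ 15 = 4 * (1 / (b : ℝ) ^ 15) := by ring
    rw [h2] at hres
    linarith
  -- An a priori bound on the distance. It is needed to replace `A` by the well conditioned `A'` in
  -- the estimate of `u - y`.
  have hd1 : nsq (Finset.range R) (fun i => u i - y i) ≤ 2 := by
    refine (lw_dist_le (Finset.range d) (Finset.range R) A h (C := (b : ℝ) ^ 3) (by positivity) hC y
      (b ^ 10)).trans ?_
    have h1 : 2 * ((b ^ 10 : ℕ) : ℝ) / (b : ℝ) ^ 3 * nsq (Finset.range d)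
        (lwResid (Finset.range R) A h y) ≤ 8 / (b : ℝ) ^ 8 := by
      push_cast
      calc _ ≤ 2 * (b : ℝ) ^ 10 / (b : ℝ) ^ 3 * (4 / (b : ℝ) ^ 15) := by gcongr
        _ = _ := by field_simp; norm_num
    have h2 := const_div_pow_le hb (c := 8) 0 8 (by norm_num)
    rw [zero_add, pow_zero, div_one] at h2
    linarith
  have hdiff : nsq (Finset.range d) (fun J => ∑ i ∈ Finset.range R, A J i * (u i - y i)) ≤
      7 * (1 / (b : ℝ) ^ 7) := by
    have e : ∀ J ∈ Finset.range d, ∑ i ∈ Finset.range R, A J i * (u i - y i) =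
        lwResid (Finset.range R) A h u J + (-1) * lwResid (Finset.range R) A h y J := fun J _ => by
      rw [lwResid_sub (Finset.range R) A h u y]; ring
    rw [nsq_congr e]
    refine (nsq_add_le _ _ _).trans ?_
    rw [nsq_smul]
    have h2 : 4 / (b : ℝ) ^ 15 = 4 * (1 / (b : ℝ) ^ 15) := by ring
    rw [h2] at hres
    linarith
  have hexact : nsq (Finset.range d) (fun J => ∑ i ∈ Finset.range R, A' J i * (u i - y i)) ≤
      15 * (1 / (b : ℝ) ^ 7) := by
    have e : ∀ J ∈ Finset.range d, ∑ i ∈ Finset.range R, A' J i * (u i - y i) =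
        ∑ i ∈ Finset.range R, A J i * (u i - y i) + (-1) *
        ∑ i ∈ Finset.range R, (A J i - A' J i) * (u i - y i) := fun J _ => by
      simp only [sub_mul (A J _), Finset.sum_sub_distrib]; ring
    rw [nsq_congr e]
    refine (nsq_add_le _ _ _).trans ?_
    rw [nsq_smul]
    have h1 : nsq (Finset.range d) (fun J => ∑ i ∈ Finset.range R, (A J i - A' J i) * (u i - y i)) ≤
        2 * (1 / (b : ℝ) ^ 14) := by
      refine (nsq_le_card fun J hJ => sq_sum_mul_le (fun i hi =>
        hA J (Finset.mem_range.1 hJ) i (Finset.mem_range.1 hi)) hd1).trans ?_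
      simp only [Finset.card_range]
      calc (d : ℝ) * (R * (1 / (b : ℝ) ^ 8) ^ 2 * 2) ≤ b * (b * (1 / (b : ℝ) ^ 8) ^ 2 * 2) := by gcongr
        _ = _ := by field_simp
    have h14 : 1 / (b : ℝ) ^ 14 ≤ 1 / 32 * (1 / (b : ℝ) ^ 7) := by
      refine le_trans ?_ h8
      exact one_div_pow_le_one_div_pow_of_le (by linarith) (by norm_num)
    linarith
  calc nsq (Finset.range R) (fun i => u i - y i) ≤ b * (15 * (1 / (b : ℝ) ^ 7)) :=
        (hlow _).trans (mul_le_mul_of_nonneg_left hexact hb0.le)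
    _ = 15 / (b : ℝ) ^ (5 + 1) := by field_simp
    _ ≤ _ := const_div_pow_le hb 5 1 (by norm_num)

/-! ### From accepted grid points to hidden states -/

namespace Mixture
variable {n R d b : ℕ} {p : ℕ → ℝ} {U V F M : ℕ → Fin R → ℝ} {w : Fin R → ℝ}

/-- A grid point that passes the test is close to the mean of a state. -/
lemma exists_state_of_candOk (h : Mixture n R d b p U V F M w) {α : ℕ → ℝ}
    (hα : ∀ x < n, 0 ≤ α x ∧ α x ≤ b) {j : ℕ} (hj : j ≤ b ^ 18) (hok : CandOk n d b p α j) :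
    ∃ s, |stateMean n M α s - j / (b : ℝ) ^ 17| ≤ 1 / (b : ℝ) ^ 14 := by
  have hb := h.b_ge
  have hb0 := h.b_pos
  obtain ⟨-, h2, h3⟩ := h.coef_of_candOk hα hj hok
  by_contra hcon
  push Not at hcon
  set c : Fin R → ℝ := fun s => ∑ I ∈ Finset.range d, U I s * candSol n d b p α j I with hc
  -- If `λ` stays `b ^ (-14)` away from all means, then every `c_s` is so small that the sum of at
  -- most `b` of them cannot be close to `1`.
  have h4 : ∀ s, c s ^ 2 ≤ 3 / (b : ℝ) ^ 3 := by
    intro s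
    have h5 := h2 s
    rw [mul_pow] at h5
    have h6 : (1 / (b : ℝ) ^ 14) ^ 2 ≤ (stateMean n M α s - j / (b : ℝ) ^ 17) ^ 2 := by
      rw [sq_le_sq, abs_of_pos (by positivity)]; exact (hcon s).le
    have h7 := (mul_le_mul_of_nonneg_right h6 (sq_nonneg (c s))).trans h5
    have h8 : (1 / (b : ℝ) ^ 14) ^ 2 * c s ^ 2 = c s ^ 2 / (b : ℝ) ^ 28 := by field_simp
    rw [h8, div_le_div_iff₀ (by positivity) (by positivity)] at h7
    rw [le_div_iff₀ (by positivity)]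
    have h9 : 0 < (b : ℝ) ^ 28 := by positivity
    have h10 : c s ^ 2 * (b : ℝ) ^ 31 = (c s ^ 2 * (b : ℝ) ^ 3) * (b : ℝ) ^ 28 := by ring
    rw [h10] at h7
    exact le_of_mul_le_mul_right h7 h9
  have h5 : (∑ s, c s) ^ 2 ≤ 3 / 32 := by
    have h6 := sq_sum_le_card_mul_sum_sq (s := (Finset.univ : Finset (Fin R))) (f := c)
    refine h6.trans ((mul_le_mul_of_nonneg_left (Finset.sum_le_card_nsmul _ _ _ fun s _ => h4 s)
      (by positivity)).trans ?_)
    simp only [Finset.card_univ, Fintype.card_fin, nsmul_eq_mul]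
    have hR : R ≤ b := by
      have h1 : (R : ℝ) ≤ b := by linarith [h.R_le]
      exact_mod_cast h1
    calc (R : ℝ) * (R * (3 / (b : ℝ) ^ 3)) ≤ (b : ℝ) * ((b : ℝ) * (3 / (b : ℝ) ^ 3)) := by gcongr
      _ = 3 / (b : ℝ) := by field_simp
      _ ≤ _ := by gcongr
  have h6 : (∑ s, c s - 1) ^ 2 ≤ 1 / 32 := by
    refine h3.trans ((const_div_pow_le hb 1 31 (by norm_num)).trans ?_)
    rw [pow_one]; exact one_div_le_one_div_of_le (by norm_num) hb
  nlinarith [sq_nonneg (∑ s, c s + (∑ s, c s - 1))]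

/-- The coefficients of the solution for a grid point that is close to the mean of one state
only. -/
lemma abs_coef_sub_le (h : Mixture n R d b p U V F M w) {α : ℕ → ℝ}
    (hα : ∀ x < n, 0 ≤ α x ∧ α x ≤ b) {j : ℕ} (hj : j ≤ b ^ 18) (hok : CandOk n d b p α j)
    {s : Fin R} (hs : ∀ r, r ≠ s → 1 / (2 * (b : ℝ) ^ 3) ≤ |stateMean n M α r - j / (b : ℝ) ^ 17|)
    (r : Fin R) : |∑ I ∈ Finset.range d, U I r * candSol n d b p α j I - if r = s then 1 else 0| ≤
      1 / (b : ℝ) ^ 10 := by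
  have hb := h.b_ge
  have hb0 := h.b_pos
  obtain ⟨-, h2, h3⟩ := h.coef_of_candOk hα hj hok
  set c : Fin R → ℝ := fun s => ∑ I ∈ Finset.range d, U I s * candSol n d b p α j I with hc
  have h4 : ∀ r, r ≠ s → |c r| ≤ 1 / (b : ℝ) ^ 12 := by
    intro r hr
    refine abs_le_of_sq_le_div hb (c := 12) 12 1 (by norm_num) ?_
    have h5 := h2 r
    rw [mul_pow] at h5
    have h6 : (1 / (2 * (b : ℝ) ^ 3)) ^ 2 ≤ (stateMean n M α r - j / (b : ℝ) ^ 17) ^ 2 := by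
      rw [sq_le_sq, abs_of_pos (by positivity)]; exact hs r hr
    have h7 := (mul_le_mul_of_nonneg_right h6 (sq_nonneg (c r))).trans h5
    have h8 : (1 / (2 * (b : ℝ) ^ 3)) ^ 2 * c r ^ 2 = c r ^ 2 / (4 * (b : ℝ) ^ 6) := by
      field_simp; ring
    rw [h8, div_le_div_iff₀ (by positivity) (by positivity)] at h7
    rw [le_div_iff₀ (by positivity)]
    have h9 : 0 < (b : ℝ) ^ 6 := by positivity
    have h10 : c r ^ 2 * (b : ℝ) ^ 31 = (c r ^ 2 * (b : ℝ) ^ (2 * 12 + 1)) * (b : ℝ) ^ 6 := by ring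
    have h11 : 3 * (4 * (b : ℝ) ^ 6) = 12 * (b : ℝ) ^ 6 := by ring
    rw [h10, h11] at h7
    exact le_of_mul_le_mul_right h7 h9
  have h12 : 1 / (b : ℝ) ^ 12 ≤ 1 / (b : ℝ) ^ 10 :=
    one_div_pow_le_one_div_pow_of_le (by linarith) (by norm_num)
  by_cases hr : r = s
  · subst hr
    rw [if_pos rfl]
    have h5 : |∑ s, c s - 1| ≤ 1 / (b : ℝ) ^ 15 :=
      abs_le_of_sq_le_div hb (c := 3) 15 2 (by norm_num) h3
    have h6 : |∑ s ∈ Finset.univ.erase r, c s| ≤ R * (1 / (b : ℝ) ^ 12) := by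
      refine (Finset.abs_sum_le_sum_abs _ _).trans ?_
      refine (Finset.sum_le_card_nsmul _ _ _ fun s hs => h4 s (Finset.ne_of_mem_erase hs)).trans ?_
      rw [nsmul_eq_mul]
      gcongr
      simp
    have h7 : c r - 1 = (∑ s, c s - 1) - ∑ s ∈ Finset.univ.erase r, c s := by
      rw [← Finset.add_sum_erase _ _ (Finset.mem_univ r)]; ring
    have h8 : |c r - 1| ≤ 1 / (b : ℝ) ^ 15 + R * (1 / (b : ℝ) ^ 12) := by
      rw [h7]; exact (abs_sub _ _).trans (add_le_add h5 h6)
    have h9 : 1 / (b : ℝ) ^ 15 ≤ 1 / (b : ℝ) ^ 12 :=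
      one_div_pow_le_one_div_pow_of_le (by linarith) (by norm_num)
    calc |c r - 1| ≤ (R + 1) * (1 / (b : ℝ) ^ 12) := by linarith
      _ ≤ b * (1 / (b : ℝ) ^ 12) := by gcongr; exact h.R_le
      _ = 1 / (b : ℝ) ^ 11 := by field_simp
      _ ≤ _ := one_div_pow_le_one_div_pow_of_le (by linarith) (by norm_num)
  · rw [if_neg hr, sub_zero]
    exact (h4 r hr).trans h12

/-- Selected grid points are far apart. -/
lemma le_abs_grid_sub {pass : ℕ → Prop} {G cnt : ℕ} {js : ℕ → ℕ} (hb : 0 < (b : ℝ))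
    (hsel : Selected pass (b ^ 14) R G cnt js) {i i' : ℕ} (hi : i < cnt) (hi' : i' < cnt)
    (hne : i ≠ i') : 1 / (b : ℝ) ^ 3 ≤ |(js i : ℝ) / (b : ℝ) ^ 17 - js i' / (b : ℝ) ^ 17| := by
  have key : ∀ i i', i < cnt → i' < cnt → i < i' →
      1 / (b : ℝ) ^ 3 ≤ (js i' : ℝ) / (b : ℝ) ^ 17 - js i / (b : ℝ) ^ 17 := by
    intro i i' _ hi' hlt
    have h1 : ((js i : ℝ)) + (b : ℝ) ^ 14 ≤ js i' := by exact_mod_cast hsel.apart i i' hlt hi'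
    rw [← sub_div, le_div_iff₀ (by positivity)]
    calc 1 / (b : ℝ) ^ 3 * (b : ℝ) ^ 17 = (b : ℝ) ^ 14 := by field_simp
      _ ≤ _ := by linarith
  rcases lt_or_gt_of_ne hne with hlt | hlt
  · rw [abs_sub_comm]; exact (key i i' hi hi' hlt).trans (le_abs_self _)
  · exact (key i' i hi' hi hlt).trans (le_abs_self _)

/-- If `R` grid points are selected, they belong to the `R` states. -/
lemma exists_perm_of_selected (h : Mixture n R d b p U V F M w) {α : ℕ → ℝ}
    (hα : ∀ x < n, 0 ≤ α x ∧ α x ≤ b) {js : ℕ → ℕ}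
    (hsel : Selected (CandOk n d b p α) (b ^ 14) R (b ^ 18 + 1) R js) :
    ∃ σ : Equiv.Perm (Fin R), ∀ i : Fin R, nsq (Finset.range d) (candSol n d b p α (js i)) ≤
      2 * (b : ℝ) ^ 34 ∧ ∀ r, |∑ I ∈ Finset.range d, U I r * candSol n d b p α (js i) I -
        if r = σ i then 1 else 0| ≤ 1 / (b : ℝ) ^ 10 := by
  have hb := h.b_ge
  have hb0 := h.b_pos
  have hjs : ∀ i : Fin R, js i ≤ b ^ 18 := fun i => Nat.lt_succ_iff.1 (hsel.lt i i.2)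
  have hst := fun i : Fin R => h.exists_state_of_candOk hα (hjs i) (hsel.ok i i.2)
  choose σ hσ using hst
  have h14 : 1 / (b : ℝ) ^ 14 ≤ 1 / 32 * (1 / (b : ℝ) ^ 3) := by
    have h4 : 1 / (b : ℝ) ^ 14 ≤ 1 / (b : ℝ) ^ 4 :=
      one_div_pow_le_one_div_pow_of_le (by linarith) (by norm_num)
    refine h4.trans ?_
    rw [one_div_mul_one_div, one_div_le_one_div (by positivity) (by positivity), pow_succ (b : ℝ) 3]
    nlinarith [pow_pos hb0 3]
  have h3 : 0 < 1 / (b : ℝ) ^ 3 := by positivity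
  -- Selected grid points are `b ^ (-3)` apart but only `b ^ (-14)` away from their means. So a mean
  -- belongs to one selected point and is far from the others; this gives both injectivity of `σ`
  -- and the hypothesis of `abs_coef_sub_le`, without any separation of the means being assumed.
  have hfar : ∀ i i' : Fin R, i ≠ i' →
      1 / (2 * (b : ℝ) ^ 3) ≤ |stateMean n M α (σ i') - js i / (b : ℝ) ^ 17| := by
    intro i i' hne
    have h1 := le_abs_grid_sub hb0 hsel i.2 i'.2 (fun h => hne (Fin.ext h))
    have h2 := hσ i'
    have h4 : |(js i : ℝ) / (b : ℝ) ^ 17 - js i' / (b : ℝ) ^ 17| ≤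
        |stateMean n M α (σ i') - js i / (b : ℝ) ^ 17| +
        |stateMean n M α (σ i') - js i' / (b : ℝ) ^ 17| := by
      have e : (js i : ℝ) / (b : ℝ) ^ 17 - js i' / (b : ℝ) ^ 17 =
        (stateMean n M α (σ i') - js i' / (b : ℝ) ^ 17) -
        (stateMean n M α (σ i') - js i / (b : ℝ) ^ 17) := by ring
      rw [e, add_comm]
      exact abs_sub _ _
    have h5 : 1 / (2 * (b : ℝ) ^ 3) = 1 / 2 * (1 / (b : ℝ) ^ 3) := by
      rw [one_div_mul_one_div]
    rw [h5]; linarith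
  have hinj : Function.Injective σ := by
    intro i i' heq
    by_contra hne
    have h1 := hfar i i' hne
    rw [← heq] at h1
    have h5 : 1 / (2 * (b : ℝ) ^ 3) = 1 / 2 * (1 / (b : ℝ) ^ 3) := by
      rw [one_div_mul_one_div]
    have := hσ i
    linarith
  have hbij : Function.Bijective σ := Finite.injective_iff_bijective.1 hinj
  refine ⟨Equiv.ofBijective σ hbij, fun i =>
    ⟨(h.coef_of_candOk hα (hjs i) (hsel.ok i i.2)).1, fun r => ?_⟩⟩
  refine h.abs_coef_sub_le hα (hjs i) (hsel.ok i i.2) (fun r hr => ?_) r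
  obtain ⟨i', rfl⟩ := hbij.2 r
  exact hfar i i' fun h => hr (by rw [h]; rfl)

/-- If the means are distinct for different states, `R` grid points are selected. -/
lemma selected_card_of_separated (h : Mixture n R d b p U V F M w) {α : ℕ → ℝ}
    (hα : ∀ x < n, 0 ≤ α x ∧ α x ≤ b)
    (hsep : ∀ r s, r ≠ s → 1 / (b : ℝ) ^ 2 ≤ |stateMean n M α r - stateMean n M α s|)
    {cnt : ℕ} {js : ℕ → ℕ}
    (hsel : Selected (CandOk n d b p α) (b ^ 14) R (b ^ 18 + 1) cnt js) : cnt = R := by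
  have hb := h.b_ge
  have hb0 := h.b_pos
  by_contra hcnt
  -- The grid point just below the mean of a state; it passes the test by `candOk_of_close`.
  have hex : ∀ s : Fin R, ∃ j : ℕ, j ≤ b ^ 18 ∧
      |stateMean n M α s - j / (b : ℝ) ^ 17| ≤ 1 / (b : ℝ) ^ 17 := by
    intro s
    have h1 := h.stateMean_mem hα s
    refine ⟨⌊stateMean n M α s * (b : ℝ) ^ 17⌋₊, ?_, ?_⟩
    · have : ⌊stateMean n M α s * (b : ℝ) ^ 17⌋₊ ≤ ⌊((b ^ 18 : ℕ) : ℝ)⌋₊ := by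
        refine Nat.floor_le_floor ?_
        push_cast
        calc _ ≤ (b : ℝ) * (b : ℝ) ^ 17 := mul_le_mul_of_nonneg_right h1.2 (by positivity)
          _ = _ := by ring
      simpa only [Nat.floor_natCast] using this
    · have h2 := Nat.floor_le (a := stateMean n M α s * (b : ℝ) ^ 17)
        (mul_nonneg h1.1 (by positivity))
      have h3 := Nat.lt_floor_add_one (stateMean n M α s * (b : ℝ) ^ 17)
      rw [abs_le]
      have h17 : 0 < (b : ℝ) ^ 17 := by positivity
      constructor
      · have : ((⌊stateMean n M α s * (b : ℝ) ^ 17⌋₊ : ℕ) : ℝ) / (b : ℝ) ^ 17 ≤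
          stateMean n M α s := by rw [div_le_iff₀ h17]; exact h2
        have : 0 < 1 / (b : ℝ) ^ 17 := by positivity
        linarith
      · rw [sub_le_iff_le_add, ← add_div, le_div_iff₀ h17]; linarith
  choose js' hle hclose using hex
  have hpick : ∀ s : Fin R, ∃ i : Fin cnt, js i ≤ js' s ∧ js' s < js i + b ^ 14 := by
    intro s
    rcases hsel.max (js' s) (Nat.lt_succ_of_le (hle s)) (h.candOk_of_close hα (hle s) s (hclose s))
      with h1 | ⟨i, hi, h1⟩
    · exact absurd h1 hcnt
    · exact ⟨⟨i, hi⟩, h1⟩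
  choose f hf using hpick
  -- With fewer than `R` selected points two states would fall into the window of one selected
  -- point, and their means would differ by at most `3 / b ^ 3 < 1 / b ^ 2`.
  obtain ⟨r, s, hrs, hfeq⟩ := Fintype.exists_ne_map_eq_of_card_lt f (by
    simpa using lt_of_le_of_ne hsel.le hcnt)
  have h1 := hf r
  have h2 := hf s
  rw [hfeq] at h1
  have h3 : |(js' r : ℝ) / (b : ℝ) ^ 17 - js' s / (b : ℝ) ^ 17| ≤ 1 / (b : ℝ) ^ 3 := by
    have h4 : |(js' r : ℝ) - js' s| ≤ (b : ℝ) ^ 14 := by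
      have a1 : (js' r : ℝ) < js (f s) + (b : ℝ) ^ 14 := by exact_mod_cast h1.2
      have a2 : (js' s : ℝ) < js (f s) + (b : ℝ) ^ 14 := by exact_mod_cast h2.2
      have a3 : (js (f s) : ℝ) ≤ js' r := by exact_mod_cast h1.1
      have a4 : (js (f s) : ℝ) ≤ js' s := by exact_mod_cast h2.1
      rw [abs_le]; constructor <;> linarith
    rw [← sub_div, abs_div, abs_of_pos (a := (b : ℝ) ^ 17) (by positivity),
      div_le_div_iff₀ (by positivity) (by positivity)]
    calc |(js' r : ℝ) - js' s| * (b : ℝ) ^ 3 ≤ (b : ℝ) ^ 14 * (b : ℝ) ^ 3 := by gcongr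
      _ = _ := by ring
  have h5 := hsep r s hrs
  have h6 : |stateMean n M α r - stateMean n M α s| ≤ 1 / (b : ℝ) ^ 17 + 1 / (b : ℝ) ^ 3 +
      1 / (b : ℝ) ^ 17 := by
    have e : stateMean n M α r - stateMean n M α s =
      (stateMean n M α r - js' r / (b : ℝ) ^ 17) +
      ((js' r : ℝ) / (b : ℝ) ^ 17 - js' s / (b : ℝ) ^ 17) -
      (stateMean n M α s - js' s / (b : ℝ) ^ 17) := by ring
    rw [e]
    refine (abs_sub _ _).trans (add_le_add ((abs_add_le _ _).trans (add_le_add (hclose r) h3))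
      (hclose s))
  have h17 : 1 / (b : ℝ) ^ 17 ≤ 1 / (b : ℝ) ^ 3 :=
    one_div_pow_le_one_div_pow_of_le (by linarith) (by norm_num)
  have h7 : 3 * (1 / (b : ℝ) ^ 3) < 1 / (b : ℝ) ^ 2 := by
    rw [mul_one_div, div_lt_div_iff₀ (by positivity) (by positivity)]
    have : 0 < (b : ℝ) ^ 2 := by positivity
    rw [pow_succ (b : ℝ) 2]; nlinarith
  linarith

/-- Extraction of one factor of an approximate mixture. -/
lemma abs_extract_sub_le (h : Mixture n R d b p U V F M w) {φ Q : ℕ → ℝ} {s : Fin R}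
    {G : Fin R → ℝ} (hφ : nsq (Finset.range d) φ ≤ 2 * (b : ℝ) ^ 34)
    (hc : ∀ r, |∑ I ∈ Finset.range d, U I r * φ I - if r = s then 1 else 0| ≤ 1 / (b : ℝ) ^ 10)
    (hG0 : ∀ r, 0 ≤ G r) (hG1 : ∀ r, G r ≤ 1)
    (hQ : ∀ I < d, |Q I - ∑ r, U I r * G r| ≤ 1 / (b : ℝ) ^ 36) :
    |∑ I ∈ Finset.range d, Q I * φ I - G s| ≤ 1 / (b : ℝ) ^ 8 := by
  have hb := h.b_ge
  have hb0 := h.b_pos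
  have h1 : |∑ I ∈ Finset.range d, (Q I - ∑ r, U I r * G r) * φ I| ≤ 1 / (b : ℝ) ^ 18 := by
    refine abs_le_of_sq_le_div hb (c := 2) 18 1 (by norm_num) ?_
    refine (sq_sum_mul_le (fun I hI => hQ I (Finset.mem_range.1 hI)) hφ).trans ?_
    rw [Finset.card_range]
    calc (d : ℝ) * (1 / (b : ℝ) ^ 36) ^ 2 * (2 * (b : ℝ) ^ 34) ≤
        b * (1 / (b : ℝ) ^ 36) ^ 2 * (2 * (b : ℝ) ^ 34) := by gcongr; exact h.d_le_b
      _ = _ := by field_simp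
  have h2 : |∑ r, G r * (∑ I ∈ Finset.range d, U I r * φ I) -
      ∑ r, G r * (if r = s then 1 else 0)| ≤ 1 / (b : ℝ) ^ 9 := by
    refine (abs_sum_mul_sub_le (C := 1) (fun r _ => by
      rw [abs_of_nonneg (hG0 r)]; exact hG1 r) (fun r _ => hc r) zero_le_one).trans ?_
    rw [Finset.card_univ, Fintype.card_fin]
    calc (R : ℝ) * (1 * (1 / (b : ℝ) ^ 10)) ≤ b * (1 * (1 / (b : ℝ) ^ 10)) := by
          have h1 : (R : ℝ) ≤ b := by linarith [h.R_le]
          exact mul_le_mul_of_nonneg_right h1 (by positivity)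
      _ = _ := by field_simp
  -- Two errors: that of `Q`, of size `b ^ (-36)` against `‖φ‖² ≤ 2 b ^ 34`, and that of the
  -- coefficients of `φ` against the unit vector of `s`.
  have e : ∑ I ∈ Finset.range d, Q I * φ I - G s =
      ∑ I ∈ Finset.range d, (Q I - ∑ r, U I r * G r) * φ I +
      (∑ r, G r * (∑ I ∈ Finset.range d, U I r * φ I) - ∑ r, G r * (if r = s then 1 else 0)) := by
    have e1 : ∑ r, G r * (if r = s then (1 : ℝ) else 0) = G s := by simp
    have e2 : ∑ r, G r * (∑ I ∈ Finset.range d, U I r * φ I) =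
        ∑ I ∈ Finset.range d, (∑ r, U I r * G r) * φ I := by
      simp only [Finset.mul_sum, Finset.sum_mul]
      rw [Finset.sum_comm]
      exact Finset.sum_congr rfl fun I _ => Finset.sum_congr rfl fun r _ => by ring
    rw [e1, e2]
    simp only [sub_mul, Finset.sum_sub_distrib]; ring
  rw [e]
  refine (abs_add_le _ _).trans ((add_le_add h1 h2).trans ?_)
  have h18 : 1 / (b : ℝ) ^ 18 ≤ 1 / (b : ℝ) ^ 9 :=
    one_div_pow_le_one_div_pow_of_le (by linarith) (by norm_num)
  calc 1 / (b : ℝ) ^ 18 + 1 / (b : ℝ) ^ 9 ≤ 2 / (b : ℝ) ^ (8 + 1) := by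
        have : 2 / (b : ℝ) ^ (8 + 1) = 1 / (b : ℝ) ^ 9 + 1 / (b : ℝ) ^ 9 := by ring
        linarith
    _ ≤ _ := const_div_pow_le hb 8 1 (by norm_num)

end Mixture

/-! ### Accuracy of the estimates -/

open scoped Matrix.Norms.Frobenius in
lemma frobNorm_sq {m n : ℕ} (A : Matrix (Fin m) (Fin n) ℝ) :
    frobNorm A ^ 2 = ∑ i, ∑ j, A i j ^ 2 := by
  have h0 : 0 ≤ ∑ i, ∑ j, ‖A i j‖ ^ (2 : ℝ) :=
    Finset.sum_nonneg fun _ _ => Finset.sum_nonneg fun _ _ => by positivity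
  rw [frobNorm, Matrix.frobenius_norm_def, ← Real.sqrt_eq_rpow, Real.sq_sqrt h0]
  refine Finset.sum_congr rfl fun i _ => Finset.sum_congr rfl fun j _ => ?_
  rw [Real.rpow_two, Real.norm_eq_abs, sq_abs]

lemma frobNorm_le {m n : ℕ} {A : Matrix (Fin m) (Fin n) ℝ} {η : ℝ} (hη : 0 ≤ η)
    (h : ∑ i, ∑ j, A i j ^ 2 ≤ η ^ 2) : frobNorm A ≤ η := by
  rw [← frobNorm_sq] at h
  exact (abs_le_of_sq_le_sq' h hη).2

/-- Extension of a vector by zero. -/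
def extZero {R : ℕ} (f : Fin R → ℝ) (i : ℕ) : ℝ := if h : i < R then f ⟨i, h⟩ else 0

lemma extZero_fin {R : ℕ} (f : Fin R → ℝ) (i : Fin R) : extZero f i = f i := by simp [extZero]

lemma RowRep.mono {ι : Type*} {R : ℕ} {s : Finset ι} {B : ι → Fin R → ℝ}
    {U : Submodule ℝ (Fin R → ℝ)} {C C' : ℝ} (h : RowRep s B U C) (hC : C ≤ C') :
    RowRep s B U C' := fun u hu => by
  obtain ⟨Φ, h1, h2⟩ := h u hu
  exact ⟨Φ, h1, h2.trans (mul_le_mul_of_nonneg_right hC (nsq_nonneg _ _))⟩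

namespace Mixture
variable {n R d b : ℕ} {p : ℕ → ℝ} {U V F M : ℕ → Fin R → ℝ} {w : Fin R → ℝ}

/-- The search finds the states. -/
lemma exists_perm_of_searchResult (h : Mixture n R d b p U V F M w) (hn : 2 ≤ n) (hR : 0 < R)
    (hgap : ∀ r s, r ≠ s → ∃ x < n, 1 / (b : ℝ) ≤ |M x r - M x s|)
    (hwt : ((n * (R * R + 1) + 1) * (R * R) + 1) * (R * R + 1) ≤ b) {Φ : ℕ → ℕ → ℝ}
    (hs : SearchResult n R d b (R * R + 1) ((n * (R * R + 1) + 1) ^ (R * R)) p Φ) :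
    ∃ σ : Equiv.Perm (Fin R), ∀ i : Fin R, nsq (Finset.range d) (Φ i) ≤ 2 * (b : ℝ) ^ 34 ∧
      ∀ r, |∑ I ∈ Finset.range d, U I r * Φ i I - if r = σ i then 1 else 0| ≤ 1 / (b : ℝ) ^ 10 := by
  have hα : ∀ e < (n * (R * R + 1) + 1) ^ (R * R), ∀ x < n,
      0 ≤ (weightVec n (R * R + 1) (e + 1) x : ℝ) ∧
      (weightVec n (R * R + 1) (e + 1) x : ℝ) ≤ b := by
    intro e he x _
    refine ⟨by positivity, ?_⟩
    have := weightVec_le_of_lt (n := n) (L := R * R + 1) (k := R * R) (by nlinarith) he x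
    exact_mod_cast this.trans hwt
  -- Any vector of weights with `R` selected grid points yields the states. If all vectors had
  -- failed, so would a separating one, which contradicts `selected_card_of_separated`.
  rcases hs with ⟨e, he, js, hsel, hΦ⟩ | hfail
  · obtain ⟨σ, hσ⟩ := h.exists_perm_of_selected (hα e he) hsel
    refine ⟨σ, fun i => ⟨?_, fun r => ?_⟩⟩
    · rw [nsq_congr fun I hI => hΦ i i.2 I (Finset.mem_range.1 hI)]
      exact (hσ i).1
    · rw [Finset.sum_congr rfl fun I hI => by rw [hΦ i i.2 I (Finset.mem_range.1 hI)]]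
      exact (hσ i).2 r
  · exfalso
    obtain ⟨e, he, hsep⟩ := exists_separating_weightVec hR M hgap (by omega)
    obtain ⟨cnt, hcnt, js, hsel⟩ := hfail e he
    have hb := h.b_ge
    have hb0 := h.b_pos
    refine hcnt.ne (h.selected_card_of_separated (hα e he) (fun r s hrs => ?_) hsel)
    refine le_trans ?_ (hsep r s hrs)
    rw [div_div, one_div_le_one_div (by positivity) (by positivity), sq]
    gcongr; linarith

/-- The estimates are accurate. -/
lemma output_approx (h : Mixture n R d b p U V F M w) {P : Fin R → Fin R → ℝ}
    (hP0 : ∀ s r, 0 ≤ P s r) (hP1 : ∀ r, ∑ s, P s r = 1)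
    (hV : ∀ J r, V J r = ∑ s, P s r * F J s) {Φ : ℕ → ℕ → ℝ} {σ : Equiv.Perm (Fin R)}
    (hσ : ∀ i : Fin R, nsq (Finset.range d) (Φ i) ≤ 2 * (b : ℝ) ^ 34 ∧
      ∀ r, |∑ I ∈ Finset.range d, U I r * Φ i I - if r = σ i then 1 else 0| ≤ 1 / (b : ℝ) ^ 10) :
    (∀ x < n, ∀ i : Fin R, |estObs n d p Φ x i - M x (σ i)| ≤ 1 / (b : ℝ) ^ 8) ∧
    (∀ i : Fin R, ∑ r : Fin R,
      (estCoef n R d b p Φ (fun J => estLate n d p Φ J i) r - P (σ r) (σ i)) ^ 2 ≤ 1 / (b : ℝ) ^ 5) ∧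
    ∑ r : Fin R, (estCoef n R d b p Φ (fun J => ∑ I ∈ Finset.range d, earlyMarg n d p J I) r -
      w (σ r)) ^ 2 ≤ 1 / (b : ℝ) ^ 5 := by
  have hb := h.b_ge
  have hb0 := h.b_pos
  have hobs : ∀ x < n, ∀ i : Fin R, |estObs n d p Φ x i - M x (σ i)| ≤ 1 / (b : ℝ) ^ 8 :=
    fun x hx i => h.abs_extract_sub_le (hσ i).1 (hσ i).2 (fun r => h.M_nonneg x r)
      (fun r => h.M_le_one hx r) fun I hI => h.obsMarg_approx hI hx
  have hearly : ∀ J < d, ∀ i : Fin R, |estEarly n d p Φ J i - F J (σ i)| ≤ 1 / (b : ℝ) ^ 8 :=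
    fun J hJ i => h.abs_extract_sub_le (hσ i).1 (hσ i).2 (fun r => h.F_nonneg J r)
      (fun r => h.F_le_one hJ r) fun I hI => h.early I hI J hJ
  have hlate : ∀ J < d, ∀ i : Fin R, |estLate n d p Φ J i - V J (σ i)| ≤ 1 / (b : ℝ) ^ 8 :=
    fun J hJ i => h.abs_extract_sub_le (hσ i).1 (hσ i).2 (fun r => h.V_nonneg J r)
      (fun r => h.V_le_one hJ r) fun I hI => h.lateMarg_approx hI hJ
  -- Both final systems have the matrix `F`: the columns of `P` solve `F y = V` column by column,
  -- and `w` solves it for the law of a block. In each case the solution is a probability vector.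
  have hsolve : ∀ (g : ℕ → ℝ) (y : Fin R → ℝ), (∀ r, 0 ≤ y r) → ∑ r, y r = 1 →
      (∀ J < d, |g J - ∑ s, F J s * y s| ≤ 1 / (b : ℝ) ^ 8) →
      ∑ r : Fin R, (estCoef n R d b p Φ g r - y (σ r)) ^ 2 ≤ 1 / (b : ℝ) ^ 5 := by
    intro g y hy0 hy1 hg
    have hR : (R : ℝ) ≤ b := by linarith [h.R_le]
    have hd : (d : ℝ) ≤ b := by linarith [h.d_le]
    have hsum : ∀ J (z : ℕ → ℝ), ∑ i ∈ Finset.range R, extZero (fun i => F J (σ i)) i * z i =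
        ∑ s, F J s * z (σ.symm s) := by
      intro J z
      rw [Finset.sum_range, ← Equiv.sum_comp σ fun s => F J s * z (σ.symm s)]
      simp only [extZero_fin, Equiv.symm_apply_apply]
    have key := nsq_lwIter_sub_le hb hd hR (A := estEarly n d p Φ)
      (A' := fun J => extZero fun i => F J (σ i)) (h := g) (y := extZero fun i => y (σ i))
      (fun J hJ i hi => by
        have := hearly J hJ ⟨i, hi⟩
        simpa [extZero, hi] using this)
      (fun J hJ i hi => by
        simpa [extZero, hi, abs_of_nonneg (h.F_nonneg J _)] using h.F_le_one hJ _)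
      (fun z => by
        simp only [hsum]
        refine le_trans (le_of_eq ?_) (h.lowF fun s => z (σ.symm s))
        simp only [nsq]
        rw [Finset.sum_range, ← Equiv.sum_comp σ fun s => z (σ.symm s) ^ 2]
        simp only [Equiv.symm_apply_apply])
      (fun i hi => by simpa [extZero, hi] using hy0 _)
      (by
        rw [Finset.sum_range]
        simp only [extZero_fin]
        rw [Equiv.sum_comp σ y, hy1])
      (fun J hJ => by
        rw [hsum]
        have : ∀ s, extZero (fun i => y (σ i)) (σ.symm s) = y s := fun s => by
          rw [extZero_fin, Equiv.apply_symm_apply]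
        simp only [this]
        exact hg J hJ)
    rw [nsq, Finset.sum_range] at key
    simpa only [estCoef, extZero_fin] using key
  refine ⟨hobs, fun i => ?_, ?_⟩
  · refine hsolve _ (fun s => P s (σ i)) (fun s => hP0 s _) (hP1 _) fun J hJ => ?_
    have e : ∑ s, F J s * P s (σ i) = V J (σ i) := by
      rw [hV]; exact Finset.sum_congr rfl fun s _ => mul_comm _ _
    rw [e]
    exact hlate J hJ i
  · refine hsolve _ w h.w_nonneg h.w_sum fun J hJ => ?_
    have e : ∑ s, F J s * w s = ∑ I ∈ Finset.range d, ∑ s, U I s * F J s := by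
      rw [Finset.sum_comm]
      refine Finset.sum_congr rfl fun s _ => ?_
      rw [← Finset.sum_mul, h.U_sum, mul_comm]
    rw [e]
    refine (abs_sum_sub_le fun I hI => h.early I (Finset.mem_range.1 hI) J hJ).trans ?_
    rw [Finset.card_range]
    calc (d : ℝ) * (1 / (b : ℝ) ^ 36) ≤ b * (1 / (b : ℝ) ^ 36) := by gcongr; exact h.d_le_b
      _ = 1 / (b : ℝ) ^ 35 := by field_simp
      _ ≤ _ := one_div_pow_le_one_div_pow_of_le (by linarith) (by norm_num)

end Mixture

/-! ### The hidden Markov model as a mixture -/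

namespace HMM
variable {n R : ℕ} (H : HMM n R)

lemma exists_blockCode_eq {m c : ℕ} (hc : c < n ^ m) : ∃ x : Fin m → Fin n, blockCode x = c := by
  refine ⟨finFunctionFinEquiv.symm ⟨c, hc⟩, ?_⟩
  rw [blockCode, ← finFunctionFinEquiv_apply, Equiv.apply_symm_apply]

/-- The law of the observations is a mixture. -/
lemma mixture {q b : ℕ} {X : ℝ} {k : ℕ} {p : ℕ → ℝ}
    (hk : 1 ≤ k) (hR : 1 ≤ R) (hn : 1 ≤ n) (hX : 2 ≤ X) (hRX : (R : ℝ) ≤ X) (hnX : (n : ℝ) ≤ X)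
    (hMk : ColDual (Finset.range n) H.obs k X)
    (hP : ∀ u : Fin R → ℝ, nsq Finset.univ u ≤ X * nsq Finset.univ (fun r => ∑ s, H.P r s * u s))
    (hw0 : ∀ r, 0 < H.w r) (hwX : ∀ r, 1 ≤ X * H.w r ^ 2) (hq : R ≤ 1 + (q + 1) * (k - 1))
    (hb : 32 ≤ b) (hd : n ^ (q + 1) + 1 ≤ b) (hRb : R + 1 ≤ b) (hXb : X ^ (20 * (q + 1) + 3) ≤ b)
    (hp : ∀ x : Fin (2 * q + 2 + 1) → Fin n,
      |p (blockCode x) - H.obsProb x| ≤ 1 / (b : ℝ) ^ 37) :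
    Mixture n R (n ^ (q + 1)) b p (pastLaw n H.P H.obs H.w (q + 1))
      (fun J r => ∑ s, H.P s r * futLaw n H.P H.obs (q + 1) J s)
      (futLaw n H.P H.obs (q + 1)) H.obs H.w := by
  set d := n ^ (q + 1) with hdd
  have hd0 : 0 < d := Nat.pow_pos hn
  have hb' : (32 : ℝ) ≤ b := by exact_mod_cast hb
  have hb0 : (0 : ℝ) < b := by linarith
  have hnb : n ≤ b := by
    have : n ≤ d := Nat.le_self_pow (by omega) n
    omega
  have hX1 : (1 : ℝ) ≤ X := by linarith
  have hw1 : ∀ r, H.w r ≤ 1 := fun r =>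
    H.w_sum ▸ Finset.single_le_sum (fun s _ => H.w_nonneg s) (Finset.mem_univ r)
  have hrepF := rowRep_futLaw hk hR hX hRX hnX H.obs_nonneg H.sum_obs hMk H.P_sum hP hq
  have hrepU := rowRep_pastLaw hk hR hX hRX hnX H.obs_nonneg H.sum_obs hMk hP
    H.stationary' hw0 hw1 hwX hq
  have hlowF := fun z => RowRep.nsq_le (by positivity) hrepF z
  have hlowV := fun z => nsq_le_next (by linarith) hlowF hP z
  -- The window is cut before the middle observation, `2q + 3 = (q + 1) + (q + 2)`. Reading the
  -- lowest digit of `c` as the middle observation gives the three-fold mixture; summing out its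
  -- highest digit gives the two-fold one with factor `F`.
  have hmix : ∀ I < d, ∀ c, c < n ^ (q + 2) →
      |p (I + d * c) - ∑ s, pastLaw n H.P H.obs H.w (q + 1) I s *
        futLaw n H.P H.obs (q + 2) c s| ≤ 1 / (b : ℝ) ^ 37 := by
    intro I hI c hc
    have hlt : I + d * c < n ^ (2 * q + 2 + 1) := by
      calc I + d * c < d + d * c := Nat.add_lt_add_right hI _
        _ = d * (c + 1) := by ring
        _ ≤ d * n ^ (q + 2) := Nat.mul_le_mul_left _ hc
        _ = _ := by rw [hdd, ← pow_add]; congr 1; ring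
    obtain ⟨x, hx⟩ := exists_blockCode_eq hlt
    have h1 := hp x
    rw [hx, H.obsProb_eq, hx, show 2 * q + 2 + 1 = (q + 1) + (q + 2) by ring, sum_mul_futLaw,
      ← hdd, Nat.add_mul_mod_self_left, Nat.mod_eq_of_lt hI, Nat.add_mul_div_left _ _ hd0,
      Nat.div_eq_of_lt hI, zero_add] at h1
    exact h1
  refine ⟨hb', by exact_mod_cast hd, by exact_mod_cast hnb, by exact_mod_cast hRb,
    pastLaw_nonneg H.P_nonneg H.obs_nonneg H.w_nonneg _, fun J r => Finset.sum_nonneg fun s _ =>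
      mul_nonneg (H.P_nonneg _ _) (futLaw_nonneg H.P_nonneg H.obs_nonneg _ _ _),
    futLaw_nonneg H.P_nonneg H.obs_nonneg _, H.obs_nonneg, H.w_nonneg,
    sum_pastLaw H.stationary' H.sum_obs _, fun r => ?_, sum_futLaw H.P_sum H.sum_obs _, H.sum_obs,
    H.w_sum, fun I hI J hJ x hx => ?_, fun I hI J hJ => ?_, hrepU.mono hXb, fun z => ?_, fun z => ?_⟩
  · rw [Finset.sum_comm]
    simp only [← Finset.mul_sum]
    rw [Finset.sum_congr rfl fun s _ => by rw [sum_futLaw H.P_sum H.sum_obs]]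
    simp only [mul_one, H.P_sum]
  · have hlt : x + n * J < n ^ (q + 2) := by
      calc x + n * J < n + n * J := Nat.add_lt_add_right hx _
        _ = n * (J + 1) := by ring
        _ ≤ n * d := Nat.mul_le_mul_left _ hJ
        _ = _ := by rw [hdd]; ring
    refine le_of_eq_of_le ?_ (hmix I hI _ hlt)
    congr 2
    refine Finset.sum_congr rfl fun s _ => ?_
    rw [show q + 2 = (q + 1) + 1 by ring, futLaw, Nat.add_mul_mod_self_left, Nat.mod_eq_of_lt hx,
      Nat.add_mul_div_left _ _ hn, Nat.div_eq_of_lt hx, zero_add]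
    ring
  · have e : ∑ s, pastLaw n H.P H.obs H.w (q + 1) I s * futLaw n H.P H.obs (q + 1) J s =
        ∑ y ∈ Finset.range n, ∑ s, pastLaw n H.P H.obs H.w (q + 1) I s *
          futLaw n H.P H.obs (q + 2) (J + d * y) s := by
      rw [Finset.sum_comm]
      refine Finset.sum_congr rfl fun s _ => ?_
      rw [← Finset.mul_sum, sum_futLaw_last H.P_sum H.sum_obs hJ]
    rw [e, earlyMarg]
    refine (abs_sum_sub_le fun y hy => hmix I hI (J + d * y) ?_).trans ?_
    · calc J + d * y < d + d * y := Nat.add_lt_add_right hJ _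
        _ = d * (y + 1) := by ring
        _ ≤ d * n := Nat.mul_le_mul_left _ (Finset.mem_range.1 hy)
        _ = _ := by rw [hdd]; ring
    · rw [Finset.card_range]
      calc (n : ℝ) * (1 / (b : ℝ) ^ 37) ≤ b * (1 / (b : ℝ) ^ 37) := by gcongr
        _ = _ := by field_simp
  · refine (hlowV z).trans (mul_le_mul_of_nonneg_right ?_ (nsq_nonneg _ _))
    rw [← pow_succ']
    exact (pow_le_pow_right₀ hX1 (by omega)).trans hXb
  · refine (hlowF z).trans (mul_le_mul_of_nonneg_right ?_ (nsq_nonneg _ _))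
    exact (pow_le_pow_right₀ hX1 (by omega)).trans hXb

/-- The output of the algorithm approximates the model. -/
lemma approx_of_output {q b : ℕ} {p : ℕ → ℝ} {Φ : ℕ → ℕ → ℝ} {η : ℝ} {s : RealRAM.Mem}
    (h : Mixture n R (n ^ (q + 1)) b p (pastLaw n H.P H.obs H.w (q + 1))
      (fun J r => ∑ s, H.P s r * futLaw n H.P H.obs (q + 1) J s)
      (futLaw n H.P H.obs (q + 1)) H.obs H.w) (hn : 2 ≤ n) (hR : 0 < R)
    (hgap : ∀ r s, r ≠ s → ∃ x < n, 1 / (b : ℝ) ≤ |H.obs x r - H.obs x s|)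
    (hwt : ((n * (R * R + 1) + 1) * (R * R) + 1) * (R * R + 1) ≤ b)
    (hs : SearchResult n R (n ^ (q + 1)) b (R * R + 1) ((n * (R * R + 1) + 1) ^ (R * R)) p Φ)
    (ho : RealRAM.Output n R (n ^ (q + 1)) b p Φ s) (hη : 1 / (b : ℝ) ≤ η) :
    H.Approx η (s.matrix 1 R R) (s.matrix 2 n R) (s.vector 3 R) := by
  have hb := h.b_ge
  have hb0 := h.b_pos
  have hRb : R ≤ b := by
    have : (R : ℝ) ≤ b := by linarith [h.R_le]
    exact_mod_cast this
  have hb1 : 0 < 1 / (b : ℝ) := by positivity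
  have hη2 : 1 / (b : ℝ) ^ 4 ≤ η ^ 2 := by
    calc 1 / (b : ℝ) ^ 4 ≤ 1 / (b : ℝ) ^ 2 :=
          one_div_pow_le_one_div_pow_of_le (by linarith) (by norm_num)
      _ = (1 / (b : ℝ)) ^ 2 := by rw [div_pow, one_pow]
      _ ≤ _ := by gcongr
  obtain ⟨σ, hσ⟩ := h.exists_perm_of_searchResult hn hR hgap hwt hs
  obtain ⟨h1, h2, h3⟩ := h.output_approx (P := H.P) H.P_nonneg H.P_sum (fun _ _ => rfl) hσ
  refine ⟨σ, frobNorm_le (hb1.le.trans hη) ?_, frobNorm_le (hb1.le.trans hη) ?_, fun r => ?_⟩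
  · refine le_trans ?_ hη2
    have : ∀ (x : Fin n) (i : Fin R),
        (H.M.submatrix id σ - s.matrix 2 n R) x i ^ 2 ≤ (1 / (b : ℝ) ^ 8) ^ 2 := by
      intro x i
      have h4 := h1 x x.2 i
      rw [H.obs_fin, ← ho.obs x x.2 i i.2] at h4
      rw [sq_le_sq, abs_of_pos (a := 1 / (b : ℝ) ^ 8) (by positivity)]
      rwa [abs_sub_comm] at h4
    calc _ ≤ ∑ _x : Fin n, ∑ _i : Fin R, (1 / (b : ℝ) ^ 8) ^ 2 :=
          Finset.sum_le_sum fun x _ => Finset.sum_le_sum fun i _ => this x i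
      _ = n * (R * (1 / (b : ℝ) ^ 8) ^ 2) := by simp
      _ ≤ b * (b * (1 / (b : ℝ) ^ 8) ^ 2) := by
          gcongr
          exact h.n_le_b
      _ = 1 / (b : ℝ) ^ 14 := by field_simp
      _ ≤ _ := one_div_pow_le_one_div_pow_of_le (by linarith) (by norm_num)
  · refine le_trans ?_ hη2
    rw [Finset.sum_comm]
    have : ∀ i : Fin R, ∑ r : Fin R, (H.P.submatrix σ σ - s.matrix 1 R R) r i ^ 2 ≤
        1 / (b : ℝ) ^ 5 := by
      intro i
      refine le_of_eq_of_le (Finset.sum_congr rfl fun r _ => ?_) (h2 i)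
      rw [← ho.trans r r.2 i i.2]
      show (H.P (σ r) (σ i) - s.real 1 (r * R + i)) ^ 2 = _
      ring
    calc _ ≤ ∑ _i : Fin R, 1 / (b : ℝ) ^ 5 := Finset.sum_le_sum fun i _ => this i
      _ = R * (1 / (b : ℝ) ^ 5) := by simp
      _ ≤ b * (1 / (b : ℝ) ^ 5) := by gcongr
      _ = _ := by field_simp
  · have h4 := (Finset.single_le_sum (f := fun r : Fin R =>
      (estCoef n R (n ^ (q + 1)) b p Φ (fun J => ∑ I ∈ Finset.range (n ^ (q + 1)),
        earlyMarg n (n ^ (q + 1)) p J I) r - H.w (σ r)) ^ 2) (fun r _ => sq_nonneg _)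
        (Finset.mem_univ r)).trans h3
    rw [← ho.stat r r.2] at h4
    have h5 := abs_le_of_sq_le_div hb (c := 1) 2 1 (by norm_num) h4
    rw [abs_sub_comm] at h5
    refine lt_of_le_of_lt h5 (lt_of_lt_of_le ?_ hη)
    rw [one_div_lt_one_div (by positivity) hb0, sq]
    nlinarith

end HMM

/-! ### A priori bounds on the parameters -/

namespace HMM
variable {n R : ℕ}

lemma states_pos (H : HMM n R) : 0 < R := by
  rcases Nat.eq_zero_or_pos R with rfl | h
  · simpa using H.w_sum
  · exact h

lemma observations_pos (H : HMM n R) : 0 < n := by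
  rcases Nat.eq_zero_or_pos n with rfl | h
  · simpa using H.M_sum ⟨0, H.states_pos⟩
  · exact h

variable (H : HMM n R)

lemma w_le_one (r : Fin R) : H.w r ≤ 1 :=
  H.w_sum ▸ Finset.single_le_sum (fun s _ => H.w_nonneg s) (Finset.mem_univ r)

lemma obs_le_one (x : Fin n) (r : Fin R) : H.M x r ≤ 1 :=
  H.M_sum r ▸ Finset.single_le_sum (fun s _ => H.M_nonneg s r) (Finset.mem_univ x)

lemma card_mul_le_one {γ : ℝ} (h : ∀ r, γ < H.w r) : (R : ℝ) * γ ≤ 1 := by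
  calc (R : ℝ) * γ = ∑ _r : Fin R, γ := by simp
    _ ≤ ∑ r, H.w r := Finset.sum_le_sum fun r _ => (h r).le
    _ = 1 := H.w_sum

/-- Dual vectors of the columns of a stochastic matrix are not short. -/
lemma one_le_of_colDual {k : ℕ} (hk : 1 ≤ k) {T : ℝ} (h : ColDual (Finset.range n) H.obs k T) :
    1 ≤ T := by
  obtain ⟨y, hy, hT⟩ := h {⟨0, H.states_pos⟩} (by simpa using hk) _ (Finset.mem_singleton_self _)
  have h1 := hy _ (Finset.mem_singleton_self _)
  rw [if_pos rfl] at h1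
  have h2 := Finset.sum_mul_sq_le_sq_mul_sq (Finset.range n)
    (fun x => H.obs x ⟨0, H.states_pos⟩) y
  rw [h1, one_pow] at h2
  have h3 : ∑ x ∈ Finset.range n, H.obs x ⟨0, H.states_pos⟩ ^ 2 ≤ 1 := by
    refine (Finset.sum_le_sum fun x hx => ?_).trans (H.sum_obs ⟨0, H.states_pos⟩).le
    have h0 := H.obs_nonneg x ⟨0, H.states_pos⟩
    have h4 := H.obs_le_one ⟨x, Finset.mem_range.1 hx⟩ ⟨0, H.states_pos⟩
    rw [← H.obs_fin] at h4
    exact pow_le_of_le_one h0 h4 (by norm_num)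
  have h5 : (0 : ℝ) ≤ ∑ x ∈ Finset.range n, y x ^ 2 := nsq_nonneg _ _
  have h6 : ∑ x ∈ Finset.range n, y x ^ 2 ≤ T := hT
  nlinarith

/-- The observation laws of two states differ at some observation. -/
lemma exists_gap {k b : ℕ} (hk : 2 ≤ k) {T : ℝ} (h : ColDual (Finset.range n) H.obs k T)
    (hb : n * T < (b : ℝ) ^ 2) {r s : Fin R} (hrs : r ≠ s) :
    ∃ x < n, 1 / (b : ℝ) ≤ |H.obs x r - H.obs x s| := by
  by_contra! hcon
  -- A vector dual to `r` within the pair has inner product `1` with the difference of the two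
  -- columns, so by Cauchy-Schwarz the difference is not small.
  obtain ⟨y, hy, hT⟩ := h {r, s} (by rw [Finset.card_pair hrs]; exact hk) r (by simp)
  have h1 := hy r (by simp)
  have h2 := hy s (by simp)
  rw [if_pos rfl] at h1
  rw [if_neg hrs.symm] at h2
  have h3 : ∑ x ∈ Finset.range n, (H.obs x r - H.obs x s) * y x = 1 := by
    simp only [sub_mul, Finset.sum_sub_distrib, h1, h2, sub_zero]
  have h4 := Finset.sum_mul_sq_le_sq_mul_sq (Finset.range n) (fun x => H.obs x r - H.obs x s) y
  rw [h3, one_pow] at h4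
  have h5 : ∑ x ∈ Finset.range n, (H.obs x r - H.obs x s) ^ 2 ≤ n * (1 / (b : ℝ)) ^ 2 := by
    refine (Finset.sum_le_sum (g := fun _ => (1 / (b : ℝ)) ^ 2) fun x hx => ?_).trans (by simp)
    rw [← sq_abs]
    exact pow_le_pow_left₀ (abs_nonneg _) (hcon x (Finset.mem_range.1 hx)).le 2
  have h6 : (0 : ℝ) ≤ ∑ x ∈ Finset.range n, y x ^ 2 := nsq_nonneg _ _
  have h7 : ∑ x ∈ Finset.range n, y x ^ 2 ≤ T := hT
  have h8 : n * (1 / (b : ℝ)) ^ 2 * T < 1 := by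
    have hT1 : (0 : ℝ) ≤ n * T := mul_nonneg (by positivity) (h6.trans h7)
    have hb2 : (0 : ℝ) < (b : ℝ) ^ 2 := hT1.trans_lt hb
    calc n * (1 / (b : ℝ)) ^ 2 * T = n * T / (b : ℝ) ^ 2 := by rw [one_div, inv_pow]; field_simp
      _ < 1 := (div_lt_one hb2).2 hb
  have h9 := mul_le_mul h5 h7 h6 (by positivity)
  linarith

lemma nsq_le_of_le_singVal_trans {γ : ℝ} (hγ : 0 < γ) (h : γ ≤ singVal R H.P) (u : Fin R → ℝ) :
    nsq Finset.univ u ≤ (1 / γ) ^ 2 * nsq Finset.univ (fun r => ∑ s, H.P r s * u s) := by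
  have := nsq_le_of_le_singVal H.P (Fintype.card_fin R) hγ.le h u
  rw [one_div, inv_pow, ← div_eq_inv_mul, le_div_iff₀ (by positivity), mul_comm]
  exact this

/-- `P` fixes the nonzero vector `w`, so its smallest singular value cannot exceed `1`. -/
lemma le_one_of_le_singVal {γ : ℝ} (hγ : 0 < γ) (hw : ∀ r, 0 < H.w r) (h : γ ≤ singVal R H.P) :
    γ ≤ 1 := by
  have h1 := nsq_le_of_le_singVal H.P (Fintype.card_fin R) hγ.le h H.w
  simp only [H.stationary'] at h1
  have h2 : 0 < nsq Finset.univ H.w :=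
    Finset.sum_pos (fun r _ => pow_pos (hw r) 2) ⟨⟨0, H.states_pos⟩, Finset.mem_univ _⟩
  have h3 : γ ^ 2 ≤ 1 := by
    by_contra! h3
    nlinarith
  nlinarith

/-- The zero matrices approximate the parameters with a large error. -/
lemma approx_zero {η : ℝ} (hη : 0 < η) (h : (R : ℝ) < η * η) : H.Approx η 0 0 0 := by
  refine ⟨1, frobNorm_le hη.le ?_, frobNorm_le hη.le ?_, fun r => ?_⟩
  · rw [Finset.sum_comm, sq]
    refine le_trans ?_ h.le
    calc _ ≤ ∑ _r : Fin R, (1 : ℝ) := Finset.sum_le_sum fun r _ => ?_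
      _ = R := by simp
    refine le_trans (Finset.sum_le_sum fun x _ => ?_) (H.M_sum r).le
    simpa using pow_le_of_le_one (H.M_nonneg x r) (H.obs_le_one x r) two_ne_zero
  · rw [Finset.sum_comm, sq]
    refine le_trans ?_ h.le
    calc _ ≤ ∑ _r : Fin R, (1 : ℝ) := Finset.sum_le_sum fun r _ => ?_
      _ = R := by simp
    refine le_trans (Finset.sum_le_sum fun s _ => ?_) (H.P_sum r).le
    have : H.P s r ≤ 1 :=
      H.P_sum r ▸ Finset.single_le_sum (fun s _ => H.P_nonneg s r) (Finset.mem_univ s)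
    simpa using pow_le_of_le_one (H.P_nonneg s r) this two_ne_zero
  · have h1 : (1 : ℝ) ≤ R := by exact_mod_cast H.states_pos
    have h2 : H.w r ≤ 1 := H.w_le_one r
    simp only [Equiv.Perm.coe_one, id_eq, Pi.zero_apply, sub_zero, abs_of_nonneg (H.w_nonneg r)]
    nlinarith

end HMM

/-! ### Sample size and running time -/

/-- An integer root of the number of samples. -/
lemma exists_root_ceil_pow {D : ℕ} (hD : D ≠ 0) {θ : ℝ} (hθ : 1 ≤ θ) :
    ∃ B : ℕ, ⌈θ ^ D⌉₊ ≤ B ^ D ∧ (∀ j < B, j ^ D < ⌈θ ^ D⌉₊) ∧ θ ≤ B ∧ (B : ℝ) ≤ 2 * θ := by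
  have hθ0 : 0 ≤ θ := by linarith
  have hex : ∃ B : ℕ, ⌈θ ^ D⌉₊ ≤ B ^ D := by
    refine ⟨⌈θ⌉₊, Nat.ceil_le.2 ?_⟩
    push_cast
    exact pow_le_pow_left₀ hθ0 (Nat.le_ceil θ) D
  classical
  refine ⟨Nat.find hex, Nat.find_spec hex, fun j hj => not_le.1 (Nat.find_min hex hj), ?_, ?_⟩
  · have h1 := Nat.ceil_le.1 (Nat.find_spec hex)
    push_cast at h1
    exact le_of_pow_le_pow_left₀ hD (Nat.cast_nonneg _) h1
  · have h1 : Nat.find hex ≤ ⌈θ⌉₊ := by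
      refine Nat.find_min' hex (Nat.ceil_le.2 ?_)
      push_cast
      exact pow_le_pow_left₀ hθ0 (Nat.le_ceil θ) D
    have h2 : (Nat.find hex : ℝ) ≤ ⌈θ⌉₊ := by exact_mod_cast h1
    linarith [Nat.ceil_lt_add_one hθ0]

/-- The elementary bounds behind the running time. -/
lemma running_time_bounds {n R : ℕ} {η τ γ₁ γ₂ : ℝ} (hn : 2 ≤ n) (hR : 1 ≤ R) (hη : 0 < η)
    (hγ₁ : 0 < γ₁) (hγ₂ : 0 < γ₂) (hτ : 1 ≤ τ) (hγ₁R : R * γ₁ ≤ 1) (hγ₂1 : γ₂ ≤ 1)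
    (hηR : η * η ≤ R) :
    (2 + 1 / η) * (2 + R) * (2 + n) * (2 + τ) * (2 + 1 / (γ₁ * γ₂)) ≤
      ((n : ℝ) ^ ((R : ℝ) ^ 2 * Real.posLog (1 / (η * γ₁)))) ^ 2 * (n * τ / (γ₁ * γ₂)) ^ 10 ∧
    ((n : ℝ) * (R * R + 1) + 1) ^ (R * R) ≤
      ((n : ℝ) ^ ((R : ℝ) ^ 2 * Real.posLog (1 / (η * γ₁)))) ^ 20 * (n * τ / (γ₁ * γ₂)) ^ 3 := by
  set L := Real.posLog (1 / (η * γ₁)) with hL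
  set E := (n : ℝ) ^ ((R : ℝ) ^ 2 * L) with hE
  set Y := n * τ / (γ₁ * γ₂) with hY
  have hn2 : (2 : ℝ) ≤ n := by exact_mod_cast hn
  have hn1 : (1 : ℝ) ≤ n := by linarith
  have hn0 : (0 : ℝ) < n := by linarith
  have hR1 : (1 : ℝ) ≤ R := by exact_mod_cast hR
  have hγ₁1 : γ₁ ≤ 1 := (le_mul_of_one_le_left hγ₁.le hR1).trans hγ₁R
  have hγγ : γ₁ * γ₂ ≤ γ₁ := mul_le_of_le_one_right hγ₁.le hγ₂1
  have hγγ0 : 0 < γ₁ * γ₂ := by positivity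
  have hRγ : (R : ℝ) ≤ 1 / γ₁ := by rw [le_div_iff₀ hγ₁]; exact hγ₁R
  have hγinv : 1 / γ₁ ≤ 1 / (γ₁ * γ₂) := one_div_le_one_div_of_le hγγ0 hγγ
  have hinv1 : 1 ≤ 1 / (γ₁ * γ₂) := by linarith
  have hYe : Y = n * τ * (1 / (γ₁ * γ₂)) := by rw [hY]; ring
  have hτ0 : 0 ≤ τ := by linarith
  have hnτ : (n : ℝ) ≤ n * τ := le_mul_of_one_le_right hn0.le hτ
  have hnτ' : τ ≤ n * τ := le_mul_of_one_le_left hτ0 hn1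
  have hnτY : n * τ ≤ Y := hYe ▸ le_mul_of_one_le_right (by positivity) hinv1
  have hYn : (n : ℝ) ≤ Y := hnτ.trans hnτY
  have hYτ : τ ≤ Y := hnτ'.trans hnτY
  have hYγ : 1 / (γ₁ * γ₂) ≤ Y := hYe ▸ le_mul_of_one_le_left (by positivity) (hn1.trans hnτ)
  have hY2 : 2 ≤ Y := by linarith
  have hYR : (R : ℝ) ≤ Y := by linarith
  set x := 1 / (η * γ₁) with hx
  have hx0 : 0 < x := by positivity
  have hxη : 1 / η ≤ x := one_div_le_one_div_of_le (by positivity) (mul_le_of_le_one_right hη.le hγ₁1)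
  -- From `R γ₁ ≤ 1` and `η ^ 2 ≤ R`. Powers of `R` are thereby controlled by `x = 1 / (η γ₁)`, the
  -- argument of the logarithm.
  have hRx : (R : ℝ) ≤ x ^ 2 := by
    rw [hx, one_div, inv_pow, ← one_div, le_div_iff₀ (by positivity)]
    have h1 : (η * γ₁) ^ 2 = (η * η) * γ₁ ^ 2 := by ring
    rw [h1]
    calc (R : ℝ) * (η * η * γ₁ ^ 2) ≤ R * (R * γ₁ ^ 2) := by gcongr
      _ = (R * γ₁) ^ 2 := by ring
      _ ≤ 1 := pow_le_one₀ (by positivity) hγ₁R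
  have hx1 : 1 ≤ x := (one_le_sq_iff₀ hx0.le).1 (hR1.trans hRx)
  have hLx : L = Real.log x := Real.posLog_eq_log (by rwa [abs_of_pos hx0])
  have hL0 : 0 ≤ L := Real.posLog_nonneg
  have hlogn : 1 / 2 ≤ Real.log n := by
    have h1 := Real.log_two_gt_d9
    have h2 := Real.log_le_log two_pos hn2
    linarith
  have hxn : x ≤ (n : ℝ) ^ (2 * L) := by
    rw [Real.rpow_def_of_pos hn0]
    refine (Real.exp_log hx0).symm.le.trans ?_
    rw [← hLx]
    refine Real.exp_le_exp.2 ?_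
    have := mul_le_mul_of_nonneg_right hlogn hL0
    linarith
  have hR21 : (1 : ℝ) ≤ (R : ℝ) ^ 2 := one_le_pow₀ hR1
  have hE1 : 1 ≤ E := Real.one_le_rpow hn1 (by positivity)
  have hEpow : ∀ j : ℕ, E ^ j = (n : ℝ) ^ (j * (R : ℝ) ^ 2 * L) := fun j => by
    rw [hE, ← Real.rpow_mul_natCast hn0.le]; congr 1; ring
  have hxE : x ≤ E ^ 2 := by
    refine hxn.trans ?_
    rw [hEpow]
    refine Real.rpow_le_rpow_of_exponent_le hn1 ?_
    push_cast
    have : L ≤ (R : ℝ) ^ 2 * L := le_mul_of_one_le_left hL0 hR21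
    linarith
  have hE2 : 1 ≤ E ^ 2 := one_le_pow₀ hE1
  constructor
  · calc (2 + 1 / η) * (2 + R) * (2 + n) * (2 + τ) * (2 + 1 / (γ₁ * γ₂)) ≤
        (3 * E ^ 2) * (2 * Y) * (2 * Y) * (2 * Y) * (2 * Y) := by
          have h1 : 2 + 1 / η ≤ 3 * E ^ 2 := by linarith
          have h2 : 2 + (R : ℝ) ≤ 2 * Y := by linarith
          have h3 : 2 + (n : ℝ) ≤ 2 * Y := by linarith
          have h4 : 2 + τ ≤ 2 * Y := by linarith
          have h5 : 2 + 1 / (γ₁ * γ₂) ≤ 2 * Y := by linarith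
          gcongr
      _ = E ^ 2 * (48 * Y ^ 4) := by ring
      _ ≤ E ^ 2 * (Y ^ 6 * Y ^ 4) := by
          have : (48 : ℝ) ≤ Y ^ 6 := by
            calc (48 : ℝ) ≤ 2 ^ 6 := by norm_num
              _ ≤ _ := by gcongr
          gcongr
      _ = _ := by ring
  · have hnR : (n : ℝ) ^ (R * R) ≤ E ^ 4 * Y := by
      have hY1 : 1 ≤ Y := by linarith
      -- For `R = 1` the logarithm may vanish, and the single factor `n` is paid by `Y`. For `R ≥ 2`
      -- one has `x ^ 2 ≥ 2`, so the logarithm is at least `1 / 4`.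
      rcases hR.eq_or_lt with h | h
      · rw [← h]
        calc (n : ℝ) ^ (1 * 1) = 1 * n := by ring
          _ ≤ _ := mul_le_mul (one_le_pow₀ hE1) hYn hn0.le (by positivity)
      · have hR2 : (2 : ℝ) ≤ R := by exact_mod_cast h
        have h1 : 1 ≤ 4 * L := by
          have h2 := Real.log_le_log two_pos (hR2.trans hRx)
          rw [Real.log_pow, ← hLx] at h2
          have h3 := Real.log_two_gt_d9
          push_cast at h2
          linarith
        calc (n : ℝ) ^ (R * R) = (n : ℝ) ^ ((R : ℝ) ^ 2) := by
              rw [← Real.rpow_natCast]; push_cast; rw [sq]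
          _ ≤ E ^ 4 := by
              rw [hEpow]
              refine Real.rpow_le_rpow_of_exponent_le hn1 ?_
              push_cast
              have := mul_le_mul_of_nonneg_left h1 (sq_nonneg (R : ℝ))
              linarith
          _ ≤ E ^ 4 * Y := le_mul_of_one_le_right (by positivity) hY1
    -- `R ^ 2 ≤ x ^ 4 ≤ n ^ (8 L)`, and the power `R ^ 2` of this is `E ^ 8`. Here the product of `R
    -- ^ 2` and the logarithm in the exponent is needed.
    have hRR : ((R : ℝ) * R) ^ (R * R) ≤ E ^ 8 := by
      have h1 : (R : ℝ) * R ≤ (n : ℝ) ^ (8 * L) := by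
        calc (R : ℝ) * R ≤ x ^ 2 * x ^ 2 := by gcongr
          _ = x ^ 4 := by ring
          _ ≤ ((n : ℝ) ^ (2 * L)) ^ 4 := by gcongr
          _ = _ := by rw [← Real.rpow_mul_natCast hn0.le]; congr 1; push_cast; ring
      calc ((R : ℝ) * R) ^ (R * R) ≤ ((n : ℝ) ^ (8 * L)) ^ (R * R) := by gcongr
        _ = E ^ 8 := by
            rw [hEpow, ← Real.rpow_mul_natCast hn0.le]; congr 1; push_cast; ring
    calc ((n : ℝ) * (R * R + 1) + 1) ^ (R * R) ≤ (n * n * n * (R * R)) ^ (R * R) := by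
          have : (n : ℝ) * (R * R + 1) + 1 ≤ n * n * n * (R * R) := by
            have h1 : (1 : ℝ) ≤ R * R := one_le_mul_of_one_le_of_one_le hR1 hR1
            have h2 : (4 : ℝ) * n ≤ n * n * n := by
              have : (2 : ℝ) * 2 ≤ n * n := mul_le_mul hn2 hn2 zero_le_two hn0.le
              linarith [mul_le_mul_of_nonneg_right this hn0.le]
            have h3 := mul_le_mul_of_nonneg_right h2 (zero_le_one.trans h1)
            have h4 := mul_le_mul_of_nonneg_left h1 hn0.le
            linarith
          gcongr
      _ = ((n : ℝ) ^ (R * R)) ^ 3 * ((R : ℝ) * R) ^ (R * R) := by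
          rw [mul_pow, mul_pow, mul_pow]; ring
      _ ≤ (E ^ 4 * Y) ^ 3 * E ^ 8 := by gcongr
      _ = _ := by ring

/-- The size of the input parameters. -/
noncomputable def inputSize (η R n τ g : ℝ) : ℝ := (2 + η) * (2 + R) * (2 + n) * (2 + τ) * (2 + g)

lemma inputSize_bounds {η R n τ g : ℝ} (hη : 0 ≤ η) (hR : 0 ≤ R) (hn : 0 ≤ n) (hτ : 0 ≤ τ)
    (hg : 0 ≤ g) : 32 ≤ inputSize η R n τ g ∧ η ≤ inputSize η R n τ g ∧ R + 2 ≤ inputSize η R n τ g ∧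
      n + 2 ≤ inputSize η R n τ g ∧ τ ≤ inputSize η R n τ g ∧ g ≤ inputSize η R n τ g := by
  have key : ∀ a b c d e : ℝ, 0 ≤ a → 0 ≤ b → 0 ≤ c → 0 ≤ d → 0 ≤ e →
      16 * (2 + a) ≤ (2 + a) * ((2 + b) * (2 + c) * (2 + d) * (2 + e)) := by
    intro a b c d e ha hb hc hd he
    rw [mul_comm]
    refine mul_le_mul_of_nonneg_left ?_ (by linarith)
    calc (16 : ℝ) = 2 * 2 * 2 * 2 := by norm_num
      _ ≤ _ := by gcongr <;> linarith
  have h1 := key η R n τ g hη hR hn hτ hg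
  have h2 := key R η n τ g hR hη hn hτ hg
  have h3 := key n η R τ g hn hη hR hτ hg
  have h4 := key τ η R n g hτ hη hR hn hg
  have h5 := key g η R n τ hg hη hR hn hτ
  have e1 : inputSize η R n τ g = (2 + η) * ((2 + R) * (2 + n) * (2 + τ) * (2 + g)) := by
    unfold inputSize; ring
  have e2 : inputSize η R n τ g = (2 + R) * ((2 + η) * (2 + n) * (2 + τ) * (2 + g)) := by
    unfold inputSize; ring
  have e3 : inputSize η R n τ g = (2 + n) * ((2 + η) * (2 + R) * (2 + τ) * (2 + g)) := by
    unfold inputSize; ring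
  have e4 : inputSize η R n τ g = (2 + τ) * ((2 + η) * (2 + R) * (2 + n) * (2 + g)) := by
    unfold inputSize; ring
  have e5 : inputSize η R n τ g = (2 + g) * ((2 + η) * (2 + R) * (2 + n) * (2 + τ)) := by
    unfold inputSize; ring
  exact ⟨by linarith, by linarith, by linarith, by linarith, by linarith, by linarith⟩

/-- The number of samples as a polynomial. -/
noncomputable def samplePoly (e : ℕ) : MvPolynomial (Fin 5) ℝ :=
  (∏ i, (MvPolynomial.C 2 + MvPolynomial.X i)) ^ e

lemma eval_samplePoly (e : ℕ) (η R n τ g : ℝ) :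
    MvPolynomial.eval ![η, R, n, τ, g] (samplePoly e) = inputSize η R n τ g ^ e := by
  simp [samplePoly, Fin.prod_univ_five, inputSize]

/-- Integer consequences of the choice of the accuracy. -/
lemma accuracy_bounds {n R q B : ℕ} {Z : ℝ} (hZ : 32 ≤ Z) (hR : (R : ℝ) + 2 ≤ Z)
    (hn : (n : ℝ) + 2 ≤ Z) (hB : Z ^ (40 * (q + 1) + 6) ≤ B) :
    32 ≤ B ∧ R + 1 ≤ B ∧ R * R < B ∧ n < B ∧ n ^ (q + 1) + 1 < B ∧ n ^ (2 * q + 2 + 1) < B ∧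
      ((n * (R * R + 1) + 1) * (R * R) + 1) * (R * R + 1) ≤ B := by
  have hZ1 : 1 ≤ Z := by linarith
  have hR0 : (0 : ℝ) ≤ R := Nat.cast_nonneg R
  have hn0 : (0 : ℝ) ≤ n := Nat.cast_nonneg n
  have hpow : ∀ j ≤ 40 * (q + 1) + 6, Z ^ j ≤ B := fun j hj => (pow_le_pow_right₀ hZ1 hj).trans hB
  have h1 : Z ≤ B := by simpa using hpow 1 (by omega)
  have hRR : (R : ℝ) * R + 1 ≤ Z ^ 2 := by nlinarith
  have hZZ : ∀ j, Z ^ j + 1 ≤ Z ^ (j + 1) := fun j => by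
    have := one_le_pow₀ hZ1 (n := j)
    rw [pow_succ]; nlinarith
  have hnp : ∀ j, (n : ℝ) ^ j ≤ Z ^ j := fun j => pow_le_pow_left₀ hn0 (by linarith) j
  refine ⟨?_, ?_, ?_, ?_, ?_, ?_, ?_⟩
  · exact_mod_cast hZ.trans h1
  · exact_mod_cast (show (R : ℝ) + 1 ≤ B by linarith)
  · exact_mod_cast (show (R : ℝ) * R < B by linarith [hpow 2 (by omega)])
  · exact_mod_cast (show (n : ℝ) < B by linarith)
  · have := hpow (q + 1 + 1 + 1) (by omega)
    exact_mod_cast (show (n : ℝ) ^ (q + 1) + 1 < B by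
      linarith [hZZ (q + 1), hZZ (q + 1 + 1), hnp (q + 1)])
  · have := hpow (2 * q + 2 + 1 + 1) (by omega)
    exact_mod_cast (show (n : ℝ) ^ (2 * q + 2 + 1) < B by
      linarith [hZZ (2 * q + 2 + 1), hnp (2 * q + 2 + 1)])
  · have h2 : (n : ℝ) * (R * R + 1) + 1 ≤ Z ^ 4 := by
      calc (n : ℝ) * (R * R + 1) + 1 ≤ Z * Z ^ 2 + 1 := by gcongr; linarith
        _ = Z ^ 3 + 1 := by ring
        _ ≤ _ := hZZ 3
    have h3 : (((n : ℝ) * (R * R + 1) + 1) * (R * R) + 1) * (R * R + 1) ≤ Z ^ 9 := by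
      calc (((n : ℝ) * (R * R + 1) + 1) * (R * R) + 1) * (R * R + 1) ≤
          (Z ^ 4 * Z ^ 2 + 1) * Z ^ 2 := by gcongr; linarith
        _ = (Z ^ 6 + 1) * Z ^ 2 := by ring
        _ ≤ Z ^ 7 * Z ^ 2 := by gcongr; exact hZZ 6
        _ = _ := by ring
    exact_mod_cast h3.trans (hpow 9 (by omega))

/-! ### Assembly of the statistical and the algorithmic part -/

namespace HMM
variable {n R : ℕ} (H : HMM n R)

/-- Accurate frequencies yield accurate estimates. -/
lemma approx_of_empFreq {γ₁ γ₂ τ η Z : ℝ} {k q B : ℕ} {p : ℕ → ℝ} {Φ : ℕ → ℕ → ℝ}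
    {s : RealRAM.Mem} (hn : 2 ≤ n) (hγ₁ : 0 < γ₁) (hγ₂ : 0 < γ₂) (hτ : 0 < τ) (hη : 0 < η)
    (hγ₁1 : γ₁ ≤ 1) (hγ₂1 : γ₂ ≤ 1)
    (hw : ∀ r, γ₁ < H.w r) (hk : 1 ≤ k) (hkτ : k ≤ robustKRank τ H.M)
    (hRk : R ≤ 1 + (q + 1) * (k - 1)) (hP : γ₂ ≤ singVal R H.P)
    (hZ : 32 ≤ Z) (hηZ : 1 / η ≤ Z) (hRZ : (R : ℝ) + 2 ≤ Z) (hnZ : (n : ℝ) + 2 ≤ Z) (hτZ : τ ≤ Z)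
    (hgZ : 1 / (γ₁ * γ₂) ≤ Z) (hB : Z ^ (40 * (q + 1) + 6) ≤ B)
    (hp : ∀ x : Fin (2 * q + 2 + 1) → Fin n, |p (blockCode x) - H.obsProb x| ≤ 1 / (B : ℝ) ^ 37)
    (hs : SearchResult n R (n ^ (q + 1)) B (R * R + 1) ((n * (R * R + 1) + 1) ^ (R * R)) p Φ)
    (ho : RealRAM.Output n R (n ^ (q + 1)) B p Φ s) :
    H.Approx η (s.matrix 1 R R) (s.matrix 2 n R) (s.vector 3 R) := by
  obtain ⟨h32, hRB, -, -, hdB, -, hwt⟩ := accuracy_bounds hZ hRZ hnZ hB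
  obtain ⟨k₀, hk₀, hdual⟩ := H.exists_colDual hτ hk hkτ
  have hZ1 : 1 ≤ Z := by linarith
  have hZ2 : Z ≤ Z ^ 2 := by nlinarith
  have hB0 : (0 : ℝ) < B := by exact_mod_cast (show 0 < B by omega)
  have hγγ0 : 0 < γ₁ * γ₂ := mul_pos hγ₁ hγ₂
  have hg1 : 1 / γ₁ ≤ Z :=
    (one_div_le_one_div_of_le hγγ0 (mul_le_of_le_one_right hγ₁.le hγ₂1)).trans hgZ
  have hg2 : 1 / γ₂ ≤ Z :=
    (one_div_le_one_div_of_le hγγ0 (mul_le_of_le_one_left hγ₂.le hγ₁1)).trans hgZ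
  have hpow : ∀ j ≤ 40 * (q + 1) + 6, Z ^ j ≤ B := fun j hj => (pow_le_pow_right₀ hZ1 hj).trans hB
  have hZB : Z ≤ B := by simpa using hpow 1 (by omega)
  -- The conditioning constants are squares of `τ`, `1 / γ₁` and `1 / γ₂`, hence `X = Z ^ 2`, and `X
  -- ^ (20 (q + 1) + 3) = Z ^ (40 (q + 1) + 6)` is the size required of `B`.
  have hmix := H.mixture (q := q) (b := B) (X := Z ^ 2) (k := k₀) (p := p) (hk.trans hk₀)
    H.states_pos (by omega) (by linarith) (by linarith) (by linarith)
    (fun S hS r₀ hr₀ => by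
      obtain ⟨y, h1, h2⟩ := hdual S hS r₀ hr₀
      exact ⟨y, h1, h2.trans (pow_le_pow_left₀ hτ.le hτZ 2)⟩)
    (fun u => (H.nsq_le_of_le_singVal_trans hγ₂ hP u).trans
      (mul_le_mul_of_nonneg_right (pow_le_pow_left₀ (by positivity) hg2 2) (nsq_nonneg _ _)))
    (fun r => hγ₁.trans (hw r)) (fun r => by
      rw [← mul_pow]
      refine one_le_pow₀ ?_
      calc (1 : ℝ) = 1 / γ₁ * γ₁ := by field_simp
        _ ≤ Z * H.w r := mul_le_mul hg1 (hw r).le hγ₁.le (by linarith))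
    (hRk.trans (by gcongr)) h32 hdB.le hRB (by
      rw [← pow_mul]
      exact hpow _ (by omega)) hp
  refine H.approx_of_output hmix hn H.states_pos (fun r s hrs => ?_) hwt hs ho ?_
  -- Two different states exist here, and `k = 1` would force `R ≤ 1`.
  · have hk2 : 2 ≤ k := by
      by_contra! h
      have hk1 : k = 1 := by omega
      have hR1 : R ≤ 1 := by simpa [hk1] using hRk
      exact hrs (Fin.ext (by omega))
    refine H.exists_gap (hk2.trans hk₀) hdual ?_ hrs
    calc (n : ℝ) * τ ^ 2 < Z * Z ^ 2 := by
          refine mul_lt_mul (by linarith) (pow_le_pow_left₀ hτ.le hτZ 2) (by positivity) (by linarith)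
      _ = Z ^ 3 := by ring
      _ ≤ Z ^ 6 := pow_le_pow_right₀ hZ1 (by norm_num)
      _ = (Z ^ 3) ^ 2 := by ring
      _ ≤ (B : ℝ) ^ 2 := pow_le_pow_left₀ (by positivity) (hpow 3 (by omega)) 2
  · rw [one_div_le hB0 hη]
    exact hηZ.trans hZB

end HMM

/-- The number of samples suffices for the required accuracy. -/
lemma samples_suffice {n c B : ℕ} {θ N : ℝ} (hn : 0 < n) (hθ : 2 ≤ θ) (hnθ : (n : ℝ) ≤ θ)
    (hB0 : 0 < B) (hB : (B : ℝ) ≤ 2 * θ) (hN : θ ^ (c + 148) ≤ N) :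
    1 - 1 / (n : ℝ) ^ c ≤ 1 - 1 / (N * (1 / (B : ℝ) ^ 37) ^ 2) := by
  have hB1 : (0 : ℝ) < B := by exact_mod_cast hB0
  have hn1 : (0 : ℝ) < n := by exact_mod_cast hn
  -- `2 θ ≤ θ ^ 2`. The exponent `148` is `37 * 2 * 2`: the accuracy, squared in Chebyshev's
  -- inequality, in terms of `θ ^ 2`.
  have hB2 : (B : ℝ) ≤ θ ^ 2 := by nlinarith
  refine sub_le_sub_left (one_div_le_one_div_of_le (by positivity) ?_) 1
  rw [div_pow, one_pow, ← pow_mul, mul_one_div, le_div_iff₀ (by positivity)]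
  calc (n : ℝ) ^ c * (B : ℝ) ^ (37 * 2) ≤ θ ^ c * (θ ^ 2) ^ (37 * 2) := by gcongr
    _ = θ ^ (c + 148) := by rw [← pow_mul, ← pow_add]
    _ ≤ N := hN

theorem corollary4 (δ : ℝ) (hδ : 0 < δ) (c : ℕ) :
    ∃ (ϑ : MvPolynomial (Fin 5) ℝ) (prog : RealRAM.Prog) (K : ℕ),
      ∀ (n R : ℕ) (H : HMM n R) (γ₁ γ₂ τ η : ℝ) (k : ℕ),
        0 < γ₁ → 0 < γ₂ → 0 < τ → 0 < η →
        (∀ r, γ₁ < H.w r) →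
        k ≤ robustKRank τ H.M → δ * R ≤ k →
        (R : ℝ) ≤ (⌈1 / δ⌉₊ + 1) * ((k : ℝ) - 1) + 1 →
        γ₂ ≤ singVal R H.P →
        ∀ N : ℕ, N = ⌈MvPolynomial.eval ![1 / η, (R : ℝ), (n : ℝ), τ, 1 / (γ₁ * γ₂)] ϑ⌉₊ →
          (∀ S : Fin N → Fin (2 * ⌈1 / δ⌉₊ + 3) → Fin n,
            ∃ (t : ℕ) (s : RealRAM.Mem),
              RealRAM.Exec prog (RealRAM.input n R η τ γ₁ γ₂ S) t s ∧
              (t : ℝ) ≤ K * (n : ℝ) ^ ((K : ℝ) * (R : ℝ) ^ 2 * Real.posLog (1 / (η * γ₁))) *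
                (n * τ / (γ₁ * γ₂)) ^ K) ∧
          1 - 1 / (n : ℝ) ^ c ≤
            H.sampleProb {S : Fin N → Fin (2 * ⌈1 / δ⌉₊ + 3) → Fin n |
              ∃ (t : ℕ) (s : RealRAM.Mem),
                RealRAM.Exec prog (RealRAM.input n R η τ γ₁ γ₂ S) t s ∧
                H.Approx η (s.matrix 1 R R) (s.matrix 2 n R) (s.vector 3 R)} := by
  set q := ⌈1 / δ⌉₊ with hq
  obtain ⟨κ, hκ⟩ : ∃ κ, κ = 40 * (q + 1) + 6 := ⟨_, rfl⟩
  obtain ⟨D, hD⟩ : ∃ D, D = c + 148 := ⟨_, rfl⟩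
  obtain ⟨K₀, hK₀⟩ := RealRAM.runs_learnProg D (q + 1) (2 * q + 3)
  refine ⟨samplePoly (κ * D), RealRAM.learnProg D (q + 1) (2 * q + 3),
    20 + 10 * κ * K₀ + K₀, fun n R H γ₁ γ₂ τ η k hγ₁ hγ₂ hτ hη hw hkτ _ hRk hP N hN => ?_⟩
  -- `K` dominates the exponents `20 + 2 κ K₀` of `E` and `4 + 10 κ K₀ + K₀` of `Y` that come out
  -- below, and the `16` steps of a trivial run.
  obtain ⟨K, hK⟩ : ∃ K, K = 20 + 10 * κ * K₀ + K₀ := ⟨_, rfl⟩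
  rw [← hK]
  have hn0 := H.observations_pos
  have hR0 := H.states_pos
  have hn1 : (1 : ℝ) ≤ n := by exact_mod_cast hn0
  have hR1 : (1 : ℝ) ≤ R := by exact_mod_cast hR0
  -- The subtraction `k - 1` in the hypothesis is real, so `k = 0` would give `R ≤ -q`.
  have hk : 1 ≤ k := by
    by_contra! h
    have : k = 0 := by omega
    rw [this] at hRk
    have hq0 : (0 : ℝ) ≤ q := Nat.cast_nonneg q
    push_cast at hRk
    linarith
  have hRk' : R ≤ 1 + (q + 1) * (k - 1) := by
    have : (R : ℝ) ≤ ((1 + (q + 1) * (k - 1) : ℕ) : ℝ) := by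
      push_cast [Nat.cast_sub hk]
      linarith
    exact_mod_cast this
  obtain ⟨k₀, hk₀, hdual⟩ := H.exists_colDual hτ hk hkτ
  have hτ1 : 1 ≤ τ := (one_le_sq_iff₀ hτ.le).1 (H.one_le_of_colDual (hk.trans hk₀) hdual)
  have hγ₂1 := H.le_one_of_le_singVal hγ₂ (fun r => hγ₁.trans (hw r)) hP
  have hγ₁R := H.card_mul_le_one hw
  have hγ₁1 : γ₁ ≤ 1 := (le_mul_of_one_le_left hγ₁.le hR1).trans hγ₁R
  have hγγ0 : 0 < γ₁ * γ₂ := mul_pos hγ₁ hγ₂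
  set Z := inputSize (1 / η) R n τ (1 / (γ₁ * γ₂)) with hZdef
  obtain ⟨hZ, hηZ, hRZ, hnZ, hτZ, hgZ⟩ := inputSize_bounds (η := 1 / η) (R := R) (n := n) (τ := τ)
    (g := 1 / (γ₁ * γ₂)) (by positivity) (by positivity) (by positivity) hτ.le (by positivity)
  rw [← hZdef] at hZ hηZ hRZ hnZ hτZ hgZ
  have hZ1 : 1 ≤ Z := by linarith
  rw [eval_samplePoly, ← hZdef, pow_mul] at hN
  have hZθ : Z ≤ Z ^ κ := le_self_pow₀ hZ1 (by omega)
  obtain ⟨B, hNB, hBN, hθB, hBθ⟩ := exists_root_ceil_pow (D := D) (by omega) (hZ1.trans hZθ)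
  rw [← hN] at hNB hBN
  obtain ⟨h32, -, hRRB, hnB, hdB, hmB, -⟩ := accuracy_bounds (q := q) hZ hRZ hnZ (hκ ▸ hθB)
  set E := (n : ℝ) ^ ((R : ℝ) ^ 2 * Real.posLog (1 / (η * γ₁))) with hE
  set Y := n * τ / (γ₁ * γ₂) with hY
  have hE1 : 1 ≤ E := Real.one_le_rpow hn1 (mul_nonneg (sq_nonneg _) Real.posLog_nonneg)
  have hY1 : 1 ≤ Y := by
    rw [hY, le_div_iff₀ hγγ0, one_mul]
    calc γ₁ * γ₂ ≤ 1 * 1 := mul_le_mul hγ₁1 hγ₂1 hγ₂.le zero_le_one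
      _ ≤ n * τ := mul_le_mul hn1 hτ1 zero_le_one (by positivity)
  have hbound : (n : ℝ) ^ ((K : ℝ) * (R : ℝ) ^ 2 * Real.posLog (1 / (η * γ₁))) = E ^ K := by
    rw [hE, ← Real.rpow_mul_natCast (by positivity)]
    congr 1; ring
  rw [hbound]
  by_cases htriv : n < 2 ∨ (R : ℝ) < η * η
  · constructor
    · intro S
      obtain ⟨t, s, h1, h2, -⟩ := RealRAM.learnProg_trivial (τ := τ) (γ₁ := γ₁) (γ₂ := γ₂) D (q + 1)
        S htriv
      refine ⟨t, s, h1, ?_⟩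
      calc (t : ℝ) ≤ 16 := by exact_mod_cast h2
        _ ≤ K := by exact_mod_cast (show 16 ≤ K by omega)
        _ ≤ K * E ^ K := le_mul_of_one_le_right (Nat.cast_nonneg _) (one_le_pow₀ hE1)
        _ ≤ _ := le_mul_of_one_le_right (by positivity) (one_le_pow₀ hY1)
    · by_cases hn : n < 2
      -- For `n = 1` the required probability is `1 - 1 / 1 ^ c = 0`.
      · have : n = 1 := by omega
        refine le_trans (le_of_eq ?_) (H.sampleProb_nonneg _)
        simp [this]
      · have hRη : (R : ℝ) < η * η := htriv.resolve_left hn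
        have h1 : 1 - 1 / (n : ℝ) ^ c ≤ 1 := sub_le_self _ (by positivity)
        refine h1.trans ((H.sampleProb_univ (2 * q + 2) N).symm.le.trans
          (H.sampleProb_mono fun S _ => ?_))
        obtain ⟨t, s, h1, -, h3⟩ := RealRAM.learnProg_trivial (τ := τ) (γ₁ := γ₁) (γ₂ := γ₂) D (q + 1)
          S htriv
        refine ⟨t, s, h1, ?_⟩
        have := H.approx_zero hη hRη
        convert this using 1 <;> subst h3 <;> ext <;>
          simp [RealRAM.Mem.matrix, RealRAM.Mem.vector, RealRAM.input]
  · rw [not_or, not_lt, not_lt] at htriv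
    obtain ⟨hn2, hηR⟩ := htriv
    -- The run is analysed for every sample sequence, as the time bound is not probabilistic.
    have hrun := fun S : Fin N → Fin (2 * q + 3) → Fin n => hK₀ (τ := τ) (γ₁ := γ₁) (γ₂ := γ₂) S hn2
      hηR hR0 (by omega) (by omega) hNB hBN hRRB hnB hdB hmB
    constructor
    · intro S
      obtain ⟨t, s, h1, h2, -⟩ := hrun S
      refine ⟨t, s, h1, ?_⟩
      obtain ⟨hZE, hG⟩ := running_time_bounds hn2 hR0 hη hγ₁ hγ₂ hτ1 hγ₁R hγ₂1 hηR
      have hY2 : 2 ≤ Y := by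
        rw [hY, le_div_iff₀ hγγ0]
        have hn2' : (2 : ℝ) ≤ n := by exact_mod_cast hn2
        calc 2 * (γ₁ * γ₂) ≤ 2 * (1 * 1) :=
              mul_le_mul_of_nonneg_left (mul_le_mul hγ₁1 hγ₂1 hγ₂.le zero_le_one) zero_le_two
          _ = 2 * 1 := by norm_num
          _ ≤ n * τ := mul_le_mul hn2' hτ1 zero_le_one (by positivity)
      have hG1 : ((n : ℝ) * (R * R + 1) + 1) ^ (R * R) + 1 ≤ Y * (E ^ 20 * Y ^ 3) := by
        have h3 : 1 ≤ E ^ 20 * Y ^ 3 :=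
          one_le_mul_of_one_le_of_one_le (one_le_pow₀ hE1) (one_le_pow₀ hY1)
        have h4 := mul_le_mul_of_nonneg_right hY2 (zero_le_one.trans h3)
        linarith
      have hB1 : (B : ℝ) ≤ Y * (E ^ 2 * Y ^ 10) ^ κ := by
        refine hBθ.trans ?_
        have h3 : Z ≤ E ^ 2 * Y ^ 10 := hZE
        replace h3 : Z ^ κ ≤ (E ^ 2 * Y ^ 10) ^ κ := pow_le_pow_left₀ (by linarith) h3 κ
        exact mul_le_mul hY2 h3 (by positivity) (by positivity)
      calc (t : ℝ) ≤ (((n : ℝ) * (R * R + 1) + 1) ^ (R * R) + 1) * (B : ℝ) ^ K₀ := by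
            exact_mod_cast h2
        _ ≤ (Y * (E ^ 20 * Y ^ 3)) * (Y * (E ^ 2 * Y ^ 10) ^ κ) ^ K₀ := by gcongr
        _ = E ^ (20 + 2 * κ * K₀) * Y ^ (4 + 10 * κ * K₀ + K₀) := by
            rw [mul_pow, ← pow_mul, mul_pow, ← pow_mul, ← pow_mul]
            ring
        _ ≤ E ^ K * Y ^ K := by
            have h3 : 20 + 2 * κ * K₀ ≤ K := by
              rw [hK]; nlinarith [Nat.zero_le (κ * K₀)]
            have h4 : 4 + 10 * κ * K₀ + K₀ ≤ K := by omega
            exact mul_le_mul (pow_le_pow_right₀ hE1 h3) (pow_le_pow_right₀ hY1 h4) (by positivity)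
              (by positivity)
        _ = 1 * E ^ K * Y ^ K := by rw [one_mul]
        _ ≤ _ := by
            have : (1 : ℝ) ≤ K := by exact_mod_cast (show 1 ≤ K by omega)
            gcongr
    -- The event that all frequencies are `B ^ (-37)`-accurate is likely enough, and on it the
    -- output is accurate.
    · have hNθ : (Z ^ κ) ^ D ≤ N := hN ▸ Nat.le_ceil _
      have hN0 : 0 < N := by
        have : (0 : ℝ) < N := lt_of_lt_of_le (by positivity) hNθ
        exact_mod_cast this
      have hB0 : 0 < B := by omega
      refine (samples_suffice hn0 (by linarith) (by linarith) hB0 hBθ (hD ▸ hNθ)).trans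
        ((H.le_sampleProb_empFreq (l := 2 * q + 2) hN0 (ε := 1 / (B : ℝ) ^ 37)
          (by positivity)).trans (H.sampleProb_mono fun S hS => ?_))
      obtain ⟨t, s, h1, -, p, Φ, hp, hs, ho⟩ := hrun S
      refine ⟨t, s, h1, H.approx_of_empFreq hn2 hγ₁ hγ₂ hτ hη hγ₁1 hγ₂1 hw hk hkτ hRk' hP hZ hηZ hRZ
        hnZ hτZ hgZ (hκ ▸ hθB) (fun x => ?_) hs ho⟩
      rw [hp]
      exact hS x
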